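/- Let $k$ be a commutative ring. All operads are symmetric $k$-linear operads $\mathcal P=(\mathcal P(n))_{n\ge 1}$ without operations of arity $0$. Let $\mathrm{Dend}$ be the operad of dendriform algebras: it is generated by two binary operations $\prec,\succ$ subject to $$(x\prec y)\prec z=x\prec(y\prec z)+x\prec(y\succ z),\quad (x\succ y)\prec z=x\succ(y\prec z),\quad x\succ(y\succ z)=(x\succ y)\succ z+(x\prec y)\succ z .$$ Let $\mathrm{Brace}$ be the operad of brace algebras: it is generated by operations $\mathrm{Corl}_n=\{x_1\mid x_2,\dots,x_{n+1}\}$ of arity $n+1$, for $n\ge 1$, subject, for all $n,m\ge1$, to $$\{\{z\mid x_1,\dots,x_n\}\mid y_1,\dots,y_m\}=\sum\{z\mid Y_0,\{x_1\mid Y_1\},Y_2,\{x_2\mid Y_3\},Y_4,\dots,Y_{2n-2},\{x_n\mid Y_{2n-1}\},Y_{2n}\},$$ where the sum runs over all partitions of the ordered set $(y_1,\dots,y_m)$ into successive, possibly empty, intervals $Y_0,\dots,Y_{2n}$, and $\{x\mid\ \}=x$. Let $\mathrm{Brace}_+=(\mathrm{Brace}(n))_{n\ge2}$. Put $\nearrow(x_1)=\searrow(x_1)=x_1$,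 $\nearrow(x_1,\dots,x_n)=x_1\prec\nearrow(x_2,\dots,x_n)$ and $\searrow(x_1,\dots,x_{n+1})=\searrow(x_1,\dots,x_n)\succ x_{n+1}$. There is a unique morphism of operads $\psi:\mathrm{Brace}\to\mathrm{Dend}$ such that, for all $n\ge1$, $$\psi(\mathrm{Corl}_n)(x_1,\dots,x_{n+1})=\sum_{i=1}^{n+1}(-1)^{i-1}\nearrow(x_2,\dots,x_i)\succ x_1\prec\searrow(x_{i+1},\dots,x_{n+1}),$$ where the factor of an empty list of arguments is omitted: the terms for $i=1$ and $i=n+1$ are $x_1\prec\searrow(x_2,\dots,x_{n+1})$ and $(-1)^n\nearrow(x_2,\dots,x_{n+1})\succ x_1$. A left ideal of an operad $\mathcal P$ is a sub-$\mathbb S$-module $\mathcal J$ such that $e\circ_i f\in\mathcal J$ for all $e\in\mathcal P(m)$, $f\in\mathcal J(n)$ and $1\le i\le m$; it is a (two-sided) ideal if moreover $f\circ_i e\in\mathcal J$ for all $f\in\mathcal J(m)$, $e\in\mathcal P(n)$ and $1\le i\le m$. **Proposition.** The left ideal $\mathcal J$ of $\mathrm{Dend}$ generated by $\psi(\mathrm{Brace}_+)$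 is a two-sided ideal of the operad $\mathrm{Dend}$. -/

import Mathlib

namespace BraceDend

universe u v w

/-! ## Operads

Symmetric `k`-linear operads without operations of arity zero, given by their partial compositions.
Inputs are labelled by arbitrary finite nonempty sets. -/

section Relabelling

variable {I J L : Type}

/-- `J ≃ ({*} ∖ *) ⊔ J`. -/
def oneCompEquiv (J : Type) : J ≃ {x : Unit // x ≠ ()} ⊕ J where
  toFun j := Sum.inr j
  invFun
    | Sum.inl x => absurd rfl x.2
    | Sum.inr j => j
  left_inv _ := rfl
  right_inv := by
    rintro (x | j)
    · exact absurd rfl x.2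
    · rfl

/-- `I ≃ (I ∖ i) ⊔ {*}`, sending `i` to `*`. -/
noncomputable def compOneEquiv (i : I) : I ≃ {x : I // x ≠ i} ⊕ Unit :=
  (Equiv.ofBijective
    (Sum.elim (fun x : {x : I // x ≠ i} => x.1) (fun _ : Unit => i))
    ⟨by
      rintro (x | x) (y | y) h
      · exact congrArg Sum.inl (Subtype.ext h)
      · exact absurd h x.2
      · exact absurd h.symm y.2
      · rfl, by
      intro x
      by_cases h : x = i
      · exact ⟨Sum.inr (), h.symm⟩
      · exact ⟨Sum.inl ⟨x, h⟩, rfl⟩⟩).symm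

/-- `(I ∖ i) ⊔ ((J ∖ j) ⊔ L) ≃ (((I ∖ i) ⊔ J) ∖ j) ⊔ L`. -/
def seqEquiv (i : I) (j : J) (L : Type) :
    {x : I // x ≠ i} ⊕ ({y : J // y ≠ j} ⊕ L) ≃
      {z : {x : I // x ≠ i} ⊕ J // z ≠ Sum.inr j} ⊕ L where
  toFun
    | Sum.inl x => Sum.inl ⟨Sum.inl x, by simp⟩
    | Sum.inr (Sum.inl y) => Sum.inl ⟨Sum.inr y.1, by simpa using y.2⟩
    | Sum.inr (Sum.inr l) => Sum.inr l
  invFun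
    | Sum.inl ⟨Sum.inl x, _⟩ => Sum.inl x
    | Sum.inl ⟨Sum.inr y, h⟩ => Sum.inr (Sum.inl ⟨y, by simpa using h⟩)
    | Sum.inr l => Sum.inr (Sum.inr l)
  left_inv := by rintro (x | ⟨y, h⟩ | l) <;> rfl
  right_inv := by rintro (⟨x | y, h⟩ | l) <;> rfl

/-- `(((I ∖ i') ⊔ L) ∖ i) ⊔ J ≃ (((I ∖ i) ⊔ J) ∖ i') ⊔ L`. -/
def parEquiv {i i' : I} (hi : i ≠ i') (J L : Type) :
    {z : {x : I // x ≠ i'} ⊕ L // z ≠ Sum.inl ⟨i, hi⟩} ⊕ J ≃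
      {z : {x : I // x ≠ i} ⊕ J // z ≠ Sum.inl ⟨i', hi.symm⟩} ⊕ L where
  toFun
    | Sum.inl ⟨Sum.inl x, h⟩ =>
        Sum.inl ⟨Sum.inl ⟨x.1, fun e => h (congrArg Sum.inl (Subtype.ext e))⟩,
          fun e => x.2 (congrArg Subtype.val (Sum.inl.inj e))⟩
    | Sum.inl ⟨Sum.inr l, _⟩ => Sum.inr l
    | Sum.inr j => Sum.inl ⟨Sum.inr j, by simp⟩
  invFun
    | Sum.inl ⟨Sum.inl x, h⟩ =>
        Sum.inl ⟨Sum.inl ⟨x.1, fun e => h (congrArg Sum.inl (Subtype.ext e))⟩,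
          fun e => x.2 (congrArg Subtype.val (Sum.inl.inj e))⟩
    | Sum.inl ⟨Sum.inr j, _⟩ => Sum.inr j
    | Sum.inr l => Sum.inl ⟨Sum.inr l, by simp⟩
  left_inv := by rintro (⟨x | l, h⟩ | j) <;> rfl
  right_inv := by rintro (⟨x | j, h⟩ | l) <;> rfl

/-- The bijection `(I ∖ i) ⊔ J ≃ (I' ∖ σ i) ⊔ J'` induced by `σ : I ≃ I'` and `τ : J ≃ J'`. -/
def equivariantEquiv {I' J' : Type} (σ : I ≃ I') (τ : J ≃ J') (i : I) :
    {x : I // x ≠ i} ⊕ J ≃ {x : I' // x ≠ σ i} ⊕ J' :=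
  Equiv.sumCongr (σ.subtypeEquiv fun x => by simp) τ

end Relabelling

/-- A symmetric operad in `k`-modules: `obj I` is the module of operations with inputs labelled by
the finite nonempty set `I`, bijections act by relabelling, and `comp i p q` is the partial
composition `p ∘ᵢ q`, with inputs labelled by `(I ∖ i) ⊔ J`. -/
structure Operad (k : Type u) [CommRing k] where
  obj : (I : Type) → [Finite I] → [Nonempty I] → Type v
  [addCommGroup : ∀ (I : Type) [Finite I] [Nonempty I], AddCommGroup (obj I)]
  [module : ∀ (I : Type) [Finite I] [Nonempty I], Module k (obj I)]
  map : ∀ {I J : Type} [Finite I] [Nonempty I] [Finite J] [Nonempty J],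
    I ≃ J → obj I →ₗ[k] obj J
  one : obj Unit
  comp : ∀ {I J : Type} [Finite I] [Nonempty I] [Finite J] [Nonempty J] (i : I),
    obj I →ₗ[k] obj J →ₗ[k] obj ({x : I // x ≠ i} ⊕ J)
  map_refl : ∀ {I : Type} [Finite I] [Nonempty I] (p : obj I), map (Equiv.refl I) p = p
  map_trans : ∀ {I J L : Type} [Finite I] [Nonempty I] [Finite J] [Nonempty J]
    [Finite L] [Nonempty L] (σ : I ≃ J) (τ : J ≃ L) (p : obj I),
    map (σ.trans τ) p = map τ (map σ p)
  comp_map : ∀ {I I' J J' : Type} [Finite I] [Nonempty I] [Finite I'] [Nonempty I']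
    [Finite J] [Nonempty J] [Finite J'] [Nonempty J'] (σ : I ≃ I') (τ : J ≃ J') (i : I)
    (p : obj I) (q : obj J),
    comp (σ i) (map σ p) (map τ q) = map (equivariantEquiv σ τ i) (comp i p q)
  one_comp : ∀ {J : Type} [Finite J] [Nonempty J] (q : obj J),
    comp () one q = map (oneCompEquiv J) q
  comp_one : ∀ {I : Type} [Finite I] [Nonempty I] (i : I) (p : obj I),
    comp i p one = map (compOneEquiv i) p
  comp_comp_seq : ∀ {I J L : Type} [Finite I] [Nonempty I] [Finite J] [Nonempty J]
    [Finite L] [Nonempty L] (i : I) (j : J) (p : obj I) (q : obj J) (r : obj L),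
    comp (Sum.inr j) (comp i p q) r = map (seqEquiv i j L) (comp i p (comp j q r))
  comp_comp_par : ∀ {I J L : Type} [Finite I] [Nonempty I] [Finite J] [Nonempty J]
    [Finite L] [Nonempty L] {i i' : I} (hi : i ≠ i') (p : obj I) (q : obj J) (r : obj L),
    comp (Sum.inl ⟨i', hi.symm⟩) (comp i p q) r =
      map (parEquiv hi J L) (comp (Sum.inl ⟨i, hi⟩) (comp i' p r) q)

attribute [instance] Operad.addCommGroup Operad.module

namespace Operad

variable {k : Type u} [CommRing k]

/-- Morphisms of operads. -/
structure Hom (P : Operad.{u, v} k) (Q : Operad.{u, w} k) where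
  app : ∀ (I : Type) [Finite I] [Nonempty I], P.obj I →ₗ[k] Q.obj I
  app_map : ∀ {I J : Type} [Finite I] [Nonempty I] [Finite J] [Nonempty J] (σ : I ≃ J)
    (p : P.obj I), app J (P.map σ p) = Q.map σ (app I p)
  app_one : app Unit P.one = Q.one
  app_comp : ∀ {I J : Type} [Finite I] [Nonempty I] [Finite J] [Nonempty J] (i : I)
    (p : P.obj I) (q : P.obj J), app _ (P.comp i p q) = Q.comp i (app I p) (app J q)

/-- A sub-`𝕊`-module of an operad: submodules stable under relabelling. -/
structure SubSModule (P : Operad.{u, v} k) where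
  carrier : ∀ (I : Type) [Finite I] [Nonempty I], Submodule k (P.obj I)
  map_mem : ∀ {I J : Type} [Finite I] [Nonempty I] [Finite J] [Nonempty J] (σ : I ≃ J)
    {p : P.obj I}, p ∈ carrier I → P.map σ p ∈ carrier J

variable {P : Operad.{u, v} k}

/-- `𝒥` is a left ideal: `e ∘ᵢ f ∈ 𝒥` whenever `f ∈ 𝒥`. -/
def SubSModule.IsLeftIdeal (𝒥 : SubSModule P) : Prop :=
  ∀ ⦃I J : Type⦄ [Finite I] [Nonempty I] [Finite J] [Nonempty J] (i : I)
    (e : P.obj I) (f : P.obj J), f ∈ 𝒥.carrier J → P.comp i e f ∈ 𝒥.carrier _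

/-- `𝒥` is a (two-sided) operad ideal: `e ∘ᵢ f ∈ 𝒥` whenever `e ∈ 𝒥` or `f ∈ 𝒥`. -/
def SubSModule.IsIdeal (𝒥 : SubSModule P) : Prop :=
  ∀ ⦃I J : Type⦄ [Finite I] [Nonempty I] [Finite J] [Nonempty J] (i : I)
    (e : P.obj I) (f : P.obj J), (e ∈ 𝒥.carrier I ∨ f ∈ 𝒥.carrier J) →
      P.comp i e f ∈ 𝒥.carrier _

/-- The smallest sub-`𝕊`-module that satisfies `C` and contains `S`, when there is one: the
intersection of all of them. -/
def spanOf (P : Operad.{u, v} k) (C : SubSModule P → Prop)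
    (S : ∀ (I : Type) [Finite I] [Nonempty I], Set (P.obj I)) : SubSModule P where
  carrier I _ _ := sInf {N | ∃ 𝒥 : SubSModule P, C 𝒥 ∧
    (∀ (J : Type) [Finite J] [Nonempty J], S J ⊆ 𝒥.carrier J) ∧ N = 𝒥.carrier I}
  map_mem := by
    intro I J _ _ _ _ σ p hp
    rw [Submodule.mem_sInf] at hp ⊢
    rintro N ⟨𝒥, hC, hS, rfl⟩
    exact 𝒥.map_mem σ (hp _ ⟨𝒥, hC, hS, rfl⟩)

theorem mem_spanOf {C : SubSModule P → Prop}
    {S : ∀ (I : Type) [Finite I] [Nonempty I], Set (P.obj I)}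
    {I : Type} [Finite I] [Nonempty I] {p : P.obj I} :
    p ∈ (P.spanOf C S).carrier I ↔ ∀ 𝒥 : SubSModule P, C 𝒥 →
      (∀ (J : Type) [Finite J] [Nonempty J], S J ⊆ 𝒥.carrier J) → p ∈ 𝒥.carrier I := by
  refine Submodule.mem_sInf.trans ⟨fun h 𝒥 hC hS => h _ ⟨𝒥, hC, hS, rfl⟩, ?_⟩
  rintro h N ⟨𝒥, hC, hS, rfl⟩
  exact h 𝒥 hC hS

/-- The left ideal generated by `S`. -/
def leftIdealSpan (P : Operad.{u, v} k)
    (S : ∀ (I : Type) [Finite I] [Nonempty I], Set (P.obj I)) : SubSModule P :=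
  P.spanOf SubSModule.IsLeftIdeal S

/-- The two-sided ideal generated by `S`. -/
def idealSpan (P : Operad.{u, v} k)
    (S : ∀ (I : Type) [Finite I] [Nonempty I], Set (P.obj I)) : SubSModule P :=
  P.spanOf SubSModule.IsIdeal S

theorem leftIdealSpan_isLeftIdeal (S : ∀ (I : Type) [Finite I] [Nonempty I], Set (P.obj I)) :
    (P.leftIdealSpan S).IsLeftIdeal := by
  intro I J _ _ _ _ i e f hf
  refine mem_spanOf.2 fun 𝒥 hC hS => hC i e f (mem_spanOf.1 hf 𝒥 hC hS)

theorem idealSpan_isIdeal (S : ∀ (I : Type) [Finite I] [Nonempty I], Set (P.obj I)) :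
    (P.idealSpan S).IsIdeal := by
  intro I J _ _ _ _ i e f hf
  refine mem_spanOf.2 fun 𝒥 hC hS => hC i e f ?_
  exact hf.imp (fun h => mem_spanOf.1 h 𝒥 hC hS) (fun h => mem_spanOf.1 h 𝒥 hC hS)

/-- The partial composition of the quotient by an ideal. -/
def quotientComp (𝒥 : SubSModule P) (h𝒥 : 𝒥.IsIdeal) {I J : Type} [Finite I] [Nonempty I]
    [Finite J] [Nonempty J] (i : I) :
    (P.obj I ⧸ 𝒥.carrier I) →ₗ[k] (P.obj J ⧸ 𝒥.carrier J) →ₗ[k]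
      (P.obj ({x : I // x ≠ i} ⊕ J) ⧸ 𝒥.carrier ({x : I // x ≠ i} ⊕ J)) :=
  Submodule.liftQ (𝒥.carrier I)
    (LinearMap.flip (Submodule.liftQ (𝒥.carrier J)
      (LinearMap.flip ((P.comp i).compr₂ (Submodule.mkQ (𝒥.carrier ({x : I // x ≠ i} ⊕ J)))))
      (fun f hf => by
        refine LinearMap.mem_ker.2 (LinearMap.ext fun e => ?_)
        exact (Submodule.Quotient.mk_eq_zero _).2 (h𝒥 i e f (Or.inr hf)))))
    (fun e he => by
      refine LinearMap.mem_ker.2 (LinearMap.ext fun f => ?_)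
      obtain ⟨f, rfl⟩ := Submodule.Quotient.mk_surjective _ f
      exact (Submodule.Quotient.mk_eq_zero _).2 (h𝒥 i e f (Or.inl he)))

theorem quotientComp_mk (𝒥 : SubSModule P) (h𝒥 : 𝒥.IsIdeal) {I J : Type} [Finite I] [Nonempty I]
    [Finite J] [Nonempty J] (i : I) (p : P.obj I) (q : P.obj J) :
    quotientComp 𝒥 h𝒥 i (Submodule.Quotient.mk p) (Submodule.Quotient.mk q) =
      Submodule.Quotient.mk (P.comp i p q) := rfl

/-- The relabelling maps of the quotient. -/
def quotientMap (𝒥 : SubSModule P) {I J : Type} [Finite I] [Nonempty I]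
    [Finite J] [Nonempty J] (σ : I ≃ J) :
    (P.obj I ⧸ 𝒥.carrier I) →ₗ[k] (P.obj J ⧸ 𝒥.carrier J) :=
  Submodule.mapQ (𝒥.carrier I) (𝒥.carrier J) (P.map σ) fun _ hp => 𝒥.map_mem σ hp

theorem quotientMap_mk (𝒥 : SubSModule P) {I J : Type} [Finite I] [Nonempty I]
    [Finite J] [Nonempty J] (σ : I ≃ J) (p : P.obj I) :
    quotientMap 𝒥 σ (Submodule.Quotient.mk p) = Submodule.Quotient.mk (P.map σ p) := rfl

/-- The quotient of an operad by an ideal. -/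
def quotient (P : Operad.{u, v} k) (𝒥 : SubSModule P) (h𝒥 : 𝒥.IsIdeal) : Operad.{u, v} k where
  obj I _ _ := P.obj I ⧸ 𝒥.carrier I
  map σ := quotientMap 𝒥 σ
  one := Submodule.Quotient.mk P.one
  comp i := quotientComp 𝒥 h𝒥 i
  map_refl := by
    intro I _ _ p
    obtain ⟨p, rfl⟩ := Submodule.Quotient.mk_surjective _ p
    simp only [quotientMap_mk, P.map_refl]
  map_trans := by
    intro I J L _ _ _ _ _ _ σ τ p
    obtain ⟨p, rfl⟩ := Submodule.Quotient.mk_surjective _ p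
    simp only [quotientMap_mk, P.map_trans]
  comp_map := by
    intro I I' J J' _ _ _ _ _ _ _ _ σ τ i p q
    obtain ⟨p, rfl⟩ := Submodule.Quotient.mk_surjective _ p
    obtain ⟨q, rfl⟩ := Submodule.Quotient.mk_surjective _ q
    simp only [quotientMap_mk, quotientComp_mk, P.comp_map]
  one_comp := by
    intro J _ _ q
    obtain ⟨q, rfl⟩ := Submodule.Quotient.mk_surjective _ q
    simp only [quotientMap_mk, quotientComp_mk, P.one_comp]
  comp_one := by
    intro I _ _ i p
    obtain ⟨p, rfl⟩ := Submodule.Quotient.mk_surjective _ p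
    simp only [quotientMap_mk, quotientComp_mk, P.comp_one]
  comp_comp_seq := by
    intro I J L _ _ _ _ _ _ i j p q r
    obtain ⟨p, rfl⟩ := Submodule.Quotient.mk_surjective _ p
    obtain ⟨q, rfl⟩ := Submodule.Quotient.mk_surjective _ q
    obtain ⟨r, rfl⟩ := Submodule.Quotient.mk_surjective _ r
    simp only [quotientMap_mk, quotientComp_mk, P.comp_comp_seq]
  comp_comp_par := by
    intro I J L _ _ _ _ _ _ i i' hi p q r
    obtain ⟨p, rfl⟩ := Submodule.Quotient.mk_surjective _ p
    obtain ⟨q, rfl⟩ := Submodule.Quotient.mk_surjective _ q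
    obtain ⟨r, rfl⟩ := Submodule.Quotient.mk_surjective _ r
    simp only [quotientMap_mk, quotientComp_mk, P.comp_comp_par hi]

end Operad

/-! ## Free operads -/

/-- A family of generating operations; `e` has arity `arity e + 1`. -/
structure Sig where
  Gen : Type
  arity : Gen → ℕ

/-- Formal expressions built from the generators of `S` and variables in `X`. -/
inductive Tm (S : Sig) (X : Type) : Type
  | var : X → Tm S X
  | node : (e : S.Gen) → (Fin (S.arity e + 1) → Tm S X) → Tm S X

namespace Tm

variable {S : Sig} {X Y Z : Type}

/-- Simultaneous substitution. -/
def bind (f : X → Tm S Y) : Tm S X → Tm S Y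
  | var x => f x
  | node e c => node e fun a => bind f (c a)

/-- The variables of an expression, read from left to right. -/
def leaves : Tm S X → List X
  | var x => [x]
  | node _ c => (List.ofFn fun a => leaves (c a)).flatten

/-- Each variable occurs exactly once. -/
def Linear (t : Tm S X) : Prop := t.leaves.Nodup ∧ ∀ x, x ∈ t.leaves

/-- Renaming of variables. -/
def rename (σ : X → Y) : Tm S X → Tm S Y := bind fun x => var (σ x)

open Classical in
/-- The value at `x` of the substitution of `s` for the variable `i`. -/
noncomputable def substAt {I J : Type} (i : I) (s : Tm S J) (x : I) :
    Tm S ({x : I // x ≠ i} ⊕ J) :=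
  if h : x = i then s.rename Sum.inr else var (Sum.inl ⟨x, h⟩)

/-- Substitution of `s` for the variable `i` in `t`. -/
noncomputable def subst {I J : Type} (i : I) (t : Tm S I) (s : Tm S J) :
    Tm S ({x : I // x ≠ i} ⊕ J) :=
  t.bind (substAt i s)

theorem bind_bind (f : X → Tm S Y) (g : Y → Tm S Z) (t : Tm S X) :
    (t.bind f).bind g = t.bind fun x => (f x).bind g := by
  induction t with
  | var x => rfl
  | node e c ih => simp only [bind, ih]

theorem bind_var (t : Tm S X) : t.bind var = t := by
  induction t with
  | var x => rfl
  | node e c ih => simp only [bind, ih]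

theorem leaves_bind (f : X → Tm S Y) (t : Tm S X) :
    (t.bind f).leaves = t.leaves.flatMap fun x => (f x).leaves := by
  induction t with
  | var x => simp [bind, leaves]
  | node e c ih =>
    simp only [bind, leaves, ih, List.flatMap_def, List.map_flatten, List.map_ofFn,
      List.flatten_flatten]
    rfl

theorem leaves_rename (σ : X → Y) (t : Tm S X) : (t.rename σ).leaves = t.leaves.map σ := by
  rw [rename, leaves_bind]
  simp only [leaves]
  exact List.flatMap_pure_eq_map σ t.leaves

theorem Linear.rename {t : Tm S X} (ht : t.Linear) (σ : X ≃ Y) : (t.rename σ).Linear := by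
  rw [Linear, leaves_rename]
  exact ⟨ht.1.map σ.injective, fun y => List.mem_map.2 ⟨σ.symm y, ht.2 _, by simp⟩⟩

theorem substAt_self {I J : Type} (i : I) (s : Tm S J) : substAt i s i = s.rename Sum.inr := by
  simp [substAt]

theorem substAt_ne {I J : Type} (i : I) (s : Tm S J) (x : I) (h : x ≠ i) :
    substAt i s x = var (Sum.inl ⟨x, h⟩) := by
  simp [substAt, h]

theorem Linear.subst {I J : Type} {i : I} {t : Tm S I} {s : Tm S J}
    (ht : t.Linear) (hs : s.Linear) : (t.subst i s).Linear := by
  have key : ∀ (x : I) (z), z ∈ (substAt i s x).leaves →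
      (Sum.elim (fun y : {x : I // x ≠ i} => y.1) (fun _ => i) z) = x := by
    intro x z hz
    by_cases h : x = i
    · subst h
      rw [substAt_self, leaves_rename, List.mem_map] at hz
      obtain ⟨y, -, rfl⟩ := hz
      rfl
    · rw [substAt_ne i s x h, leaves, List.mem_singleton] at hz
      rw [hz]
      rfl
  rw [Linear, Tm.subst, leaves_bind]
  refine ⟨List.nodup_flatMap.2 ⟨fun x _ => ?_, ?_⟩, ?_⟩
  · by_cases h : x = i
    · subst h
      rw [substAt_self, leaves_rename]
      exact hs.1.map Sum.inr_injective
    · rw [substAt_ne i s x h]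
      simp [leaves]
  · refine ht.1.imp fun {x y} hxy => ?_
    intro z hz hz'
    exact hxy ((key x z hz).symm.trans (key y z hz'))
  · rintro (x | y)
    · refine List.mem_flatMap.2 ⟨x.1, ht.2 _, ?_⟩
      rw [substAt_ne i s x.1 x.2]
      simp [leaves]
    · refine List.mem_flatMap.2 ⟨i, ht.2 _, ?_⟩
      rw [substAt_self, leaves_rename]
      exact List.mem_map.2 ⟨y, hs.2 y, rfl⟩

theorem rename_bind (σ : X → Y) (g : Y → Tm S Z) (t : Tm S X) :
    (t.rename σ).bind g = t.bind fun x => g (σ x) :=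
  bind_bind _ _ t

theorem bind_congr {f g : X → Tm S Y} (h : ∀ x, f x = g x) (t : Tm S X) : t.bind f = t.bind g :=
  congrArg (fun f => t.bind f) (funext h)

end Tm

/-- Multilinear expressions with variables in `I`: planar trees whose vertices are labelled by
generators and whose leaves are in bijection with `I`. They form the basis of the free operad. -/
def Tree (S : Sig) (I : Type) : Type := {t : Tm S I // t.Linear}

namespace Tree

variable {S : Sig} {I J : Type}

/-- Relabelling of the leaves. -/
def map (σ : I ≃ J) (t : Tree S I) : Tree S J := ⟨t.1.rename σ, t.2.rename σ⟩

/-- Grafting of `s` on the leaf `i` of `t`. -/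
noncomputable def graft (i : I) (t : Tree S I) (s : Tree S J) :
    Tree S ({x : I // x ≠ i} ⊕ J) := ⟨t.1.subst i s.1, t.2.subst s.2⟩

/-- The trivial tree. -/
def one : Tree S Unit := ⟨Tm.var (), by simp [Tm.Linear, Tm.leaves]⟩

theorem map_refl (t : Tree S I) : t.map (Equiv.refl I) = t :=
  Subtype.ext (Tm.bind_var t.1)

theorem map_trans {L : Type} (σ : I ≃ J) (τ : J ≃ L) (t : Tree S I) :
    t.map (σ.trans τ) = (t.map σ).map τ :=
  Subtype.ext (Tm.bind_bind (fun x => .var (σ x)) (fun y => .var (τ y)) t.1).symm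

theorem graft_map {I' J' : Type} (σ : I ≃ I') (τ : J ≃ J') (i : I) (t : Tree S I)
    (s : Tree S J) :
    (t.map σ).graft (σ i) (s.map τ) = (t.graft i s).map (equivariantEquiv σ τ i) := by
  refine Subtype.ext ?_
  change (t.1.rename σ).bind _ = (t.1.bind _).bind _
  rw [Tm.rename_bind, Tm.bind_bind]
  refine Tm.bind_congr (fun x => ?_) _
  by_cases h : x = i
  · subst h
    rw [Tm.substAt_self, Tm.substAt_self, Tm.rename_bind]
    exact Tm.bind_bind _ _ s.1
  · rw [Tm.substAt_ne i _ x h, Tm.substAt_ne _ _ _ (fun e => h (σ.injective e))]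
    rfl

theorem one_graft (s : Tree S J) : (one : Tree S Unit).graft () s = s.map (oneCompEquiv J) :=
  Subtype.ext (Tm.substAt_self () s.1)

theorem graft_one (i : I) (t : Tree S I) :
    t.graft i (one : Tree S Unit) = t.map (compOneEquiv i) := by
  refine Subtype.ext (Tm.bind_congr (fun x => ?_) t.1)
  by_cases h : x = i
  · subst h
    rw [Tm.substAt_self]
    refine congrArg Tm.var ?_
    exact (Equiv.eq_symm_apply _).2 rfl
  · rw [Tm.substAt_ne i _ x h]
    refine congrArg Tm.var ?_
    exact (Equiv.eq_symm_apply _).2 rfl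

theorem graft_graft_seq {L : Type} (i : I) (j : J) (t : Tree S I) (s : Tree S J)
    (r : Tree S L) :
    (t.graft i s).graft (Sum.inr j) r = (t.graft i (s.graft j r)).map (seqEquiv i j L) := by
  refine Subtype.ext ?_
  change (t.1.bind _).bind _ = (t.1.bind _).bind _
  rw [Tm.bind_bind, Tm.bind_bind]
  refine Tm.bind_congr (fun x => ?_) _
  by_cases h : x = i
  · subst h
    rw [Tm.substAt_self, Tm.substAt_self, Tm.rename_bind, Tm.rename_bind]
    change _ = (s.1.bind _).bind _
    rw [Tm.bind_bind]
    refine Tm.bind_congr (fun y => ?_) _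
    by_cases h' : y = j
    · subst h'
      rw [Tm.substAt_self, Tm.substAt_self, Tm.rename_bind]
      rfl
    · rw [Tm.substAt_ne j _ y h', Tm.substAt_ne _ _ _ (fun e => h' (Sum.inr_injective e))]
      rfl
  · rw [Tm.substAt_ne i _ x h, Tm.substAt_ne i _ x h]
    change Tm.substAt _ _ (Sum.inl _) = _
    rw [Tm.substAt_ne _ _ _ (by simp)]
    rfl

theorem graft_graft_par {L : Type} {i i' : I} (hi : i ≠ i') (t : Tree S I) (s : Tree S J)
    (r : Tree S L) :
    (t.graft i s).graft (Sum.inl ⟨i', hi.symm⟩) r =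
      ((t.graft i' r).graft (Sum.inl ⟨i, hi⟩) s).map (parEquiv hi J L) := by
  refine Subtype.ext ?_
  change (t.1.bind _).bind _ = ((t.1.bind _).bind _).bind _
  rw [Tm.bind_bind, Tm.bind_bind, Tm.bind_bind]
  refine Tm.bind_congr (fun x => ?_) _
  by_cases h : x = i
  · subst h
    rw [Tm.substAt_self, Tm.substAt_ne i' _ x hi, Tm.rename_bind]
    change _ = (Tm.substAt _ _ _).bind _
    rw [Tm.substAt_self, Tm.rename_bind]
    refine Tm.bind_congr (fun y => ?_) _
    rw [Tm.substAt_ne _ _ _ (by simp)]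
    rfl
  · rw [Tm.substAt_ne i _ x h]
    by_cases h' : x = i'
    · subst h'
      rw [Tm.substAt_self, Tm.rename_bind]
      change Tm.substAt _ _ _ = _
      rw [Tm.substAt_self]
      refine Tm.bind_congr (fun y => ?_) _
      change _ = (Tm.substAt _ _ _).bind _
      rw [Tm.substAt_ne _ _ _ (by simp)]
      rfl
    · rw [Tm.substAt_ne i' _ x h']
      change Tm.substAt _ _ _ = (Tm.substAt _ _ _).bind _
      rw [Tm.substAt_ne _ _ _ (by simpa using h'), Tm.substAt_ne _ _ _ (by simpa using h)]
      rfl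

end Tree

section Free

variable (k : Type u) [CommRing k] (S : Sig)

variable {k S} in
/-- The relabelling maps of the free operad. -/
noncomputable def freeMap {I J : Type} (σ : I ≃ J) : (Tree S I →₀ k) →ₗ[k] (Tree S J →₀ k) :=
  Finsupp.lmapDomain k k (Tree.map σ)

variable {k S} in
/-- The bilinear extension of grafting. -/
noncomputable def freeComp {I J : Type} (i : I) :
    (Tree S I →₀ k) →ₗ[k] (Tree S J →₀ k) →ₗ[k] (Tree S ({x : I // x ≠ i} ⊕ J) →₀ k) :=
  Finsupp.lift _ k _ fun t => Finsupp.lmapDomain k k fun s => t.graft i s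

variable {k S} in
theorem freeMap_single {I J : Type} (σ : I ≃ J) (t : Tree S I) (a : k) :
    freeMap σ (Finsupp.single t a) = Finsupp.single (t.map σ) a :=
  Finsupp.mapDomain_single

variable {k S} in
theorem freeComp_single {I J : Type} (i : I) (t : Tree S I) (s : Tree S J) (a b : k) :
    freeComp i (Finsupp.single t a) (Finsupp.single s b) =
      Finsupp.single (t.graft i s) (a * b) := by
  rw [freeComp, Finsupp.lift_apply, Finsupp.sum_single_index (by rw [zero_smul]),
    LinearMap.smul_apply, Finsupp.lmapDomain_apply, Finsupp.mapDomain_single,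
    Finsupp.smul_single, smul_eq_mul]

/-- The free operad over `k` on the generators of `S`. -/
noncomputable def freeOperad : Operad.{u, u} k where
  obj I _ _ := Tree S I →₀ k
  map σ := freeMap σ
  one := Finsupp.single Tree.one 1
  comp i := freeComp i
  map_refl p := by
    induction p using Finsupp.induction_linear with
    | zero => simp only [map_zero]
    | add f g hf hg => simp only [map_add, hf, hg]
    | single p p' =>
      simp only [freeMap_single, Tree.map_refl]
  map_trans σ τ p := by
    induction p using Finsupp.induction_linear with
    | zero => simp only [map_zero]
    | add f g hf hg => simp only [map_add, hf, hg]
    | single p p' =>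
      simp only [freeMap_single, Tree.map_trans]
  comp_map σ τ i p q := by
    induction p using Finsupp.induction_linear with
    | zero => simp only [map_zero, LinearMap.zero_apply]
    | add f g hf hg => simp only [map_add, LinearMap.add_apply, hf, hg]
    | single p p' =>
      induction q using Finsupp.induction_linear with
      | zero => simp only [map_zero]
      | add f g hf hg => simp only [map_add, hf, hg]
      | single q q' =>
        simp only [freeMap_single, freeComp_single, Tree.graft_map]
  one_comp q := by
    induction q using Finsupp.induction_linear with
    | zero => simp only [map_zero]
    | add f g hf hg => simp only [map_add, hf, hg]
    | single q q' =>
      simp only [freeMap_single, freeComp_single, Tree.one_graft, one_mul]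
  comp_one i p := by
    induction p using Finsupp.induction_linear with
    | zero => simp only [map_zero, LinearMap.zero_apply]
    | add f g hf hg => simp only [map_add, LinearMap.add_apply, hf, hg]
    | single p p' =>
      simp only [freeMap_single, freeComp_single, Tree.graft_one, mul_one]
  comp_comp_seq i j p q r := by
    induction p using Finsupp.induction_linear with
    | zero => simp only [map_zero, LinearMap.zero_apply]
    | add f g hf hg => simp only [map_add, LinearMap.add_apply, hf, hg]
    | single p p' =>
      induction q using Finsupp.induction_linear with
      | zero => simp only [map_zero, LinearMap.zero_apply]
      | add f g hf hg => simp only [map_add, LinearMap.add_apply, hf, hg]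
      | single q q' =>
        induction r using Finsupp.induction_linear with
        | zero => simp only [map_zero]
        | add f g hf hg => simp only [map_add, hf, hg]
        | single r r' =>
          simp only [freeMap_single, freeComp_single, Tree.graft_graft_seq, mul_assoc]
  comp_comp_par hi p q r := by
    induction p using Finsupp.induction_linear with
    | zero => simp only [map_zero, LinearMap.zero_apply]
    | add f g hf hg => simp only [map_add, LinearMap.add_apply, hf, hg]
    | single p p' =>
      induction q using Finsupp.induction_linear with
      | zero => simp only [map_zero, LinearMap.zero_apply]
      | add f g hf hg => simp only [map_add, LinearMap.add_apply, hf, hg]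
      | single q q' =>
        induction r using Finsupp.induction_linear with
        | zero => simp only [map_zero, LinearMap.zero_apply]
        | add f g hf hg => simp only [map_add, LinearMap.add_apply, hf, hg]
        | single r r' =>
          simp only [freeMap_single, freeComp_single, Tree.graft_graft_par hi, mul_right_comm]

/-- A tree as an element of the free operad. -/
noncomputable def freeOperad.of {I : Type} [Finite I] [Nonempty I] (t : Tree S I) :
    (freeOperad k S).obj I := Finsupp.single t (1 : k)

variable (R : ∀ (I : Type) [Finite I] [Nonempty I], Set ((freeOperad k S).obj I))

/-- The operad with generators `S` and relations `r = 0` for `r` in `R`. -/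
noncomputable def presentedOperad : Operad.{u, u} k :=
  (freeOperad k S).quotient ((freeOperad k S).idealSpan R) (Operad.idealSpan_isIdeal R)

/-- The class of a tree in a presented operad. -/
noncomputable def presentedOperad.of {I : Type} [Finite I] [Nonempty I] (t : Tree S I) :
    (presentedOperad k S R).obj I :=
  Submodule.Quotient.mk (freeOperad.of k S t)

end Free

/-! ## The operad of dendriform algebras -/

/-- The two products `≺` and `≻`. -/
inductive DendGen : Type
  | prec
  | succ

/-- Two generators of arity two. -/
def dendSig : Sig := ⟨DendGen, fun _ => 1⟩

section DendTerms

variable {X : Type}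

/-- `a ≺ b`. -/
def prec (a b : Tm dendSig X) : Tm dendSig X := Tm.node DendGen.prec ![a, b]

/-- `a ≻ b`. -/
def succ (a b : Tm dendSig X) : Tm dendSig X := Tm.node DendGen.succ ![a, b]

@[simp] theorem leaves_prec (a b : Tm dendSig X) : (prec a b).leaves = a.leaves ++ b.leaves := by
  change (List.ofFn fun c : Fin 2 => (![a, b] c).leaves).flatten = _
  simp [List.ofFn_succ]

@[simp] theorem leaves_succ (a b : Tm dendSig X) : (succ a b).leaves = a.leaves ++ b.leaves := by
  change (List.ofFn fun c : Fin 2 => (![a, b] c).leaves).flatten = _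
  simp [List.ofFn_succ]

/-- `nearrow x₁ [x₂, …, xₙ] = x₁ ≺ (x₂ ≺ (⋯ ≺ xₙ))`. -/
def nearrow : X → List X → Tm dendSig X
  | x, [] => Tm.var x
  | x, y :: l => prec (Tm.var x) (nearrow y l)

/-- `searrow x₁ [x₂, …, xₙ] = ((x₁ ≻ x₂) ≻ ⋯) ≻ xₙ`. -/
def searrow (x : X) (l : List X) : Tm dendSig X :=
  l.foldl (fun t y => succ t (Tm.var y)) (Tm.var x)

/-- `↗(a) ≻ z ≺ ↘(b)`, where the factor of an empty list is omitted. -/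
def vTerm (z : X) : List X → List X → Tm dendSig X
  | [], [] => Tm.var z
  | [], y :: b => prec (Tm.var z) (searrow y b)
  | x :: a, [] => succ (nearrow x a) (Tm.var z)
  | x :: a, y :: b => prec (succ (nearrow x a) (Tm.var z)) (searrow y b)

theorem leaves_nearrow (x : X) (l : List X) : (nearrow x l).leaves = x :: l := by
  induction l generalizing x with
  | nil => rfl
  | cons y l ih => simp [nearrow, ih, Tm.leaves]

theorem leaves_searrow (x : X) (l : List X) : (searrow x l).leaves = x :: l := by
  have : ∀ t : Tm dendSig X,
      (l.foldl (fun t y => succ t (Tm.var y)) t).leaves = t.leaves ++ l := by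
    induction l with
    | nil => simp
    | cons y l ih => intro t; simp [ih, Tm.leaves]
  exact this (Tm.var x)

theorem leaves_vTerm (z : X) (a b : List X) : (vTerm z a b).leaves = a ++ z :: b := by
  cases a <;> cases b <;> simp [vTerm, leaves_nearrow, leaves_searrow, Tm.leaves]

end DendTerms

/-- A product of three distinct variables, as a tree. -/
def tree3 (t : Tm dendSig (Fin 3)) (ht : t.leaves = [0, 1, 2]) : Tree dendSig (Fin 3) :=
  ⟨t, by rw [Tm.Linear, ht]; decide⟩

section Dend

variable (k : Type u) [CommRing k]

/-- The three axioms of dendriform algebras, with `x = 0`, `y = 1`, `z = 2`: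
`(x ≺ y) ≺ z = x ≺ (y ≺ z) + x ≺ (y ≻ z)`, `(x ≻ y) ≺ z = x ≻ (y ≺ z)` and
`x ≻ (y ≻ z) = (x ≻ y) ≻ z + (x ≺ y) ≻ z`. -/
inductive DendRel :
    ∀ (I : Type) [Finite I] [Nonempty I], (freeOperad k dendSig).obj I → Prop
  | prec_prec : DendRel (Fin 3)
      (freeOperad.of k dendSig (tree3 (prec (prec (.var 0) (.var 1)) (.var 2)) rfl)
        - freeOperad.of k dendSig (tree3 (prec (.var 0) (prec (.var 1) (.var 2))) rfl)
        - freeOperad.of k dendSig (tree3 (prec (.var 0) (succ (.var 1) (.var 2))) rfl))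
  | succ_prec : DendRel (Fin 3)
      (freeOperad.of k dendSig (tree3 (prec (succ (.var 0) (.var 1)) (.var 2)) rfl)
        - freeOperad.of k dendSig (tree3 (succ (.var 0) (prec (.var 1) (.var 2))) rfl))
  | succ_succ : DendRel (Fin 3)
      (freeOperad.of k dendSig (tree3 (succ (.var 0) (succ (.var 1) (.var 2))) rfl)
        - freeOperad.of k dendSig (tree3 (succ (succ (.var 0) (.var 1)) (.var 2)) rfl)
        - freeOperad.of k dendSig (tree3 (succ (prec (.var 0) (.var 1)) (.var 2)) rfl))

/-- The operad `Dend` of dendriform algebras. -/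
noncomputable def Dend : Operad.{u, u} k :=
  presentedOperad k dendSig fun I _ _ => {r | DendRel k I r}

/-- The variables `x₂, …, xₙ₊₁`, where `xᵢ` is the element `i - 1` of `Fin (n + 1)`. -/
def tailVars (n : ℕ) : List (Fin (n + 1)) := (List.finRange n).map Fin.succ

/-- `↗(x₂, …, xᵢ₊₁) ≻ x₁ ≺ ↘(xᵢ₊₂, …, xₙ₊₁)`. -/
def vTree (n i : ℕ) : Tree dendSig (Fin (n + 1)) :=
  ⟨vTerm 0 ((tailVars n).take i) ((tailVars n).drop i), by
    have h : List.Perm ((tailVars n).take i ++ 0 :: (tailVars n).drop i)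
        (List.finRange (n + 1)) := by
      refine List.perm_middle.trans ?_
      rw [List.take_append_drop, List.finRange_succ]
      exact List.Perm.refl _
    rw [Tm.Linear, leaves_vTerm]
    exact ⟨h.nodup_iff.2 (List.nodup_finRange _), fun x => h.mem_iff.2 (List.mem_finRange x)⟩⟩

/-- The operation `∑_{i=0}^{n} (-1)^i ↗(x₂, …, xᵢ₊₁) ≻ x₁ ≺ ↘(xᵢ₊₂, …, xₙ₊₁)`. -/
noncomputable def dendCorl (n : ℕ) : (Dend k).obj (Fin (n + 1)) :=
  ∑ i ∈ Finset.range (n + 1), (-1 : k) ^ i • presentedOperad.of k dendSig _ (vTree n i)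

end Dend

/-! ## The operad of brace algebras -/

/-- The generator `m` is the brace product `{x₁ ∣ x₂, …, xₙ₊₁}` for `n = m + 1 ≥ 1`; its arity is
`n + 1 = m + 2`. -/
def braceSig : Sig := ⟨ℕ, fun m => m + 1⟩

section BraceTerms

variable {X : Type}

/-- `{t ∣ l₁, …, lₙ}`, where `{t ∣ }` is `t`. -/
def brace (t : Tm braceSig X) : List (Tm braceSig X) → Tm braceSig X
  | [] => t
  | a :: l => Tm.node (S := braceSig) l.length fun c : Fin (l.length + 2) => (t :: a :: l).get c

/-- All ways to cut a list into a left part and a right part, possibly empty. -/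
def cuts {α : Type} (l : List α) : List (List α × List α) :=
  (List.range (l.length + 1)).map fun i => (l.take i, l.drop i)

/-- The lists `Y₀, {x₁ ∣ Y₁}, Y₂, {x₂ ∣ Y₃}, Y₄, …, Y₂ₙ₋₂, {xₙ ∣ Y₂ₙ₋₁}, Y₂ₙ`, for all partitions
of the list `ys` into successive, possibly empty, intervals `Y₀, …, Y₂ₙ`. -/
def braceArgs : List (Tm braceSig X) → List (Tm braceSig X) → List (List (Tm braceSig X))
  | [], ys => [ys]
  | x :: xs, ys => (cuts ys).flatMap fun p => (cuts p.2).flatMap fun q =>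
      (braceArgs xs q.2).map fun A => p.1 ++ brace x q.1 :: A

theorem leaves_brace (t : Tm braceSig X) (l : List (Tm braceSig X)) :
    (brace t l).leaves = t.leaves ++ l.flatMap Tm.leaves := by
  cases l with
  | nil => simp [brace]
  | cons a l =>
    change (List.ofFn fun c : Fin (t :: a :: l).length => ((t :: a :: l).get c).leaves).flatten = _
    rw [← Function.comp_def, ← List.map_ofFn, List.ofFn_get]
    simp [List.flatMap_def]

theorem append_of_mem_cuts {α : Type} {l : List α} {p : List α × List α} (hp : p ∈ cuts l) :
    p.1 ++ p.2 = l := by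
  obtain ⟨i, -, rfl⟩ := List.mem_map.1 hp
  exact List.take_append_drop i l

theorem leaves_braceArgs (xs ys A : List (Tm braceSig X)) (hA : A ∈ braceArgs xs ys) :
    List.Perm (A.flatMap Tm.leaves) (xs.flatMap Tm.leaves ++ ys.flatMap Tm.leaves) := by
  induction xs generalizing ys A with
  | nil =>
    rw [braceArgs, List.mem_singleton] at hA
    simp [hA]
  | cons x xs ih =>
    simp only [braceArgs, List.mem_flatMap, List.mem_map] at hA
    obtain ⟨p, hp, q, hq, B, hB, rfl⟩ := hA
    have h := ih _ _ hB
    rw [← append_of_mem_cuts hp, ← append_of_mem_cuts hq]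
    simp only [List.flatMap_append, List.flatMap_cons, leaves_brace, List.append_assoc]
    rw [← Multiset.coe_eq_coe] at h ⊢
    simp only [← Multiset.coe_add] at h ⊢
    rw [h]
    abel

end BraceTerms

section Brace

variable (k : Type u) [CommRing k]

/-- The corolla `Corl_n(1; 2, …, n+1)`, that is `{x₁ ∣ x₂, …, xₙ₊₁}`, with `n` leaves. -/
def corlTree (n : ℕ) : Tree braceSig (Fin (n + 1)) :=
  ⟨brace (Tm.var 0) ((tailVars n).map Tm.var), by
    have h : (brace (Tm.var 0) ((tailVars n).map Tm.var)).leaves = List.finRange (n + 1) := by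
      rw [leaves_brace, List.finRange_succ]
      simp only [Tm.leaves, tailVars, List.flatMap_map, List.singleton_append]
      exact congrArg (List.cons 0) (List.flatMap_pure_eq_map Fin.succ _)
    rw [Tm.Linear, h]
    exact ⟨List.nodup_finRange _, List.mem_finRange⟩⟩

/-- The variables `z, x₁, …, xₙ, y₁, …, yₘ` of the brace relation. -/
abbrev BraceVar (n m : ℕ) : Type := Option (Fin n ⊕ Fin m)

/-- The variable `z`. -/
def zVar (n m : ℕ) : Tm braceSig (BraceVar n m) := .var none

/-- The variables `x₁, …, xₙ`. -/
def xVars (n m : ℕ) : List (Tm braceSig (BraceVar n m)) :=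
  (List.finRange n).map fun a => .var (some (Sum.inl a))

/-- The variables `y₁, …, yₘ`. -/
def yVars (n m : ℕ) : List (Tm braceSig (BraceVar n m)) :=
  (List.finRange m).map fun b => .var (some (Sum.inr b))

theorem linear_of_perm {n m : ℕ} {t : Tm braceSig (BraceVar n m)}
    (ht : List.Perm t.leaves ((zVar n m).leaves ++
      ((xVars n m).flatMap Tm.leaves ++ (yVars n m).flatMap Tm.leaves))) : t.Linear := by
  have hx : (xVars n m).flatMap Tm.leaves = (List.finRange n).map fun a => some (Sum.inl a) := by
    simp only [xVars, Tm.leaves, List.flatMap_map]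
    exact List.flatMap_pure_eq_map _ _
  have hy : (yVars n m).flatMap Tm.leaves = (List.finRange m).map fun b => some (Sum.inr b) := by
    simp only [yVars, Tm.leaves, List.flatMap_map]
    exact List.flatMap_pure_eq_map _ _
  rw [hx, hy] at ht
  refine ⟨ht.nodup_iff.2 ?_, fun v => ht.mem_iff.2 ?_⟩
  · simp only [zVar, Tm.leaves, List.singleton_append, List.nodup_cons]
    refine ⟨by simp, List.Nodup.append ?_ ?_ ?_⟩
    · exact (List.nodup_finRange n).map fun a b h => by simpa using h
    · exact (List.nodup_finRange m).map fun a b h => by simpa using h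
    · intro v hv hv'
      simp only [List.mem_map] at hv hv'
      obtain ⟨a, -, rfl⟩ := hv
      simp at hv'
  · rcases v with _ | a | b <;> simp [zVar, Tm.leaves]

/-- `{{z ∣ x₁, …, xₙ} ∣ y₁, …, yₘ}`. -/
def braceLhs (n m : ℕ) : Tree braceSig (BraceVar n m) :=
  ⟨brace (brace (zVar n m) (xVars n m)) (yVars n m), linear_of_perm (by
    rw [leaves_brace, leaves_brace, List.append_assoc])⟩

/-- The list of all `{z ∣ Y₀, {x₁ ∣ Y₁}, Y₂, …, {xₙ ∣ Y₂ₙ₋₁}, Y₂ₙ}`. -/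
def braceRhs (n m : ℕ) : List (Tree braceSig (BraceVar n m)) :=
  (braceArgs (xVars n m) (yVars n m)).attach.map fun A =>
    ⟨brace (zVar n m) A.1, linear_of_perm (by
      rw [leaves_brace]
      exact (leaves_braceArgs _ _ _ A.2).append_left _)⟩

/-- The brace relations, for `n, m ≥ 1`: `{{z ∣ x₁, …, xₙ} ∣ y₁, …, yₘ}` is the sum of the
`{z ∣ Y₀, {x₁ ∣ Y₁}, Y₂, …, {xₙ ∣ Y₂ₙ₋₁}, Y₂ₙ}`. -/
inductive BraceRel :
    ∀ (I : Type) [Finite I] [Nonempty I], (freeOperad k braceSig).obj I → Prop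
  | brace_brace (n m : ℕ) (hn : 1 ≤ n) (hm : 1 ≤ m) : BraceRel (BraceVar n m)
      (freeOperad.of k braceSig (braceLhs n m)
        - ((braceRhs n m).map (freeOperad.of k braceSig)).sum)

/-- The operad `Brace` of brace algebras. -/
noncomputable def Brace : Operad.{u, u} k :=
  presentedOperad k braceSig fun I _ _ => {r | BraceRel k I r}

/-- The operation `Corl_n` of `Brace`. -/
noncomputable def corl (n : ℕ) : (Brace k).obj (Fin (n + 1)) :=
  presentedOperad.of k braceSig _ (corlTree n)

variable {k}

/-- `ψ` sends `Corl_n` to `∑_{i=0}^{n} (-1)^i ↗(x₂, …, xᵢ₊₁) ≻ x₁ ≺ ↘(xᵢ₊₂, …, xₙ₊₁)` for all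
`n ≥ 1`. -/
def SendsCorollas (ψ : Operad.Hom (Brace k) (Dend k)) : Prop :=
  ∀ n : ℕ, 1 ≤ n → ψ.app (Fin (n + 1)) (corl k n) = dendCorl k n

/-- The image under `ψ` of `Brace₊`, the operations of arity at least two. -/
def imagePlus (ψ : Operad.Hom (Brace k) (Dend k)) (I : Type) [Finite I] [Nonempty I] :
    Set ((Dend k).obj I) :=
  {y | 2 ≤ Nat.card I ∧ ∃ b : (Brace k).obj I, ψ.app I b = y}

end Brace

end BraceDend

/-! The left ideal 𝒥 turns out to be the set of all operations of `Dend` that vanish on one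
particular dendriform algebra, and such a set is automatically two-sided. The algebra is `Zinb k`:
functions on nonempty words with the half-shuffle product, where x ≻ y = y ≺ x.

Existence of ψ. Let A be a dendriform algebra, with associative product x ≺ y + x ≻ y. Write N(l) =
`nearU k l` for the signed ↗ and S(l) = `searU k l` for ↘, both equal to 1 in the unitization when l
is empty. The axioms say that A is a bimodule over its unitization through ≻ and ≺, and the brace is
`br k z l` = Σ N(p)·z·S(q) over the cuts l = pq. For convolution over cuts, N and S are inverse to
each other (`nearU_mul_searU`, `searU_mul_nearU`). Summed over the lists W on the right of the brace
relation, N(W) gives N(ys)N(xs) (`brSum_nearU`); by inversion S(W) gives S(xs)S(ys) (`brSum_searU`),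
and the brace relation `br_br` follows. Then ψ evaluates a brace expression on the generators of a
free dendriform algebra and takes the multilinear part, which is `Dend`. It is unique because every
brace tree is an iterated graft of corollas.

𝒥 lies in the kernel. When the two actions coincide, Σ N(p)·z·S(q) = (Σ N(p)S(q))·z, which is 0 for
l nonempty; so braces vanish on `Zinb k` (`Zinb.br_eq_zero`).

The kernel lies in 𝒥. Modulo 𝒥 the brace formula rewrites z ≺ ↘(l) through products ≻, and the
axioms bring these to left-bracketed words ((x₁ ≻ x₂) ≻ ⋯) ≻ xₙ, which therefore span
(`deg_le_sup_words`). Evaluated at letters of `Zinb k`, words become the indicator functions of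
their reversals and stay linearly independent (`eq_zero_of_lift_letter_eq_zero`). An operation in
the kernel thus has no word component modulo 𝒥 (`leftIdealSpan_carrier_eq`). -/

namespace BraceDend

universe u v w

/-! ## Algebras over a signature -/

/-- A module with a multilinear operation for each generator of `S`. -/
structure Alg (k : Type u) [CommRing k] (S : Sig) (B : Type v) [AddCommGroup B] [Module k B] where
  op : (e : S.Gen) → (Fin (S.arity e + 1) → B) → B
  linear : ∀ (e : S.Gen) (v : Fin (S.arity e + 1) → B) (a : Fin (S.arity e + 1)),
    IsLinearMap k fun x => op e (Function.update v a x)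

section Eval

variable {k : Type u} [CommRing k] {S : Sig} {B : Type v} [AddCommGroup B] [Module k B]
  {X Y : Type}

/-- The value of an expression in an algebra. -/
def Alg.eval (𝔸 : Alg k S B) (g : X → B) : Tm S X → B
  | .var x => g x
  | .node e c => 𝔸.op e fun a => 𝔸.eval g (c a)

theorem Alg.eval_bind (𝔸 : Alg k S B) (g : Y → B) (f : X → Tm S Y) (t : Tm S X) :
    𝔸.eval g (t.bind f) = 𝔸.eval (fun x => 𝔸.eval g (f x)) t := by
  induction t with
  | var x => rfl
  | node e c ih => simp only [Tm.bind, Alg.eval, ih]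

theorem Alg.eval_rename (𝔸 : Alg k S B) (g : Y → B) (f : X → Y) (t : Tm S X) :
    𝔸.eval g (t.rename f) = 𝔸.eval (fun x => g (f x)) t :=
  𝔸.eval_bind g _ t

theorem Tm.mem_leaves_node {e : S.Gen} {c : Fin (S.arity e + 1) → Tm S X} {x : X} :
    x ∈ (Tm.node e c).leaves ↔ ∃ a, x ∈ (c a).leaves := by
  rw [Tm.leaves, List.mem_flatten]
  simp only [List.mem_ofFn, exists_exists_eq_and]

theorem Alg.eval_congr (𝔸 : Alg k S B) {g g' : X → B} (t : Tm S X)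
    (h : ∀ x ∈ t.leaves, g x = g' x) : 𝔸.eval g t = 𝔸.eval g' t := by
  induction t with
  | var x => exact h x (by simp [Tm.leaves])
  | node e c ih =>
    simp only [Alg.eval]
    congr 1
    exact funext fun a => ih a fun x hx => h x (Tm.mem_leaves_node.2 ⟨a, hx⟩)

-- A variable of a linear expression occurs in exactly one argument of the root; the other arguments
-- are constant in it, and induction applies to that one.
open Classical in
theorem Alg.eval_linear (𝔸 : Alg k S B) (g : X → B) (i : X) (t : Tm S X)
    (ht : t.leaves.Nodup) (hi : i ∈ t.leaves) :
    IsLinearMap k fun v => 𝔸.eval (Function.update g i v) t := by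
  induction t with
  | var x =>
    obtain rfl : i = x := by simpa [Tm.leaves] using hi
    simp only [Alg.eval, Function.update_self]
    exact ⟨fun _ _ => rfl, fun _ _ => rfl⟩
  | node e c ih =>
    obtain ⟨a, ha⟩ := Tm.mem_leaves_node.1 hi
    rw [Tm.leaves, List.nodup_flatten, List.pairwise_ofFn] at ht
    have hne : ∀ b, b ≠ a → i ∉ (c b).leaves := by
      intro b hb hib
      rcases lt_or_gt_of_ne hb with h | h
      · exact ht.2 h hib ha
      · exact ht.2 h ha hib
    have key : (fun v => 𝔸.eval (Function.update g i v) (Tm.node e c)) = fun v =>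
        𝔸.op e (Function.update (fun b => 𝔸.eval g (c b)) a
          (𝔸.eval (Function.update g i v) (c a))) := by
      funext v
      simp only [Alg.eval]
      congr 1
      funext b
      by_cases hb : b = a
      · subst hb
        simp
      · rw [Function.update_of_ne hb]
        refine 𝔸.eval_congr _ fun x hx => Function.update_of_ne ?_ _ _
        rintro rfl
        exact hne b hb hx
    rw [key]
    have h1 := ih a (ht.1 _ (List.mem_ofFn.2 ⟨a, rfl⟩)) ha
    have h2 := 𝔸.linear e (fun b => 𝔸.eval g (c b)) a
    exact ⟨fun x y => by rw [h1.map_add, h2.map_add], fun r x => by rw [h1.map_smul, h2.map_smul]⟩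

/-- The linear extension of the evaluation of trees. -/
noncomputable def Alg.evalL (𝔸 : Alg k S B) (g : X → B) : (Tree S X →₀ k) →ₗ[k] B :=
  Finsupp.linearCombination k fun t : Tree S X => 𝔸.eval g t.1

theorem Alg.evalL_single (𝔸 : Alg k S B) (g : X → B) (t : Tree S X) (c : k) :
    𝔸.evalL g (Finsupp.single t c) = c • 𝔸.eval g t.1 :=
  Finsupp.linearCombination_single k c t

theorem Alg.evalL_freeMap (𝔸 : Alg k S B) (g : Y → B) (σ : X ≃ Y) (p : Tree S X →₀ k) :
    𝔸.evalL g (freeMap σ p) = 𝔸.evalL (fun x => g (σ x)) p := by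
  induction p using Finsupp.induction_linear with
  | zero => simp only [map_zero]
  | add f g hf hg => simp only [map_add, hf, hg]
  | single t c =>
    rw [freeMap_single, Alg.evalL_single, Alg.evalL_single]
    exact congrArg _ (𝔸.eval_rename g σ t.1)

open Classical in
theorem Alg.eval_graft (𝔸 : Alg k S B) (i : X) (g : {x : X // x ≠ i} ⊕ Y → B) (t : Tree S X)
    (s : Tree S Y) : 𝔸.eval g (t.graft i s).1 =
      𝔸.eval (Function.update (fun x => if h : x = i then 0 else g (Sum.inl ⟨x, h⟩)) i
        (𝔸.eval (fun y => g (Sum.inr y)) s.1)) t.1 := by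
  refine (𝔸.eval_bind g _ t.1).trans (𝔸.eval_congr _ fun x _ => ?_)
  by_cases h : x = i
  · subst h
    rw [Tm.substAt_self, Function.update_self, Alg.eval_rename]
  · rw [Tm.substAt_ne _ _ _ h, Function.update_of_ne h, dif_neg h]
    rfl

open Classical in
theorem Alg.evalL_freeComp (𝔸 : Alg k S B) (i : X) (g : {x : X // x ≠ i} ⊕ Y → B)
    (p : Tree S X →₀ k) (q : Tree S Y →₀ k) : 𝔸.evalL g (freeComp i p q) =
      𝔸.evalL (Function.update (fun x => if h : x = i then 0 else g (Sum.inl ⟨x, h⟩)) i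
        (𝔸.evalL (fun y => g (Sum.inr y)) q)) p := by
  induction p using Finsupp.induction_linear with
  | zero => simp only [map_zero, LinearMap.zero_apply]
  | add f g hf hg => simp only [map_add, LinearMap.add_apply, hf, hg]
  | single t c =>
    have hlin := 𝔸.eval_linear (fun x => if h : x = i then 0 else g (Sum.inl ⟨x, h⟩)) i t.1
      t.2.1 (t.2.2 i)
    rw [Alg.evalL_single]
    induction q using Finsupp.induction_linear with
    | zero => simp only [map_zero, hlin.map_zero, smul_zero]
    | add f g hf hg => simp only [map_add, hlin.map_add, hf, hg, smul_add]
    | single s d =>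
      rw [freeComp_single, Alg.evalL_single, Alg.evalL_single, hlin.map_smul, Alg.eval_graft,
        smul_smul]

/-- The combinations of trees that vanish identically in an algebra. -/
noncomputable def Alg.kernel (𝔸 : Alg k S B) : (freeOperad k S).SubSModule where
  carrier I _ _ := ⨅ g : I → B, LinearMap.ker (𝔸.evalL g)
  map_mem := by
    intro I J _ _ _ _ σ p hp
    rw [Submodule.mem_iInf] at hp ⊢
    exact fun g => (𝔸.evalL_freeMap g σ p).trans (hp _)

theorem Alg.mem_kernel (𝔸 : Alg k S B) {I : Type} [Finite I] [Nonempty I]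
    {p : (freeOperad k S).obj I} :
    p ∈ 𝔸.kernel.carrier I ↔ ∀ g : I → B, 𝔸.evalL g p = 0 :=
  Submodule.mem_iInf _

/-- An operation that vanishes on all inputs also vanishes when one input is itself a value; and a
vanishing inner operation puts 0 in a slot of a multilinear one. Two-sidedness in the main theorem
comes from here. -/
theorem Alg.kernel_isIdeal (𝔸 : Alg k S B) : 𝔸.kernel.IsIdeal := by
  classical
  intro I J _ _ _ _ i e f h
  refine 𝔸.mem_kernel.2 fun g => (𝔸.evalL_freeComp i g e f).trans ?_
  rcases h with h | h
  · exact 𝔸.mem_kernel.1 h _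
  · rw [𝔸.mem_kernel.1 h]
    refine (Finsupp.linearCombination_apply k e).trans (Finset.sum_eq_zero fun t _ => ?_)
    have hlin := 𝔸.eval_linear (fun x => if h : x = i then 0 else g (Sum.inl ⟨x, h⟩)) i t.1
      t.2.1 (t.2.2 i)
    exact (congrArg _ hlin.map_zero).trans (smul_zero _)

theorem Alg.evalL_eq_zero (𝔸 : Alg k S B)
    {R : ∀ (I : Type) [Finite I] [Nonempty I], Set ((freeOperad k S).obj I)}
    (hR : ∀ (I : Type) [Finite I] [Nonempty I], R I ⊆ 𝔸.kernel.carrier I)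
    {I : Type} [Finite I] [Nonempty I] {p : (freeOperad k S).obj I}
    (hp : p ∈ ((freeOperad k S).idealSpan R).carrier I) (g : I → B) : 𝔸.evalL g p = 0 :=
  𝔸.mem_kernel.1 (Operad.mem_spanOf.1 hp 𝔸.kernel 𝔸.kernel_isIdeal hR) g

end Eval

/-! ## Expressions with repeated variables -/

section Renames

variable {k : Type u} [CommRing k] {S : Sig} {X Y Z : Type}

/-- The linear extension of a substitution. -/
noncomputable def bindL (g : X → Tm S Y) : (Tree S X →₀ k) →ₗ[k] (Tm S Y →₀ k) :=
  Finsupp.lmapDomain k k fun t => t.1.bind g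

theorem bindL_single (g : X → Tm S Y) (t : Tree S X) (c : k) :
    bindL g (Finsupp.single t c) = Finsupp.single (t.1.bind g) c :=
  Finsupp.mapDomain_single

/-- The combinations of expressions obtained from elements of `𝒥` by renaming, and possibly
identifying, variables. -/
noncomputable def renames (𝒥 : (freeOperad k S).SubSModule) (X : Type) : Submodule k (Tm S X →₀ k) :=
  Submodule.span k {f | ∃ (Y : Type) (_ : Finite Y) (_ : Nonempty Y) (j : Y → X)
    (p : (freeOperad k S).obj Y), p ∈ 𝒥.carrier Y ∧ bindL (fun y => .var (j y)) p = f}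

theorem bindL_var_mem_renames {𝒥 : (freeOperad k S).SubSModule} [Finite Y] [Nonempty Y]
    (j : Y → X) {p : (freeOperad k S).obj Y} (hp : p ∈ 𝒥.carrier Y) :
    bindL (fun y => .var (j y)) p ∈ renames 𝒥 X :=
  Submodule.subset_span ⟨Y, _, _, j, p, hp, rfl⟩

theorem Tm.leaves_ne_nil (t : Tm S X) : t.leaves ≠ [] := by
  induction t with
  | var x => simp [Tm.leaves]
  | node e c ih =>
    obtain ⟨x, hx⟩ := List.exists_mem_of_ne_nil _ (ih 0)
    exact List.ne_nil_of_mem (Tm.mem_leaves_node.2 ⟨0, hx⟩)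

theorem Tm.Linear.node {e : S.Gen} {Y : Fin (S.arity e + 1) → Type} {c : ∀ a, Tm S (Y a)}
    (h : ∀ a, (c a).Linear) : (Tm.node e fun a => (c a).rename (Sigma.mk a)).Linear := by
  refine ⟨?_, fun x => Tm.mem_leaves_node.2 ⟨x.1, ?_⟩⟩
  · rw [Tm.leaves, List.nodup_flatten, List.pairwise_ofFn]
    simp only [List.mem_ofFn, Tm.leaves_rename]
    refine ⟨?_, fun a b hab x hx hx' => ?_⟩
    · rintro l ⟨a, rfl⟩
      exact (h a).1.map sigma_mk_injective
    · obtain ⟨y, -, rfl⟩ := List.mem_map.1 hx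
      obtain ⟨z, -, hz⟩ := List.mem_map.1 hx'
      exact hab.ne (congrArg Sigma.fst hz).symm
  · rw [Tm.leaves_rename]
    exact List.mem_map.2 ⟨x.2, (h x.1).2 _, rfl⟩

/-- Give every occurrence of a variable its own name: the occurrences are indexed by the disjoint
union over the arguments of the root. -/
theorem Tm.exists_tree (t : Tm S X) : ∃ (Y : Type) (_ : Finite Y) (_ : Nonempty Y) (j : Y → X)
    (s : Tree S Y), s.1.rename j = t := by
  induction t with
  | var x => exact ⟨Unit, inferInstance, inferInstance, fun _ => x, Tree.one, rfl⟩
  | node e c ih =>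
    choose Y hY hY' j s hs using ih
    refine ⟨Σ a, Y a, inferInstance,
      ⟨⟨0, Classical.choice (hY' 0)⟩⟩, fun y => j y.1 y.2,
      ⟨.node e fun a => (s a).1.rename (Sigma.mk a), Tm.Linear.node fun a => (s a).2⟩, ?_⟩
    simp only [Tm.rename, Tm.bind, Tm.bind_bind]
    congr 1
    exact funext fun a => hs a

open Classical in
theorem bindL_freeComp (i : X) (p : Tree S X →₀ k) (s : Tree S Y)
    (g : {x : X // x ≠ i} ⊕ Y → Tm S Z) :
    bindL g (freeComp i p (Finsupp.single s 1)) = bindL (fun x => if h : x = i then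
      s.1.bind (fun y => g (Sum.inr y)) else g (Sum.inl ⟨x, h⟩)) p := by
  induction p using Finsupp.induction_linear with
  | zero => simp only [map_zero, LinearMap.zero_apply]
  | add f g hf hg => simp only [map_add, LinearMap.add_apply, hf, hg]
  | single t c =>
    rw [freeComp_single, bindL_single, bindL_single, mul_one]
    congr 1
    refine (Tm.bind_bind _ _ _).trans (Tm.bind_congr (fun x => ?_) _)
    by_cases h : x = i
    · subst h
      rw [Tm.substAt_self, dif_pos rfl, Tm.rename_bind]
    · rw [Tm.substAt_ne _ _ _ h, dif_neg h]
      rfl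

/-- A family of combinations of trees that is stable under grafting the trees of a family `Q` is
stable under simultaneous substitutions by expressions built from `Q`. -/
theorem exists_bindL_var {P : ∀ (I : Type) [Finite I] [Nonempty I], Set (Tree S I →₀ k)}
    {Q : ∀ (I : Type) [Finite I] [Nonempty I], Set (Tree S I)}
    (hPQ : ∀ {I J : Type} [Finite I] [Nonempty I] [Finite J] [Nonempty J] (i : I)
      (p : Tree S I →₀ k) (s : Tree S J), p ∈ P I → s ∈ Q J →
        freeComp i p (Finsupp.single s 1) ∈ P _)
    {I : Type} [Finite I] [Nonempty I] {p : Tree S I →₀ k} (hp : p ∈ P I) (g : I → Tm S X)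
    (hg : ∀ i, (∃ x, g i = .var x) ∨ ∃ (Y : Type) (_ : Finite Y) (_ : Nonempty Y) (j : Y → X)
      (s : Tree S Y), s ∈ Q Y ∧ s.1.rename j = g i) :
    ∃ (Y : Type) (_ : Finite Y) (_ : Nonempty Y) (j : Y → X) (q : Tree S Y →₀ k),
      q ∈ P Y ∧ bindL (fun y => .var (j y)) q = bindL g p := by
  classical
  -- Induction on the number of inputs that receive a compound expression: grafting at one of them
  -- trades it for inputs that receive variables only.
  induction hn : {i | ¬ ∃ x, g i = .var x}.ncard using Nat.strong_induction_on
    generalizing I with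
  | _ n ih =>
    by_cases h : ∀ i, ∃ x, g i = .var x
    · choose j hj using h
      exact ⟨I, _, _, j, p, hp, by rw [funext hj]⟩
    · obtain ⟨i, hi⟩ := not_forall.1 h
      obtain ⟨Y, _, _, j, s, hs, hsj⟩ := (hg i).resolve_left hi
      have key : bindL g p = bindL (Sum.elim (fun x : {x : I // x ≠ i} => g x.1)
          fun y => .var (j y)) (freeComp i p (Finsupp.single s 1)) := by
        rw [bindL_freeComp]
        refine congrArg (fun g => bindL g p) (funext fun x => ?_)
        by_cases hx : x = i
        · subst hx
          rw [dif_pos rfl]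
          exact hsj.symm
        · rw [dif_neg hx]
          rfl
      rw [key]
      refine ih _ ?_ (hPQ i p s hp hs) _ ?_ rfl
      · rw [← hn]
        have himg : {x | ¬ ∃ z, Sum.elim (fun x : {x : I // x ≠ i} => g x.1)
            (fun y => Tm.var (S := S) (j y)) x = .var z} ⊆
              Sum.inl '' {x : {x : I // x ≠ i} | ¬ ∃ z, g x.1 = .var z} := by
          rintro (x | y) hxy
          · exact ⟨x, hxy, rfl⟩
          · exact absurd ⟨j y, rfl⟩ hxy
        refine (Set.ncard_le_ncard himg (Set.toFinite _)).trans_lt ?_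
        rw [Set.ncard_image_of_injective _ Sum.inl_injective,
          ← Set.ncard_image_of_injective _ Subtype.val_injective]
        refine Set.ncard_lt_ncard ⟨?_, fun hsub => ?_⟩ (Set.toFinite _)
        · rintro _ ⟨x, hx, rfl⟩
          exact hx
        · obtain ⟨x, -, hx⟩ := hsub hi
          exact x.2 hx
      · rintro (x | y)
        · exact hg x.1
        · exact Or.inl ⟨j y, rfl⟩

/-- Substitution composes with other operations on the input side, so this is where closure under `f
∘ᵢ e` with `f` in `𝒥` is used. -/
theorem bindL_mem_renames {𝒥 : (freeOperad k S).SubSModule} (h𝒥 : 𝒥.IsIdeal) {I : Type} [Finite I]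
    [Nonempty I] {p : (freeOperad k S).obj I} (hp : p ∈ 𝒥.carrier I) (g : I → Tm S X) :
    bindL g p ∈ renames 𝒥 X := by
  obtain ⟨Y, _, _, j, q, hq, hqp⟩ := exists_bindL_var
    (P := fun I _ _ => {q | (q : (freeOperad k S).obj I) ∈ 𝒥.carrier I}) (Q := fun _ _ _ => Set.univ)
    (fun i p s hp _ => h𝒥 i p _ (Or.inl hp)) hp g fun i => by
      obtain ⟨Y, h, h', j, s, hs⟩ := (g i).exists_tree
      exact Or.inr ⟨Y, h, h', j, s, trivial, hs⟩
  rw [← hqp]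
  exact bindL_var_mem_renames j hq

open Classical in
/-- The part of a combination of expressions that involves each variable exactly once. -/
noncomputable def linearPart : (Tm S X →₀ k) →ₗ[k] (Tree S X →₀ k) :=
  Finsupp.linearCombination k fun t =>
    if h : t.Linear then Finsupp.single (⟨t, h⟩ : Tree S X) (1 : k) else 0

theorem linearPart_single (t : Tree S X) (c : k) :
    linearPart (Finsupp.single t.1 c) = Finsupp.single t c := by
  rw [linearPart, Finsupp.linearCombination_single, dif_pos t.2]
  exact (Finsupp.smul_single _ _ _).trans (congrArg _ (mul_one c))

theorem linearPart_single_of_not {t : Tm S X} (ht : ¬ t.Linear) (c : k) :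
    linearPart (Finsupp.single t c) = 0 := by
  rw [linearPart, Finsupp.linearCombination_single, dif_neg ht, smul_zero]

theorem linearPart_bindL_equiv (σ : Y ≃ X) (p : Tree S Y →₀ k) :
    linearPart (bindL (fun y => .var (σ y)) p) = freeMap σ p := by
  induction p using Finsupp.induction_linear with
  | zero => simp only [map_zero]
  | add f g hf hg => simp only [map_add, hf, hg]
  | single t c =>
    rw [bindL_single, freeMap_single]
    exact linearPart_single (t.map σ) c

theorem linearPart_bindL_var (p : Tree S X →₀ k) : linearPart (bindL .var p) = p := by
  induction p using Finsupp.induction_linear with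
  | zero => simp only [map_zero]
  | add f g hf hg => simp only [map_add, hf, hg]
  | single t c => rw [bindL_single, Tm.bind_var, linearPart_single]

theorem Tm.Linear.bijective {t : Tm S Y} (ht : t.Linear) {j : Y → X} (hj : (t.rename j).Linear) :
    Function.Bijective j := by
  rw [Tm.Linear, Tm.leaves_rename] at hj
  refine ⟨fun y z h => ?_, fun x => ?_⟩
  · exact List.inj_on_of_nodup_map hj.1 (ht.2 y) (ht.2 z) h
  · obtain ⟨y, -, hy⟩ := List.mem_map.1 (hj.2 x)
    exact ⟨y, hy⟩

/-- A renaming that is not bijective repeats or omits a variable, so it yields no linear expression;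
only bijective renamings survive, and `𝒥` is stable under those. -/
theorem linearPart_mem {𝒥 : (freeOperad k S).SubSModule} [Finite X] [Nonempty X]
    {f : Tm S X →₀ k} (hf : f ∈ renames 𝒥 X) : linearPart f ∈ 𝒥.carrier X := by
  refine (Submodule.span_le (p := (𝒥.carrier X).comap
    (linearPart : (Tm S X →₀ k) →ₗ[k] (freeOperad k S).obj X))).2 ?_ hf
  rintro _ ⟨Y, _, _, j, p, hp, rfl⟩
  change linearPart _ ∈ 𝒥.carrier X
  by_cases hj : Function.Bijective j
  · have h := 𝒥.map_mem (Equiv.ofBijective j hj) hp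
    have h' := linearPart_bindL_equiv (k := k) (S := S) (Equiv.ofBijective j hj) p
    exact h' ▸ h
  · have h0 : linearPart (bindL (fun y => .var (j y)) p) = (0 : Tree S X →₀ k) := by
      clear hp
      change Tree S Y →₀ k at p
      induction p using Finsupp.induction_linear with
      | zero => simp only [map_zero]
      | add f g hf hg => simp only [map_add, hf, hg, add_zero]
      | single t c =>
        rw [bindL_single]
        exact linearPart_single_of_not (fun h => hj (t.2.bijective h)) c
    rw [h0]
    exact Submodule.zero_mem _

end Renames

/-! ### Products of expressions, and stability of left ideals under them. -/

section Bin

variable {k : Type u} [CommRing k] {X Y : Type}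

/-- The product of two expressions given by the generator `e`. -/
def bin (e : DendGen) (a b : Tm dendSig X) : Tm dendSig X := Tm.node (S := dendSig) e ![a, b]

theorem bin_bind (e : DendGen) (a b : Tm dendSig X) (f : X → Tm dendSig Y) :
    (bin e a b).bind f = bin e (a.bind f) (b.bind f) := by
  simp only [bin, Tm.bind]
  congr 1
  funext i
  fin_cases i <;> rfl

theorem leaves_bin (e : DendGen) (a b : Tm dendSig X) :
    (bin e a b).leaves = a.leaves ++ b.leaves := by
  cases e
  · exact leaves_prec a b
  · exact leaves_succ a b

/-- The bilinear extension of `bin`. -/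
noncomputable def binL (e : DendGen) :
    (Tm dendSig X →₀ k) →ₗ[k] (Tm dendSig X →₀ k) →ₗ[k] (Tm dendSig X →₀ k) :=
  Finsupp.lift _ k _ fun t => Finsupp.lmapDomain k k fun s => bin e t s

theorem binL_single (e : DendGen) (t s : Tm dendSig X) (a b : k) :
    binL e (Finsupp.single t a) (Finsupp.single s b) = Finsupp.single (bin e t s) (a * b) := by
  rw [binL, Finsupp.lift_apply, Finsupp.sum_single_index (by rw [zero_smul]),
    LinearMap.smul_apply, Finsupp.lmapDomain_apply, Finsupp.mapDomain_single,
    Finsupp.smul_single, smul_eq_mul]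

/-- The tree obtained by multiplying the variable `none` on the right by a tree. -/
def varMul (e : DendGen) (s : Tree dendSig Y) : Tree dendSig (Option Y) :=
  ⟨bin e (.var none) (s.1.rename some), by
    rw [Tm.Linear, leaves_bin, Tm.leaves_rename, Tm.leaves]
    refine ⟨List.nodup_cons.2 ⟨by simp, s.2.1.map (Option.some_injective _)⟩, ?_⟩
    rintro (_ | y)
    · simp
    · exact List.mem_cons_of_mem _ (List.mem_map.2 ⟨y, s.2.2 y, rfl⟩)⟩

/-- The tree obtained by multiplying the variable `none` on the left by a tree. -/
def mulVar (e : DendGen) (s : Tree dendSig Y) : Tree dendSig (Option Y) :=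
  ⟨bin e (s.1.rename some) (.var none), by
    have h : List.Perm ((s.1.rename some).leaves ++ [none]) (none :: (s.1.rename some).leaves) :=
      List.perm_append_comm
    rw [Tm.Linear, leaves_bin]
    change List.Nodup (_ ++ [none]) ∧ ∀ x, x ∈ _ ++ [none]
    rw [Tm.leaves_rename] at h ⊢
    refine ⟨h.nodup_iff.2 (List.nodup_cons.2 ⟨by simp, s.2.1.map (Option.some_injective _)⟩), ?_⟩
    rintro (_ | y)
    · simp
    · exact List.mem_append_left _ (List.mem_map.2 ⟨y, s.2.2 y, rfl⟩)⟩

/-- Renaming of the variables of a graft on the variable `none`. -/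
noncomputable def optionElim {Z : Type} [Nonempty Z] (j : Z → X) (j' : Y → X) :
    {x : Option Y // x ≠ none} ⊕ Z → X :=
  -- The value at `none` is never reached, since the subtype excludes `none`; `Z` nonempty provides
  -- a filler.
  Sum.elim (fun x => x.1.elim (j (Classical.arbitrary Z)) j') j

theorem varMul_graft {Z : Type} [Nonempty Z] (e : DendGen) (s : Tree dendSig Y)
    (t : Tree dendSig Z) (j : Z → X) (j' : Y → X) :
    ((varMul e s).graft none t).1.rename (optionElim j j') =
      bin e (t.1.rename j) (s.1.rename j') := by
  refine (Tm.bind_bind _ _ _).trans ((bin_bind _ _ _ _).trans ?_)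
  congr 1
  · change (Tm.substAt none t.1 none).bind _ = _
    rw [Tm.substAt_self, Tm.rename_bind]
    rfl
  · rw [Tm.rename_bind]
    refine Tm.bind_congr (fun y => ?_) _
    rw [Tm.substAt_ne _ _ _ (by simp)]
    rfl

theorem mulVar_graft {Z : Type} [Nonempty Z] (e : DendGen) (s : Tree dendSig Y)
    (t : Tree dendSig Z) (j : Z → X) (j' : Y → X) :
    ((mulVar e s).graft none t).1.rename (optionElim j j') =
      bin e (s.1.rename j') (t.1.rename j) := by
  refine (Tm.bind_bind _ _ _).trans ((bin_bind _ _ _ _).trans ?_)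
  congr 1
  · rw [Tm.rename_bind]
    refine Tm.bind_congr (fun y => ?_) _
    rw [Tm.substAt_ne _ _ _ (by simp)]
    rfl
  · change (Tm.substAt none t.1 none).bind _ = _
    rw [Tm.substAt_self, Tm.rename_bind]
    rfl

theorem bindL_varMul {Z : Type} [Nonempty Z] (e : DendGen) (s : Tree dendSig Y) (c : k)
    (p : Tree dendSig Z →₀ k) (j : Z → X) (j' : Y → X) :
    bindL (fun y => .var (optionElim j j' y)) (freeComp none (Finsupp.single (varMul e s) c) p) =
      binL e (bindL (fun y => .var (j y)) p) (Finsupp.single (s.1.rename j') c) := by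
  induction p using Finsupp.induction_linear with
  | zero => simp only [map_zero, LinearMap.zero_apply]
  | add f g hf hg => simp only [map_add, LinearMap.add_apply, hf, hg]
  | single t d =>
    rw [freeComp_single, bindL_single, bindL_single, binL_single, mul_comm c d]
    exact congrArg (fun r => Finsupp.single r _) (varMul_graft e s t j j')

theorem bindL_mulVar {Z : Type} [Nonempty Z] (e : DendGen) (s : Tree dendSig Y) (c : k)
    (p : Tree dendSig Z →₀ k) (j : Z → X) (j' : Y → X) :
    bindL (fun y => .var (optionElim j j' y)) (freeComp none (Finsupp.single (mulVar e s) c) p) =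
      binL e (Finsupp.single (s.1.rename j') c) (bindL (fun y => .var (j y)) p) := by
  induction p using Finsupp.induction_linear with
  | zero => simp only [map_zero]
  | add f g hf hg => simp only [map_add, hf, hg]
  | single t d =>
    rw [freeComp_single, bindL_single, bindL_single, binL_single]
    exact congrArg (fun r => Finsupp.single r _) (mulVar_graft e s t j j')

/-- Multiplying by an expression `s` is composing a binary tree containing `s` with the element of
`𝒥` at the leaf `none`. The element of `𝒥` is the inner operation, so a left ideal suffices, on
whichever side the product is taken. -/
theorem binL_mem_of_left {𝒥 : (freeOperad k dendSig).SubSModule} (h𝒥 : 𝒥.IsLeftIdeal)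
    (e : DendGen) {f : Tm dendSig X →₀ k} (hf : f ∈ renames 𝒥 X) (q : Tm dendSig X →₀ k) :
    binL e f q ∈ renames 𝒥 X := by
  induction q using Finsupp.induction_linear with
  | zero => simp
  | add q q' h h' => rw [map_add]; exact Submodule.add_mem _ h h'
  | single t c =>
    refine (Submodule.span_le (p := (renames 𝒥 X).comap
      ((binL e).flip (Finsupp.single t c)))).2 ?_ hf
    rintro _ ⟨Z, _, _, j, p, hp, rfl⟩
    obtain ⟨Y, _, _, j', s, rfl⟩ := t.exists_tree
    have h := bindL_var_mem_renames (𝒥 := 𝒥) (optionElim j j')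
      (h𝒥 none (Finsupp.single (varMul e s) c) p hp)
    have hmem := Set.mem_of_eq_of_mem (s := (renames 𝒥 X : Set _)) (bindL_varMul e s c p j j').symm h
    exact hmem

theorem binL_mem_of_right {𝒥 : (freeOperad k dendSig).SubSModule} (h𝒥 : 𝒥.IsLeftIdeal)
    (e : DendGen) (q : Tm dendSig X →₀ k) {f : Tm dendSig X →₀ k} (hf : f ∈ renames 𝒥 X) :
    binL e q f ∈ renames 𝒥 X := by
  induction q using Finsupp.induction_linear with
  | zero => simp
  | add q q' h h' => rw [map_add]; exact Submodule.add_mem _ h h'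
  | single t c =>
    refine (Submodule.span_le (p := (renames 𝒥 X).comap
      (binL e (Finsupp.single t c)))).2 ?_ hf
    rintro _ ⟨Z, _, _, j, p, hp, rfl⟩
    obtain ⟨Y, _, _, j', s, rfl⟩ := t.exists_tree
    have h := bindL_var_mem_renames (𝒥 := 𝒥) (optionElim j j')
      (h𝒥 none (Finsupp.single (mulVar e s) c) p hp)
    have hmem := Set.mem_of_eq_of_mem (s := (renames 𝒥 X : Set _)) (bindL_mulVar e s c p j j').symm h
    exact hmem

end Bin

/-! ## Sums over the ways to cut a list -/

section CutSum

variable {α : Type u} {M : Type v} {N : Type w} [AddCommGroup M] [AddCommGroup N]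

/-- The sum of `F p q` over all `p` and `q` with `p ++ q = l`. -/
def cutSum (F : List α → List α → M) : List α → M
  | [] => F [] []
  | x :: l => F [] (x :: l) + cutSum (fun p q => F (x :: p) q) l

theorem cutSum_congr {F G : List α → List α → M} {l : List α}
    (h : ∀ p q, p ++ q = l → F p q = G p q) : cutSum F l = cutSum G l := by
  induction l generalizing F G with
  | nil => exact h [] [] rfl
  | cons x l ih =>
    rw [cutSum, cutSum, h [] _ rfl, ih fun p q hpq => h (x :: p) q (by rw [← hpq]; rfl)]

theorem cutSum_zero (l : List α) : cutSum (fun _ _ => (0 : M)) l = 0 := by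
  induction l with
  | nil => rfl
  | cons x l ih => rw [cutSum, ih, add_zero]

theorem cutSum_add (F G : List α → List α → M) (l : List α) :
    cutSum (fun p q => F p q + G p q) l = cutSum F l + cutSum G l := by
  induction l generalizing F G with
  | nil => rfl
  | cons x l ih => rw [cutSum, cutSum, cutSum, ih]; abel

theorem map_cutSum {Φ : Type*} [FunLike Φ M N] [AddMonoidHomClass Φ M N] (φ : Φ)
    (F : List α → List α → M) (l : List α) :
    φ (cutSum F l) = cutSum (fun p q => φ (F p q)) l := by
  induction l generalizing F with
  | nil => rfl
  | cons x l ih => rw [cutSum, cutSum, map_add, ih]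

theorem cutSum_mem {S : Type*} [SetLike S M] [AddSubmonoidClass S M] (P : S)
    {F : List α → List α → M} {l : List α} (h : ∀ p q, p ++ q = l → F p q ∈ P) :
    cutSum F l ∈ P := by
  induction l generalizing F with
  | nil => exact h [] [] rfl
  | cons x l ih =>
    exact add_mem (h [] _ rfl) (ih fun p q hpq => h (x :: p) q (by rw [← hpq]; rfl))

theorem cutSum_map {β : Type*} (f : β → α) (F : List α → List α → M) (l : List β) :
    cutSum F (l.map f) = cutSum (fun p q => F (p.map f) (q.map f)) l := by
  induction l generalizing F with
  | nil => rfl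
  | cons x l ih => rw [List.map_cons, cutSum, cutSum, ih]; rfl

theorem cutSum_append_singleton (F : List α → List α → M) (l : List α) (y : α) :
    cutSum F (l ++ [y]) = cutSum (fun p q => F p (q ++ [y])) l + F (l ++ [y]) [] := by
  induction l generalizing F with
  | nil => rfl
  | cons x l ih => rw [List.cons_append, cutSum, cutSum, ih, add_assoc]; rfl

/-- Only the first term of the sum is nonzero. -/
theorem cutSum_eq_first {F : List α → List α → M} {l : List α}
    (h : ∀ p q, p ++ q = l → p ≠ [] → F p q = 0) : cutSum F l = F [] l := by
  cases l with
  | nil => rfl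
  | cons x l =>
    rw [cutSum, cutSum_congr (G := fun _ _ => 0) fun p q hpq =>
      h (x :: p) q (by rw [← hpq]; rfl) (List.cons_ne_nil _ _), cutSum_zero, add_zero]

/-- Coassociativity of deconcatenation: both sides run over the cuts of `l` into three pieces. -/
theorem cutSum_assoc (F : List α → List α → List α → M) (l : List α) :
    cutSum (fun p q => cutSum (fun r s => F r s q) p) l =
      cutSum (fun p q => cutSum (fun r s => F p r s) q) l := by
  induction l generalizing F with
  | nil => rfl
  | cons x l ih =>
    simp only [cutSum]
    rw [cutSum_add, ih (fun r s q => F (x :: r) s q), add_assoc]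

theorem cutSum_comm {β : Type*} (F : List α → List α → List β → List β → M) (l : List α)
    (m : List β) : cutSum (fun p q => cutSum (fun r s => F p q r s) m) l =
      cutSum (fun r s => cutSum (fun p q => F p q r s) l) m := by
  induction l generalizing F with
  | nil => rfl
  | cons x l ih => rw [cutSum, ih, ← cutSum_add]; rfl

/-- Mark a letter `x` of `l`, with `p` before and `q` after it. `F` sees `x` as the end of the left
piece, `F'` as the start of the right piece; the two isolated terms are the cuts without such a
letter. This is the telescoping device for `searU_mul_nearU`. -/
theorem cutSum_shift {F F' : List α → List α → M} {H : List α → α → List α → M}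
    (hF : ∀ p x q, F (p ++ [x]) q = H p x q) (hF' : ∀ p x q, F' p (x :: q) = H p x q)
    (l : List α) : cutSum F l + F' l [] = F [] l + cutSum F' l := by
  induction l generalizing F F' H with
  | nil => rfl
  | cons x l ih =>
    have h := ih (F := fun p q => F (x :: p) q) (F' := fun p q => F' (x :: p) q)
      (H := fun p y q => H (x :: p) y q) (fun p y q => hF (x :: p) y q)
      (fun p y q => hF' (x :: p) y q)
    simp only [cutSum]
    rw [add_assoc, h, hF' [] x l, ← hF [] x l]
    rfl

end CutSum

/-! ## Dendriform algebras -/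

/-- A dendriform algebra; the ring multiplication is the sum of the two products. -/
class Dendriform (k : Type u) (A : Type v) [CommRing k] [NonUnitalRing A] [Module k A] where
  dprec : A →ₗ[k] A →ₗ[k] A
  dsucc : A →ₗ[k] A →ₗ[k] A
  mul_eq : ∀ x y : A, x * y = dprec x y + dsucc x y
  prec_prec : ∀ x y z : A, dprec (dprec x y) z = dprec x (y * z)
  succ_prec : ∀ x y z : A, dprec (dsucc x y) z = dsucc x (dprec y z)
  succ_succ : ∀ x y z : A, dsucc x (dsucc y z) = dsucc (x * y) z

open Dendriform

section DendAlg

variable (k : Type u) [CommRing k] {A : Type v} [NonUnitalRing A] [Module k A] [Dendriform k A]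

theorem Dendriform.isScalarTower (k : Type u) (A : Type v) [CommRing k] [NonUnitalRing A]
    [Module k A] [Dendriform k A] : IsScalarTower k A A :=
  ⟨fun c x y => by simp [mul_eq (k := k)]⟩

theorem Dendriform.smulCommClass (k : Type u) (A : Type v) [CommRing k] [NonUnitalRing A]
    [Module k A] [Dendriform k A] : SMulCommClass k A A :=
  ⟨fun c x y => by simp [mul_eq (k := k)]⟩

attribute [local instance] Dendriform.isScalarTower Dendriform.smulCommClass

variable {k}

/-- The left action of the unitization of `A` extending `≻`. -/
def lAct : Unitization k A →ₗ[k] A →ₗ[k] A :=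
  LinearMap.mk₂ k (fun u z => u.fst • z + dsucc (k := k) u.snd z)
    (fun u u' z => by simp [add_smul]; abel) (fun c u z => by simp [mul_smul])
    (fun u z z' => by simp; abel) (fun c u z => by simp [smul_comm c])

/-- The right action of the unitization of `A` extending `≺`. -/
def rAct : Unitization k A →ₗ[k] A →ₗ[k] A :=
  LinearMap.mk₂ k (fun u z => u.fst • z + dprec (k := k) z u.snd)
    (fun u u' z => by simp [add_smul]; abel) (fun c u z => by simp [mul_smul])
    (fun u z z' => by simp; abel) (fun c u z => by simp [smul_comm c])

theorem lAct_apply (u : Unitization k A) (z : A) : lAct u z = u.fst • z + dsucc (k := k) u.snd z := rfl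

theorem rAct_apply (u : Unitization k A) (z : A) : rAct u z = u.fst • z + dprec (k := k) z u.snd := rfl

@[simp] theorem lAct_inr (x z : A) : lAct (Unitization.inr x : Unitization k A) z =
    dsucc (k := k) x z := by
  simp [lAct_apply]

@[simp] theorem rAct_inr (x z : A) : rAct (Unitization.inr x : Unitization k A) z =
    dprec (k := k) z x := by
  simp [rAct_apply]

@[simp] theorem lAct_one (z : A) : lAct (1 : Unitization k A) z = z := by
  simp [lAct_apply]

@[simp] theorem rAct_one (z : A) : rAct (1 : Unitization k A) z = z := by
  simp [rAct_apply]

/-- The axioms say that `A` is a bimodule over its unitization: the third is the left module law,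
the first is the right module law `rAct_mul`, and the second is the commutation `rAct_lAct`. -/
theorem lAct_mul (u v : Unitization k A) (z : A) : lAct (u * v) z = lAct u (lAct v z) := by
  simp only [lAct_apply, Unitization.fst_mul, Unitization.snd_mul, map_add, map_smul,
    LinearMap.add_apply, LinearMap.smul_apply, smul_add, succ_succ, mul_smul]
  rw [smul_comm v.fst u.fst z]
  abel

theorem rAct_mul (u v : Unitization k A) (z : A) : rAct (u * v) z = rAct v (rAct u z) := by
  simp only [rAct_apply, Unitization.fst_mul, Unitization.snd_mul, map_add, map_smul,
    smul_add, prec_prec, mul_smul]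
  abel

theorem rAct_lAct (u v : Unitization k A) (z : A) : rAct v (lAct u z) = lAct u (rAct v z) := by
  simp only [rAct_apply, lAct_apply, map_add, map_smul,
    smul_add, succ_prec, smul_comm v.fst]
  abel

theorem unitization_mul_eq (u v : Unitization k A) : u * v =
    Unitization.inl (u.fst * v.fst) + Unitization.inr (rAct v u.snd + lAct u v.snd) := by
  ext
  · simp
  · simp only [rAct_apply, lAct_apply, Unitization.snd_mul, mul_eq (k := k), Unitization.snd_add,
      Unitization.snd_inl, Unitization.snd_inr, zero_add]
    abel

variable (k)

/-- `(-1)ⁿ ↗(x₁, …, xₙ)`, with value `1` at the empty list. -/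
def nearU : List A → Unitization k A
  | [] => 1
  | x :: l => Unitization.inr (-rAct (nearU l) x)

/-- `↘(x₁, …, xₙ)`, with value `1` at the empty list. -/
def searU (l : List A) : Unitization k A :=
  l.foldl (fun u x => Unitization.inr (lAct u x)) 1

@[simp] theorem nearU_nil : nearU k ([] : List A) = 1 := rfl

@[simp] theorem searU_nil : searU k ([] : List A) = 1 := rfl

theorem nearU_cons (x : A) (l : List A) :
    nearU k (x :: l) = Unitization.inr (-rAct (nearU k l) x) := rfl

theorem searU_append_singleton (l : List A) (x : A) :
    searU k (l ++ [x]) = Unitization.inr (lAct (searU k l) x) := by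
  simp [searU, List.foldl_append]

theorem nearU_fst {l : List A} (hl : l ≠ []) : (nearU k l).fst = 0 := by
  obtain ⟨x, l, rfl⟩ := List.exists_cons_of_ne_nil hl
  simp [nearU_cons]

theorem searU_fst {l : List A} (hl : l ≠ []) : (searU k l).fst = 0 := by
  rw [← List.dropLast_append_getLast hl, searU_append_singleton, Unitization.fst_inr]

/-- Split each product into its ≺ and ≻ halves. The ≺ half releases the first letter of the list,
the ≻ half the last one, each acted upon by the same convolution over a shorter list. By induction
both halves vanish unless the list has one letter `x`, when they are `-x` and `x`. -/
theorem nearU_mul_searU (l : List A) :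
    cutSum (fun p q => nearU k p * searU k q) l = if l = [] then 1 else 0 := by
  induction hn : l.length using Nat.strong_induction_on generalizing l with
  | _ n ih =>
    by_cases hl : l = []
    · subst hl
      simp [cutSum]
    rw [if_neg hl]
    have h0 : cutSum (fun p q => nearU k p * searU k q) l = Unitization.inr
        (cutSum (fun p q => rAct (searU k q) (nearU k p).snd) l +
          cutSum (fun p q => lAct (nearU k p) (searU k q).snd) l) := by
      rw [← cutSum_add, ← Unitization.inrHom_apply (R := k) (S := k), map_cutSum]
      refine cutSum_congr fun p q hpq => ?_
      rw [unitization_mul_eq]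
      have : (nearU k p).fst * (searU k q).fst = 0 := by
        rcases eq_or_ne p [] with rfl | hp
        · rw [searU_fst k (by simpa using hpq.trans_ne hl), mul_zero]
        · rw [nearU_fst k hp, zero_mul]
      rw [this, Unitization.inl_zero, zero_add]
      rfl
    have h1 : ∀ (x : A) m, m.length < n → cutSum (fun p q => rAct (searU k q) (nearU k p).snd) (x :: m) =
        if m = [] then -x else 0 := by
      intro x m hm
      rw [cutSum, nearU_nil, Unitization.snd_one, map_zero, zero_add]
      have : cutSum (fun p q => rAct (searU k q) (nearU k (x :: p)).snd) m =
          ((rAct : Unitization k A →ₗ[k] _).flip (-x))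
            (cutSum (fun p q => nearU k p * searU k q) m) := by
        rw [map_cutSum]
        refine cutSum_congr fun p q _ => ?_
        rw [LinearMap.flip_apply, rAct_mul, nearU_cons, Unitization.snd_inr, map_neg, map_neg, map_neg]
      rw [this, ih _ hm m rfl]
      split_ifs <;> simp
    have h2 : ∀ (x : A) m, m.length < n →
        cutSum (fun p q => lAct (nearU k p) (searU k q).snd) (m ++ [x]) =
          if m = [] then x else 0 := by
      intro x m hm
      rw [cutSum_append_singleton, searU_nil, Unitization.snd_one, map_zero, add_zero]
      have : cutSum (fun p q => lAct (nearU k p) (searU k (q ++ [x])).snd) m =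
          ((lAct : Unitization k A →ₗ[k] _).flip x)
            (cutSum (fun p q => nearU k p * searU k q) m) := by
        rw [map_cutSum]
        refine cutSum_congr fun p q _ => ?_
        rw [LinearMap.flip_apply, lAct_mul, searU_append_singleton, Unitization.snd_inr]
      rw [this, ih _ hm m rfl]
      split_ifs <;> simp
    rw [h0]
    have e1 : cutSum (fun p q => rAct (searU k q) (nearU k p).snd) l =
        if l.tail = [] then -l.head hl else 0 := by
      conv_lhs => rw [← List.cons_head_tail hl]
      refine h1 _ _ ?_
      have := List.length_pos_iff.2 hl
      rw [List.length_tail]; omega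
    have e2 : cutSum (fun p q => lAct (nearU k p) (searU k q).snd) l =
        if l.dropLast = [] then l.getLast hl else 0 := by
      conv_lhs => rw [← List.dropLast_append_getLast hl]
      refine h2 _ _ ?_
      have := List.length_pos_iff.2 hl
      rw [List.length_dropLast]; omega
    rw [e1, e2]
    match l, hl with
    | [x], _ => simp
    | x :: y :: m, _ => simp

/-- For each letter `x` with `p` before and `q` after it, the ≺ half contributes S(p)·x·N(q) and the
≻ half its opposite. The recursions defining `searU` and `nearU` make the cancellation exact. -/
theorem searU_mul_nearU (l : List A) :
    cutSum (fun p q => searU k p * nearU k q) l = if l = [] then 1 else 0 := by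
  by_cases hl : l = []
  · subst hl
    simp [cutSum]
  rw [if_neg hl]
  have h0 : cutSum (fun p q => searU k p * nearU k q) l = Unitization.inr
      (cutSum (fun p q => rAct (nearU k q) (searU k p).snd) l +
        cutSum (fun p q => lAct (searU k p) (nearU k q).snd) l) := by
    rw [← cutSum_add, ← Unitization.inrHom_apply (R := k) (S := k), map_cutSum]
    refine cutSum_congr fun p q hpq => ?_
    rw [unitization_mul_eq]
    have : (searU k p).fst * (nearU k q).fst = 0 := by
      rcases eq_or_ne p [] with rfl | hp
      · rw [nearU_fst k (by simpa using hpq.trans_ne hl), mul_zero]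
      · rw [searU_fst k hp, zero_mul]
    rw [this, Unitization.inl_zero, zero_add]
    rfl
  have h1 := cutSum_shift (F := fun p q : List A => rAct (nearU k q) (searU k p).snd)
    (F' := fun p q : List A => -lAct (searU k p) (nearU k q).snd)
    (H := fun p x q => lAct (searU k p) (rAct (nearU k q) x))
    (fun p x q => by simp only [searU_append_singleton, Unitization.snd_inr, rAct_lAct])
    (fun p x q => by simp only [nearU_cons, Unitization.snd_inr, map_neg, neg_neg]) l
  simp only [nearU_nil, searU_nil, Unitization.snd_one, map_zero, neg_zero, add_zero, zero_add]
    at h1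
  rw [h0, h1, ← cutSum_add, cutSum_congr (G := fun _ _ => 0), cutSum_zero, Unitization.inr_zero]
  intro p q _
  exact neg_add_cancel _

/-- `∑ᵢ (-1)ⁱ ↗(x₁, …, xᵢ) ≻ z ≺ ↘(xᵢ₊₁, …, xₙ)`. -/
def br (z : A) (l : List A) : A := cutSum (fun p q => lAct (nearU k p) (rAct (searU k q) z)) l

@[simp] theorem br_nil (z : A) : br k z [] = z := by simp [br, cutSum]

end DendAlg

section Cancel

variable {α : Type u} {M : Type v} [AddCommGroup M]

/-- Only the last term of the sum is nonzero. -/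
theorem cutSum_eq_last {F : List α → List α → M} {l : List α}
    (h : ∀ p q, p ++ q = l → q ≠ [] → F p q = 0) : cutSum F l = F l [] := by
  induction l generalizing F with
  | nil => rfl
  | cons x l ih =>
    rw [cutSum, h [] _ rfl (List.cons_ne_nil _ _), zero_add,
      ih fun p q hpq => h (x :: p) q (by rw [← hpq]; rfl)]

theorem neg_cutSum (F : List α → List α → M) (l : List α) :
    cutSum (fun p q => -F p q) l = -cutSum F l :=
  (map_cutSum (negAddMonoidHom : M →+ M) F l).symm

end Cancel

/-! ### The brace relation in a dendriform algebra, by convolution. -/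

section Brace

variable (k : Type u) [CommRing k] {A : Type v} [NonUnitalRing A] [Module k A] [Dendriform k A]

attribute [local instance] Dendriform.isScalarTower Dendriform.smulCommClass

/-- Expanding the brace gives Σ N(p)·x·S(q)N(s) over the cuts of `l` into three pieces; convolving S
with N leaves only the terms with q and s empty. -/
theorem cutSum_rAct_br (x : A) (l : List A) :
    cutSum (fun r s => rAct (nearU k s) (br k x r)) l = lAct (nearU k l) x := by
  have h1 : ∀ r s : List A, rAct (nearU k s) (br k x r) =
      cutSum (fun p q => lAct (nearU k p) (rAct (searU k q * nearU k s) x)) r := by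
    intro r s
    rw [br, map_cutSum]
    refine cutSum_congr fun p q _ => ?_
    rw [rAct_lAct, rAct_mul]
  simp only [h1]
  rw [cutSum_assoc (fun p q s => lAct (nearU k p) (rAct (searU k q * nearU k s) x))]
  have h2 : ∀ p q : List A,
      cutSum (fun r s => lAct (nearU k p) (rAct (searU k r * nearU k s) x)) q =
        lAct (nearU k p) (rAct (if q = [] then (1 : Unitization k A) else 0) x) := by
    intro p q
    rw [← searU_mul_nearU]
    exact (map_cutSum ((lAct (nearU k p)) ∘ₗ (rAct : Unitization k A →ₗ[k] _).flip x)
      (fun r s => searU k r * nearU k s) q).symm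
  simp only [h2]
  rw [cutSum_eq_last]
  · simp
  · intro p q _ hq
    simp [hq]

/-- The sum of `G W` over the lists `W = Y₀, {x₁ ∣ Y₁}, Y₂, …, {xₙ ∣ Y₂ₙ₋₁}, Y₂ₙ`, for all
partitions of the list `ys` into successive intervals. -/
def brSum {M : Type w} [AddCommGroup M] : List A → List A → (List A → M) → M
  | [], ys, G => G ys
  | x :: xs, ys, G => cutSum (fun p q => cutSum (fun r s =>
      brSum xs s fun W => G (p ++ br k x r :: W)) q) ys

section

variable {M : Type*} {N : Type*} [AddCommGroup M] [AddCommGroup N]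

theorem brSum_cons_nil (x : A) (xs : List A) (G : List A → M) :
    brSum k (x :: xs) [] G = brSum k xs [] fun W => G (x :: W) := by
  simp [brSum, cutSum]

theorem brSum_cons_cons (x y : A) (xs ys : List A) (G : List A → M) :
    brSum k (x :: xs) (y :: ys) G =
      cutSum (fun r s => brSum k xs s fun W => G (br k x r :: W)) (y :: ys) +
        brSum k (x :: xs) ys fun W => G (y :: W) := rfl

theorem map_brSum {Φ : Type*} [FunLike Φ M N] [AddMonoidHomClass Φ M N] (φ : Φ)
    (xs ys : List A) (G : List A → M) :
    φ (brSum k xs ys G) = brSum k xs ys fun W => φ (G W) := by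
  induction xs generalizing ys G with
  | nil => rfl
  | cons x xs ih => simp only [brSum, map_cutSum, ih]

theorem brSum_add (xs ys : List A) (G H : List A → M) :
    brSum k xs ys (fun W => G W + H W) = brSum k xs ys G + brSum k xs ys H := by
  induction xs generalizing ys G H with
  | nil => rfl
  | cons x xs ih => simp only [brSum, ih, cutSum_add]

/-- A cut of W never separates the contents of a single entry, so it amounts to a cut of `xs` and a
cut of `ys`: substitution of braces is compatible with deconcatenation. -/
theorem brSum_cutSum (xs ys : List A) (G : List A → List A → M) :
    brSum k xs ys (cutSum G) = cutSum (fun xs₁ xs₂ => cutSum (fun ys₁ ys₂ =>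
      brSum k xs₁ ys₁ fun W₁ => brSum k xs₂ ys₂ fun W₂ => G W₁ W₂) ys) xs := by
  induction xs generalizing ys G with
  | nil => rfl
  | cons x xs ihx =>
    -- The contribution of the lists W whose first entry is the brace of `x`, that is, with `Y₀`
    -- empty.
    have hfirst : ∀ (ys : List A) (G : List A → List A → M),
        cutSum (fun r s => brSum k xs s fun W => cutSum G (br k x r :: W)) ys =
          cutSum (fun r s => brSum k xs s fun W => G [] (br k x r :: W)) ys +
          cutSum (fun xs₁ xs₂ => cutSum (fun ys₁ ys₂ => cutSum (fun r s => brSum k xs₁ s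
            fun W₁ => brSum k xs₂ ys₂ fun W₂ => G (br k x r :: W₁) W₂) ys₁) ys) xs := by
      intro ys G
      simp only [cutSum]
      simp only [brSum_add, cutSum_add, ihx]
      congr 1
      rw [cutSum_comm]
      refine cutSum_congr fun xs₁ xs₂ _ => ?_
      rw [cutSum_assoc (fun r s ys₂ => brSum k xs₁ s fun W₁ => brSum k xs₂ ys₂ fun W₂ =>
        G (br k x r :: W₁) W₂)]
    induction ys generalizing G with
    | nil =>
      have h := hfirst [] G
      simp only [cutSum, br_nil] at h
      simp only [brSum_cons_nil, cutSum]
      exact h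
    | cons y ys ihy =>
      have h2 : (brSum k (x :: xs) ys fun W => cutSum G (y :: W)) =
          (brSum k (x :: xs) ys fun W => G [] (y :: W)) +
            brSum k (x :: xs) ys (cutSum fun p q => G (y :: p) q) := by
        rw [← brSum_add]
        rfl
      -- The left factor starts either with the brace of `x` or with `y`; when its share of `y ::
      -- ys` is empty, only the first case occurs.
      have h3 : ∀ xs₁ xs₂ : List A, cutSum (fun ys₁ ys₂ => brSum k (x :: xs₁) ys₁
          fun W₁ => brSum k xs₂ ys₂ fun W₂ => G W₁ W₂) (y :: ys) =
          cutSum (fun ys₁ ys₂ => cutSum (fun r s => brSum k xs₁ s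
            fun W₁ => brSum k xs₂ ys₂ fun W₂ => G (br k x r :: W₁) W₂) ys₁) (y :: ys) +
          cutSum (fun ys₁ ys₂ => brSum k (x :: xs₁) ys₁
            fun W₁ => brSum k xs₂ ys₂ fun W₂ => G (y :: W₁) W₂) ys := by
        intro xs₁ xs₂
        rw [cutSum.eq_2 _ y ys, cutSum.eq_2 (fun ys₁ ys₂ => cutSum (fun r s => brSum k xs₁ s
            fun W₁ => brSum k xs₂ ys₂ fun W₂ => G (br k x r :: W₁) W₂) ys₁) y ys, add_assoc,
          ← cutSum_add]
        simp only [brSum_cons_cons, brSum_cons_nil]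
        rw [cutSum.eq_1, br_nil]
      have h4 := brSum_cons_cons k x y xs ys (G [])
      have h5 : ∀ (F : List A → List A → M), cutSum F (x :: xs) =
          F [] (x :: xs) + cutSum (fun p q => F (x :: p) q) xs := fun _ => rfl
      rw [brSum_cons_cons, hfirst, h2, ihy, h5, h5]
      simp only [h3]
      rw [cutSum_add]
      change _ = (brSum k (x :: xs) (y :: ys) (G []) + cutSum (fun ys₁ ys₂ => brSum k [] ys₁
        fun W₁ => brSum k (x :: xs) ys₂ fun W₂ => G (y :: W₁) W₂) ys) + _
      rw [h4]
      abel

theorem brSum_ite (xs ys : List A) (c : M) :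
    (brSum k xs ys fun W => if W = [] then c else 0) = if xs = [] ∧ ys = [] then c else 0 := by
  cases xs with
  | nil => simp [brSum]
  | cons x xs =>
    have h : ∀ (p : List A) (a : A) (W : List A), (p ++ a :: W = []) = False := by simp
    have h0 : ∀ s : List A, (brSum k xs s fun _ => (0 : M)) = 0 := fun s => by
      simpa using (map_brSum k (0 : M →+ M) xs s fun _ => 0).symm
    simp [brSum, h, h0, cutSum_zero]

end

/-- `nearU` is defined from the first entry, which is either `y` or a brace of `x`. These two cases
give respectively the ≺ and ≻ halves of the product N(y ys)N(x xs). -/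
theorem brSum_nearU (xs ys : List A) :
    brSum k xs ys (nearU k) = nearU k ys * nearU k xs := by
  induction xs generalizing ys with
  | nil => simp [brSum]
  | cons x xs ihx =>
    -- For a first entry {x ∣ r}, induction turns the tail into N(s)N(xs); the sum of {x ∣ r}·N(s)
    -- over the cuts of `ys` is N(ys)·x by `cutSum_rAct_br`.
    have hfirst : ∀ ys : List A,
        cutSum (fun r s => brSum k xs s fun W => nearU k (br k x r :: W)) ys =
          Unitization.inr (-rAct (nearU k xs) (lAct (nearU k ys) x)) := by
      intro ys
      have h1 : ∀ r s : List A, (brSum k xs s fun W => nearU k (br k x r :: W)) =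
          (Unitization.inrHom (S := k) k A ∘ₗ (-rAct (nearU k xs)))
            (rAct (nearU k s) (br k x r)) := by
        intro r s
        have := map_brSum k (Unitization.inrHom (S := k) k A ∘ₗ
          (-((rAct : Unitization k A →ₗ[k] _).flip (br k x r)))) xs s (nearU k)
        refine Eq.trans ?_ (this.symm.trans ?_)
        · rfl
        · rw [ihx]
          simp [rAct_mul]
      simp only [h1]
      rw [← map_cutSum, cutSum_rAct_br]
      simp
    induction ys with
    | nil =>
      have h := hfirst []
      simp only [cutSum, br_nil] at h
      rw [brSum_cons_nil, h]
      simp [nearU_cons]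
    | cons y ys ihy =>
      have h1 := map_brSum k (Unitization.inrHom (S := k) k A ∘ₗ
          (-((rAct : Unitization k A →ₗ[k] _).flip y))) (x :: xs) ys (nearU k)
      rw [brSum_cons_cons, hfirst]
      refine (congrArg _ (h1.symm.trans (congrArg _ ihy))).trans ?_
      rw [unitization_mul_eq (nearU k (y :: ys))]
      have h2 := rAct_lAct (Unitization.inr (rAct (nearU k ys) y)) (nearU k xs) x
      simp only [lAct_inr] at h2
      simp [nearU_cons, rAct_mul, h2, add_comm]

/-- Convolution with N is unitriangular: the term with both left pieces empty is `D xs ys` itself,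
and all others involve `D` on shorter input. -/
theorem eq_zero_of_conv {D : List A → List A → Unitization k A}
    (hD : ∀ xs ys, cutSum (fun xs₁ xs₂ => cutSum (fun ys₁ ys₂ =>
      nearU k ys₁ * nearU k xs₁ * D xs₂ ys₂) ys) xs = 0) (xs ys : List A) : D xs ys = 0 := by
  induction hn : xs.length + ys.length using Nat.strong_induction_on generalizing xs ys with
  | _ n ih =>
    have h := hD xs ys
    rw [cutSum_eq_first, cutSum_eq_first] at h
    · simpa using h
    · intro p q hpq hp
      have := List.length_pos_iff.2 hp
      rw [ih _ _ xs q rfl, mul_zero]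
      rw [← hn, ← hpq, List.length_append]
      omega
    · intro p q hpq hp
      have := List.length_pos_iff.2 hp
      refine (cutSum_congr fun r s hrs => ?_).trans (cutSum_zero _)
      rw [ih _ _ q s rfl, mul_zero]
      rw [← hn, ← hpq, ← hrs, List.length_append, List.length_append]
      omega

/-- Both sides have the same convolution with N(ys₁)N(xs₁), namely the indicator of two empty lists:
the left side because `brSum_nearU` and `brSum_cutSum` reduce it to the sum of N * S over W, the
right side by cancelling N * S first for `xs` and then for `ys`. -/
theorem brSum_searU (xs ys : List A) :
    brSum k xs ys (searU k) = searU k xs * searU k ys := by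
  rw [← sub_eq_zero]
  refine eq_zero_of_conv k (D := fun xs ys => brSum k xs ys (searU k) - searU k xs * searU k ys)
    (fun xs ys => ?_) xs ys
  have h1 : cutSum (fun xs₁ xs₂ => cutSum (fun ys₁ ys₂ =>
      nearU k ys₁ * nearU k xs₁ * brSum k xs₂ ys₂ (searU k)) ys) xs =
      if xs = [] ∧ ys = [] then 1 else 0 := by
    have h := brSum_cutSum k xs ys fun p q : List A => nearU k p * searU k q
    have hδ : cutSum (fun p q : List A => nearU k p * searU k q) =
        fun l => if l = [] then 1 else 0 := funext (nearU_mul_searU k)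
    rw [hδ, brSum_ite] at h
    rw [h]
    refine cutSum_congr fun xs₁ xs₂ _ => cutSum_congr fun ys₁ ys₂ _ => ?_
    rw [← brSum_nearU]
    refine (map_brSum k (AddMonoidHom.mulRight (brSum k xs₂ ys₂ (searU k))) xs₁ ys₁
      (nearU k)).trans (congrArg _ (funext fun W => ?_))
    exact map_brSum k (AddMonoidHom.mulLeft (nearU k W)) xs₂ ys₂ (searU k)
  have h2 : cutSum (fun xs₁ xs₂ => cutSum (fun ys₁ ys₂ =>
      nearU k ys₁ * nearU k xs₁ * (searU k xs₂ * searU k ys₂)) ys) xs =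
      if xs = [] ∧ ys = [] then 1 else 0 := by
    rw [cutSum_comm]
    have h : ∀ ys₁ ys₂ : List A, cutSum (fun xs₁ xs₂ =>
        nearU k ys₁ * nearU k xs₁ * (searU k xs₂ * searU k ys₂)) xs =
        (if xs = [] then 1 else 0) * (nearU k ys₁ * searU k ys₂) := by
      intro ys₁ ys₂
      have e := map_cutSum ((AddMonoidHom.mulLeft (nearU k ys₁)).comp
        (AddMonoidHom.mulRight (searU k ys₂))) (fun p q => nearU k p * searU k q) xs
      rw [nearU_mul_searU] at e
      refine Eq.trans (cutSum_congr fun p q _ => ?_) (e.symm.trans ?_)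
      · simp [mul_assoc]
      · split_ifs <;> simp
    simp only [h]
    have e := map_cutSum (AddMonoidHom.mulLeft (if xs = [] then (1 : Unitization k A) else 0))
      (fun p q => nearU k p * searU k q) ys
    rw [nearU_mul_searU] at e
    refine e.symm.trans ?_
    by_cases hx : xs = [] <;> by_cases hy : ys = [] <;> simp [hx, hy]
  rw [← sub_self (if xs = [] ∧ ys = [] then (1 : Unitization k A) else 0)]
  nth_rw 1 [← h1]
  rw [← h2, sub_eq_add_neg, ← neg_cutSum, ← cutSum_add]
  refine cutSum_congr fun _ _ _ => ?_
  rw [← neg_cutSum, ← cutSum_add]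
  refine cutSum_congr fun _ _ _ => ?_
  rw [mul_sub, sub_eq_add_neg]

/-- The brace relation holds in every dendriform algebra. -/
theorem br_br (z : A) (xs ys : List A) :
    br k (br k z xs) ys = brSum k xs ys (br k z) := by
  have h : br k z = cutSum fun p q => lAct (nearU k p) (rAct (searU k q) z) := rfl
  -- The brace by W is a sum over the cuts of W; `brSum_cutSum` separates its N and S factors, and
  -- each becomes a product by the two preceding lemmas.
  have h1 : brSum k xs ys (br k z) = cutSum (fun xs₁ xs₂ => cutSum (fun ys₁ ys₂ =>
      lAct (nearU k ys₁ * nearU k xs₁) (rAct (searU k xs₂ * searU k ys₂) z)) ys) xs := by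
    rw [h, brSum_cutSum]
    refine cutSum_congr fun xs₁ xs₂ _ => cutSum_congr fun ys₁ ys₂ _ => ?_
    have e : ∀ u : Unitization k A, (brSum k xs₂ ys₂ fun W => lAct u (rAct (searU k W) z)) =
        lAct u (rAct (searU k xs₂ * searU k ys₂) z) := by
      intro u
      rw [← brSum_searU]
      exact (map_brSum k (lAct u ∘ₗ (rAct : Unitization k A →ₗ[k] _).flip z) xs₂ ys₂
        (searU k)).symm
    simp only [e]
    rw [← brSum_nearU]
    exact (map_brSum k ((lAct : Unitization k A →ₗ[k] _).flip _) xs₁ ys₁ (nearU k)).symm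
  rw [h1, cutSum_comm, br]
  refine cutSum_congr fun ys₁ ys₂ _ => ?_
  rw [br, map_cutSum, map_cutSum]
  refine cutSum_congr fun xs₁ xs₂ _ => ?_
  -- N(ys₁)N(xs₁)·z·S(xs₂)S(ys₂) is regrouped with the `xs` factors innermost, as in the iterated
  -- brace.
  rw [rAct_lAct, rAct_mul, lAct_mul]

end Brace

theorem ofFn_update {α : Type*} {n : ℕ} (v : Fin n → α) (a : Fin n) (x : α) :
    List.ofFn (Function.update v a x) =
      (List.ofFn v).take a ++ x :: (List.ofFn v).drop (a + 1) := by
  refine List.ext_getElem (by simp; omega) fun i h h' => ?_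
  simp only [List.getElem_ofFn, List.getElem_append, List.length_take, List.length_ofFn,
    List.getElem_take, List.getElem_cons, List.getElem_drop, Function.update_apply, Fin.ext_iff]
  have ha := a.2
  simp only [min_eq_left ha.le]
  split_ifs <;> first | omega | rfl | skip
  congr 2
  omega

/-! ### Multilinearity of braces, and naturality under dendriform morphisms. -/

section CutSumLinear

variable {k : Type u} [CommRing k] {α : Type v} {M : Type w} [AddCommGroup M] [Module k M]
  {B : Type*} [AddCommGroup B] [Module k B]

theorem cutSum_isLinearMap {F : B → List α → List α → M}
    (h : ∀ p q, IsLinearMap k fun x => F x p q) (l : List α) :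
    IsLinearMap k fun x => cutSum (F x) l :=
  ⟨fun x y => by
    rw [← cutSum_add]
    exact cutSum_congr fun p q _ => (h p q).map_add x y, fun c x => by
    rw [← DistribSMul.toAddMonoidHom_apply M c (cutSum _ l), map_cutSum]
    exact cutSum_congr fun p q _ => (h p q).map_smul c x⟩

theorem cutSum_slot_isLinearMap {F : List B → List B → M}
    (h₁ : ∀ p r q, IsLinearMap k fun x => F (p ++ x :: r) q)
    (h₂ : ∀ p q r, IsLinearMap k fun x => F p (q ++ x :: r)) (l m : List B) :
    IsLinearMap k fun x => cutSum F (l ++ x :: m) := by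
  induction l generalizing F with
  | nil =>
    have h := cutSum_isLinearMap (F := fun x p q => F (x :: p) q) (fun p q => h₁ [] p q) m
    exact ((h₂ [] [] m).mk' + h.mk').isLinear
  | cons y l ih =>
    have h := ih (F := fun p q => F (y :: p) q) (fun p r q => h₁ (y :: p) r q)
      fun p q r => h₂ (y :: p) q r
    exact ((h₂ [] (y :: l) m).mk' + h.mk').isLinear

end CutSumLinear

section DendAlg

variable (k : Type u) [CommRing k] {A : Type v} [NonUnitalRing A] [Module k A] [Dendriform k A]

attribute [local instance] Dendriform.isScalarTower Dendriform.smulCommClass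

theorem nearU_isLinearMap (l m : List A) : IsLinearMap k fun x => nearU k (l ++ x :: m) := by
  induction l with
  | nil =>
    exact (Unitization.inrHom (S := k) k A ∘ₗ (-rAct (nearU k m))).isLinear
  | cons y l ih =>
    exact (Unitization.inrHom (S := k) k A ∘ₗ
      (-(rAct : Unitization k A →ₗ[k] _).flip y) ∘ₗ ih.mk').isLinear

theorem searU_isLinearMap (l m : List A) : IsLinearMap k fun x => searU k (l ++ x :: m) := by
  induction m using List.reverseRecOn with
  | nil =>
    simp only [searU_append_singleton]
    exact (Unitization.inrHom (S := k) k A ∘ₗ lAct (searU k l)).isLinear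
  | append_singleton m y ih =>
    have h : ∀ x, l ++ x :: (m ++ [y]) = (l ++ x :: m) ++ [y] := by simp
    simp only [h, searU_append_singleton]
    exact (Unitization.inrHom (S := k) k A ∘ₗ
      (lAct : Unitization k A →ₗ[k] _).flip y ∘ₗ ih.mk').isLinear

theorem br_isLinearMap (l : List A) : IsLinearMap k fun z => br k z l :=
  cutSum_isLinearMap (fun p q => (lAct (nearU k p) ∘ₗ rAct (searU k q)).isLinear) l

theorem br_slot_isLinearMap (z : A) (l m : List A) :
    IsLinearMap k fun x => br k z (l ++ x :: m) :=
  cutSum_slot_isLinearMap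
    (fun p r _ => ((lAct : Unitization k A →ₗ[k] _).flip _ ∘ₗ (nearU_isLinearMap k p r).mk').isLinear)
    (fun p q r => (lAct (nearU k p) ∘ₗ (rAct : Unitization k A →ₗ[k] _).flip z ∘ₗ
      (searU_isLinearMap k q r).mk').isLinear) l m

variable (A)

/-- A dendriform algebra as an algebra over the signature of dendriform algebras. -/
def dendAlg : Alg k dendSig A where
  op e v := match e with
    | .prec => dprec (k := k) (v (0 : Fin 2)) (v (1 : Fin 2))
    | .succ => dsucc (k := k) (v (0 : Fin 2)) (v (1 : Fin 2))
  linear e v a := by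
    change Fin 2 → A at v
    change Fin 2 at a
    cases e <;> fin_cases a
    · exact ((dprec (k := k)).flip (v 1)).isLinear
    · exact (dprec (k := k) (v 0)).isLinear
    · exact ((dsucc (k := k)).flip (v 1)).isLinear
    · exact (dsucc (k := k) (v 0)).isLinear

theorem br_update_isLinearMap {n : ℕ} (v : Fin (n + 1) → A) (a : Fin (n + 1)) :
    IsLinearMap k fun x : A =>
      br k (Function.update v a x 0) (List.ofFn fun i => Function.update v a x (Fin.succ i)) := by
  induction a using Fin.cases with
  | zero =>
    have h : ∀ x : A, (fun i => Function.update v 0 x (Fin.succ i)) = fun i => v i.succ :=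
      fun x => funext fun i => Function.update_of_ne (Fin.succ_ne_zero i) _ _
    simp only [Function.update_self, h]
    exact br_isLinearMap k _
  | succ a =>
    have h1 : ∀ x : A, Function.update v a.succ x 0 = v 0 := fun x =>
      Function.update_of_ne (Fin.succ_ne_zero a).symm _ _
    have h2 : ∀ x : A, (fun i => Function.update v a.succ x (Fin.succ i)) =
        Function.update (fun i => v i.succ) a x := fun x => by
      funext i
      simp [Function.update_apply]
    simp only [h1, h2, ofFn_update]
    exact br_slot_isLinearMap k (v 0) _ _

/-- A dendriform algebra as an algebra over the signature of brace algebras. -/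
def braceAlg : Alg k braceSig A where
  op _ v := br k (v 0) (List.ofFn fun i => v i.succ)
  linear _ v a := br_update_isLinearMap k A v a

variable {A} {B : Type w} [NonUnitalRing B] [Module k B] [Dendriform k B]

/-- Morphisms of dendriform algebras. -/
structure IsDendHom (f : A →ₗ[k] B) : Prop where
  map_prec : ∀ x y, f (dprec (k := k) x y) = dprec (k := k) (f x) (f y)
  map_succ : ∀ x y, f (dsucc (k := k) x y) = dsucc (k := k) (f x) (f y)

variable {k}

/-- The hypotheses say, component by component, that `u'` is the image of `u` under the map of
unitizations induced by `f`. -/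
theorem IsDendHom.map_lAct {f : A →ₗ[k] B} (hf : IsDendHom k f) {u : Unitization k A}
    {u' : Unitization k B} (h : u'.fst = u.fst) (h' : u'.snd = f u.snd) (z : A) :
    f (lAct u z) = lAct u' (f z) := by
  rw [lAct_apply, lAct_apply, map_add, map_smul, hf.map_succ, h, h']

theorem IsDendHom.map_rAct {f : A →ₗ[k] B} (hf : IsDendHom k f) {u : Unitization k A}
    {u' : Unitization k B} (h : u'.fst = u.fst) (h' : u'.snd = f u.snd) (z : A) :
    f (rAct u z) = rAct u' (f z) := by
  rw [rAct_apply, rAct_apply, map_add, map_smul, hf.map_prec, h, h']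

theorem IsDendHom.map_nearU {f : A →ₗ[k] B} (hf : IsDendHom k f) (l : List A) :
    (nearU k (l.map f)).fst = (nearU k l).fst ∧ (nearU k (l.map f)).snd = f (nearU k l).snd := by
  induction l with
  | nil => simp
  | cons x l ih => simp [nearU_cons, hf.map_rAct ih.1 ih.2]

theorem IsDendHom.map_searU {f : A →ₗ[k] B} (hf : IsDendHom k f) (l : List A) :
    (searU k (l.map f)).fst = (searU k l).fst ∧ (searU k (l.map f)).snd = f (searU k l).snd := by
  induction l using List.reverseRecOn with
  | nil => simp
  | append_singleton l x ih => simp [searU_append_singleton, hf.map_lAct ih.1 ih.2]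

theorem IsDendHom.map_br {f : A →ₗ[k] B} (hf : IsDendHom k f) (z : A) (l : List A) :
    f (br k z l) = br k (f z) (l.map f) := by
  rw [br, br, map_cutSum, cutSum_map]
  refine cutSum_congr fun p q _ => ?_
  rw [hf.map_lAct (hf.map_nearU p).1 (hf.map_nearU p).2,
    hf.map_rAct (hf.map_searU q).1 (hf.map_searU q).2]

theorem IsDendHom.map_brace_eval {f : A →ₗ[k] B} (hf : IsDendHom k f) {X : Type} (g : X → A)
    (t : Tm braceSig X) :
    f ((braceAlg k A).eval g t) = (braceAlg k B).eval (fun x => f (g x)) t := by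
  induction t with
  | var x => rfl
  | node _ c ih =>
    refine (hf.map_br _ _).trans ?_
    rw [List.map_ofFn]
    simp only [Alg.eval, ← ih]
    rfl

end DendAlg

/-! ### The free dendriform algebra and its universal property. -/

section FreeDend

variable (k : Type u) [CommRing k] (X : Type)

/-- The ideal of relations of `Dend`. -/
noncomputable def dendIdeal : (freeOperad k dendSig).SubSModule :=
  (freeOperad k dendSig).idealSpan fun I _ _ => {r | DendRel k I r}

/-- The free dendriform algebra on `X`. -/
def FreeDend : Type u := (Tm dendSig X →₀ k) ⧸ renames (dendIdeal k) X

noncomputable instance : AddCommGroup (FreeDend k X) :=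
  inferInstanceAs (AddCommGroup ((Tm dendSig X →₀ k) ⧸ renames (dendIdeal k) X))

noncomputable instance : Module k (FreeDend k X) :=
  inferInstanceAs (Module k ((Tm dendSig X →₀ k) ⧸ renames (dendIdeal k) X))

variable {k X}

theorem dendIdeal_isIdeal : (dendIdeal k).IsIdeal := Operad.idealSpan_isIdeal _

theorem dendIdeal_isLeftIdeal : (dendIdeal k).IsLeftIdeal := fun _ _ _ _ _ _ i e f hf =>
  dendIdeal_isIdeal i e f (Or.inr hf)

namespace FreeDend

/-- The quotient map. -/
noncomputable def mk : (Tm dendSig X →₀ k) →ₗ[k] FreeDend k X :=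
  Submodule.mkQ (renames (dendIdeal k) X)

theorem mk_surjective : Function.Surjective (mk : (Tm dendSig X →₀ k) →ₗ[k] FreeDend k X) :=
  Submodule.mkQ_surjective _

theorem mk_eq_zero {f : Tm dendSig X →₀ k} : mk f = 0 ↔ f ∈ renames (dendIdeal k) X :=
  Submodule.Quotient.mk_eq_zero _

variable (k) in
/-- The class of a monomial. -/
noncomputable def mono (t : Tm dendSig X) : FreeDend k X := mk (Finsupp.single t 1)

theorem mk_single (t : Tm dendSig X) (c : k) : mk (Finsupp.single t c) = c • mono k t := by
  rw [mono, ← map_smul, Finsupp.smul_single, smul_eq_mul, mul_one]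

theorem induction_mono {P : FreeDend k X → Prop} (h0 : P 0) (hadd : ∀ x y, P x → P y → P (x + y))
    (hsmul : ∀ (c : k) x, P x → P (c • x)) (hmono : ∀ t, P (mono k t)) (x : FreeDend k X) : P x := by
  obtain ⟨f, rfl⟩ := mk_surjective x
  induction f using Finsupp.induction_linear with
  | zero => rwa [map_zero]
  | add f g hf hg => rw [map_add]; exact hadd _ _ hf hg
  | single t c => rw [mk_single]; exact hsmul c _ (hmono t)

/-- The two products of the free dendriform algebra. -/
noncomputable def prod (e : DendGen) : FreeDend k X →ₗ[k] FreeDend k X →ₗ[k] FreeDend k X :=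
  Submodule.liftQ (renames (dendIdeal k) X)
    (LinearMap.flip (Submodule.liftQ (renames (dendIdeal k) X)
      (LinearMap.flip ((binL e).compr₂ mk))
      (fun f hf => by
        refine LinearMap.mem_ker.2 (LinearMap.ext fun q => ?_)
        exact mk_eq_zero.2 (binL_mem_of_right dendIdeal_isLeftIdeal e q hf))))
    (fun f hf => by
      refine LinearMap.mem_ker.2 (LinearMap.ext fun q => ?_)
      obtain ⟨q, rfl⟩ := mk_surjective q
      exact mk_eq_zero.2 (binL_mem_of_left dendIdeal_isLeftIdeal e hf q))

theorem prod_mk (e : DendGen) (f g : Tm dendSig X →₀ k) :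
    prod e (mk f) (mk g) = mk (binL e f g) := rfl

theorem prod_mono (e : DendGen) (s t : Tm dendSig X) :
    prod e (mono k s) (mono k t) = mono k (bin e s t) := by
  rw [mono, mono, prod_mk, binL_single, mul_one, mono]

/-- The relations are imposed on variables only; they hold for arbitrary expressions because the
ideal of relations is stable under substitution. -/
theorem mk_bindL_of_dendRel {r : (freeOperad k dendSig).obj (Fin 3)} (h : DendRel k (Fin 3) r)
    (g : Fin 3 → Tm dendSig X) : mk (bindL g r) = 0 :=
  mk_eq_zero.2 (bindL_mem_renames dendIdeal_isIdeal (Operad.mem_spanOf.2 fun _ _ hS => hS _ h) g)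

theorem mk_bindL_of (t : Tree dendSig (Fin 3)) (g : Fin 3 → Tm dendSig X) :
    mk (bindL g (freeOperad.of k dendSig t)) = mono k (t.1.bind g) :=
  congrArg mk (bindL_single g t 1)

theorem mk_bindL_sub {I : Type} [Finite I] [Nonempty I] (a b : (freeOperad k dendSig).obj I)
    (g : I → Tm dendSig X) : mk (bindL g (a - b)) = mk (bindL g a) - mk (bindL g b) :=
  let φ : (freeOperad k dendSig).obj I →ₗ[k] FreeDend k X := mk ∘ₗ bindL g
  φ.map_sub a b

theorem mono_prec_prec (p q r : Tm dendSig X) : mono k (bin .prec (bin .prec p q) r) =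
    mono k (bin .prec p (bin .prec q r)) + mono k (bin .prec p (bin .succ q r)) := by
  have h := mk_bindL_of_dendRel (k := k) DendRel.prec_prec ![p, q, r]
  rw [← sub_eq_zero, ← h]
  rw [mk_bindL_sub, mk_bindL_sub, mk_bindL_of, mk_bindL_of, mk_bindL_of, sub_sub]
  change _ = mono k ((bin .prec (bin .prec (.var 0) (.var 1)) (.var 2)).bind _) -
    (mono k ((bin .prec (.var 0) (bin .prec (.var 1) (.var 2))).bind _) +
      mono k ((bin .prec (.var 0) (bin .succ (.var 1) (.var 2))).bind _))
  simp only [bin_bind]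
  rfl

theorem mono_succ_prec (p q r : Tm dendSig X) : mono k (bin .prec (bin .succ p q) r) =
    mono k (bin .succ p (bin .prec q r)) := by
  have h := mk_bindL_of_dendRel (k := k) DendRel.succ_prec ![p, q, r]
  rw [← sub_eq_zero, ← h]
  rw [mk_bindL_sub, mk_bindL_of, mk_bindL_of]
  change _ = mono k ((bin .prec (bin .succ (.var 0) (.var 1)) (.var 2)).bind _) -
    mono k ((bin .succ (.var 0) (bin .prec (.var 1) (.var 2))).bind _)
  simp only [bin_bind]
  rfl

theorem mono_succ_succ (p q r : Tm dendSig X) : mono k (bin .succ p (bin .succ q r)) =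
    mono k (bin .succ (bin .succ p q) r) + mono k (bin .succ (bin .prec p q) r) := by
  have h := mk_bindL_of_dendRel (k := k) DendRel.succ_succ ![p, q, r]
  rw [← sub_eq_zero, ← h]
  rw [mk_bindL_sub, mk_bindL_sub, mk_bindL_of, mk_bindL_of, mk_bindL_of, sub_sub]
  change _ = mono k ((bin .succ (.var 0) (bin .succ (.var 1) (.var 2))).bind _) -
    (mono k ((bin .succ (bin .succ (.var 0) (.var 1)) (.var 2)).bind _) +
      mono k ((bin .succ (bin .prec (.var 0) (.var 1)) (.var 2)).bind _))
  simp only [bin_bind]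
  rfl

theorem prec_prec' (x y z : FreeDend k X) : prod .prec (prod .prec x y) z =
    prod .prec x (prod .prec y z + prod .succ y z) := by
  induction x using induction_mono with
  | h0 => simp only [map_zero, LinearMap.zero_apply]
  | hadd x x' hx hy => simp only [map_add, LinearMap.add_apply, hx, hy] at *; abel
  | hsmul c x hx => simp only [map_smul, LinearMap.smul_apply, hx]
  | hmono p =>
  induction y using induction_mono with
  | h0 => simp only [map_zero, LinearMap.zero_apply, add_zero]
  | hadd x x' hx hy => simp only [map_add, LinearMap.add_apply, hx, hy] at *; abel
  | hsmul c x hx => simp only [map_smul, LinearMap.smul_apply, hx, ← smul_add]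
  | hmono q =>
  induction z using induction_mono with
  | h0 => simp only [map_zero, add_zero]
  | hadd x x' hx hy => simp only [map_add, hx, hy] at *; abel
  | hsmul c x hx => simp only [map_smul, hx, ← smul_add]
  | hmono r => simp only [map_add, prod_mono, mono_prec_prec]

theorem succ_prec' (x y z : FreeDend k X) : prod .prec (prod .succ x y) z =
    prod .succ x (prod .prec y z) := by
  induction x using induction_mono with
  | h0 => simp only [map_zero, LinearMap.zero_apply]
  | hadd x x' hx hy => simp only [map_add, LinearMap.add_apply, hx, hy]
  | hsmul c x hx => simp only [map_smul, LinearMap.smul_apply, hx]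
  | hmono p =>
  induction y using induction_mono with
  | h0 => simp only [map_zero, LinearMap.zero_apply]
  | hadd x x' hx hy => simp only [map_add, LinearMap.add_apply, hx, hy]
  | hsmul c x hx => simp only [map_smul, LinearMap.smul_apply, hx]
  | hmono q =>
  induction z using induction_mono with
  | h0 => simp only [map_zero]
  | hadd x x' hx hy => simp only [map_add, hx, hy]
  | hsmul c x hx => simp only [map_smul, hx]
  | hmono r => simp only [prod_mono, mono_succ_prec]

theorem succ_succ' (x y z : FreeDend k X) : prod .succ x (prod .succ y z) =
    prod .succ (prod .prec x y + prod .succ x y) z := by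
  induction x using induction_mono with
  | h0 => simp only [map_zero, LinearMap.zero_apply, add_zero]
  | hadd x x' hx hy => simp only [map_add, LinearMap.add_apply, hx, hy] at *; abel
  | hsmul c x hx => simp only [map_smul, LinearMap.smul_apply, hx, ← smul_add]
  | hmono p =>
  induction y using induction_mono with
  | h0 => simp only [map_zero, LinearMap.zero_apply, add_zero]
  | hadd x x' hx hy => simp only [map_add, LinearMap.add_apply, hx, hy] at *; abel
  | hsmul c x hx => simp only [map_smul, LinearMap.smul_apply, hx, ← smul_add]
  | hmono q =>
  induction z using induction_mono with
  | h0 => simp only [map_zero]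
  | hadd x x' hx hy => simp only [map_add, hx, hy]
  | hsmul c x hx => simp only [map_smul, hx]
  | hmono r => simp only [map_add, LinearMap.add_apply, prod_mono, mono_succ_succ, add_comm]

noncomputable instance : NonUnitalRing (FreeDend k X) where
  __ := (inferInstance : AddCommGroup (FreeDend k X))
  mul x y := prod .prec x y + prod .succ x y
  left_distrib x y z := by
    change prod _ _ _ + prod _ _ _ = (prod _ _ _ + prod _ _ _) + (prod _ _ _ + prod _ _ _)
    simp only [map_add]
    abel
  right_distrib x y z := by
    change prod _ _ _ + prod _ _ _ = (prod _ _ _ + prod _ _ _) + (prod _ _ _ + prod _ _ _)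
    simp only [map_add, LinearMap.add_apply]
    abel
  zero_mul x := by
    change prod _ _ _ + prod _ _ _ = _
    simp only [map_zero, LinearMap.zero_apply, add_zero]
  mul_zero x := by
    change prod _ _ _ + prod _ _ _ = _
    simp only [map_zero, add_zero]
  mul_assoc x y z := by
    change prod .prec (prod .prec x y + prod .succ x y) z +
      prod .succ (prod .prec x y + prod .succ x y) z =
      prod .prec x (prod .prec y z + prod .succ y z) +
      prod .succ x (prod .prec y z + prod .succ y z)
    rw [← succ_succ', map_add (prod .prec), LinearMap.add_apply, prec_prec', succ_prec',
      map_add (prod .succ x)]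
    abel

noncomputable instance : Dendriform k (FreeDend k X) where
  dprec := prod .prec
  dsucc := prod .succ
  mul_eq _ _ := rfl
  prec_prec := prec_prec'
  succ_prec := succ_prec'
  succ_succ := succ_succ'

theorem dprec_mono (s t : Tm dendSig X) :
    dprec (k := k) (mono k s) (mono k t) = mono k (bin .prec s t) := prod_mono _ s t

theorem dsucc_mono (s t : Tm dendSig X) :
    dsucc (k := k) (mono k s) (mono k t) = mono k (bin .succ s t) := prod_mono _ s t

variable (k) in
/-- The generators of the free dendriform algebra. -/
noncomputable def gen (x : X) : FreeDend k X := mono k (.var x)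

end FreeDend

theorem bin_eta {e : DendGen} (c : Fin 2 → Tm dendSig X) :
    Tm.node (S := dendSig) e c = bin e (c 0) (c 1) := by
  rw [bin]
  congr 1
  exact (List.ofFn_injective rfl : c = ![c 0, c 1])

theorem dend_induction {P : Tm dendSig X → Prop} (hvar : ∀ x, P (.var x))
    (hbin : ∀ e s t, P s → P t → P (bin e s t)) (t : Tm dendSig X) : P t := by
  induction t with
  | var x => exact hvar x
  | node e c ih => exact (bin_eta (e := e) c) ▸ hbin e _ _ (ih (0 : Fin 2)) (ih (1 : Fin 2))

section Lift

variable {B : Type v} [NonUnitalRing B] [Module k B] [Dendriform k B]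

theorem dendAlg_eval_prec (g : X → B) (s t : Tm dendSig X) :
    (dendAlg k B).eval g (bin .prec s t) =
      dprec (k := k) ((dendAlg k B).eval g s) ((dendAlg k B).eval g t) := rfl

theorem dendAlg_eval_succ (g : X → B) (s t : Tm dendSig X) :
    (dendAlg k B).eval g (bin .succ s t) =
      dsucc (k := k) ((dendAlg k B).eval g s) ((dendAlg k B).eval g t) := rfl

theorem FreeDend.eval_gen (t : Tm dendSig X) :
    (dendAlg k (FreeDend k X)).eval (gen k) t = mono k t := by
  induction t using dend_induction with
  | hvar x => rfl
  | hbin e s t hs ht =>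
    cases e
    · rw [dendAlg_eval_prec, ← dprec_mono, hs, ht]
    · rw [dendAlg_eval_succ, ← dsucc_mono, hs, ht]

theorem dendRel_subset_kernel (I : Type) [Finite I] [Nonempty I] :
    {r | DendRel k I r} ⊆ ((dendAlg k B).kernel.carrier I : Set ((freeOperad k dendSig).obj I)) := by
  intro r hr
  refine (dendAlg k B).mem_kernel.2 fun g => ?_
  have hsub : ∀ a b : (freeOperad k dendSig).obj I, (dendAlg k B).evalL g (a - b) =
      (dendAlg k B).evalL g a - (dendAlg k B).evalL g b :=
    let φ : (freeOperad k dendSig).obj I →ₗ[k] B := (dendAlg k B).evalL g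
    φ.map_sub
  have hof : ∀ t : Tree dendSig I, (dendAlg k B).evalL g (freeOperad.of k dendSig t) =
      (dendAlg k B).eval g t.1 := fun t => ((dendAlg k B).evalL_single g t 1).trans (one_smul _ _)
  cases hr with
  | prec_prec =>
    rw [hsub, hsub, hof, hof, hof, sub_sub, sub_eq_zero]
    exact (prec_prec _ _ _).trans (by rw [mul_eq (k := k), map_add]; rfl)
  | succ_prec =>
    rw [hsub, hof, hof, sub_eq_zero]
    exact succ_prec _ _ _
  | succ_succ =>
    rw [hsub, hsub, hof, hof, hof, sub_sub, sub_eq_zero]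
    exact (succ_succ _ _ _).trans (by
      rw [mul_eq (k := k), map_add, LinearMap.add_apply, add_comm]; rfl)

theorem dendAlg_evalL_eq_zero {I : Type} [Finite I] [Nonempty I]
    {p : (freeOperad k dendSig).obj I} (hp : p ∈ (dendIdeal k).carrier I) (g : I → B) :
    (dendAlg k B).evalL g p = 0 :=
  Alg.evalL_eq_zero _ (fun I _ _ => dendRel_subset_kernel I) hp g

theorem Alg.linearCombination_bindL {S : Sig} {B : Type v} [AddCommGroup B] [Module k B] {Y : Type}
    (𝔸 : Alg k S B) (h : Y → Tm S X) (g : X → B) (p : Tree S Y →₀ k) :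
    Finsupp.linearCombination k (𝔸.eval g) (bindL h p) = 𝔸.evalL (fun y => 𝔸.eval g (h y)) p := by
  induction p using Finsupp.induction_linear with
  | zero => simp only [map_zero]
  | add f g hf hg => simp only [map_add, hf, hg]
  | single t c =>
    rw [bindL_single, Finsupp.linearCombination_single, Alg.evalL_single, Alg.eval_bind]

/-- The morphism of dendriform algebras that extends a map on the generators. -/
noncomputable def FreeDend.lift (g : X → B) : FreeDend k X →ₗ[k] B :=
  Submodule.liftQ (renames (dendIdeal k) X)
    (Finsupp.linearCombination k ((dendAlg k B).eval g)) (by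
      refine Submodule.span_le.2 ?_
      rintro _ ⟨Y, _, _, j, p, hp, rfl⟩
      exact ((dendAlg k B).linearCombination_bindL _ g p).trans (dendAlg_evalL_eq_zero hp _))

theorem FreeDend.lift_mk (g : X → B) (f : Tm dendSig X →₀ k) :
    lift g (mk f) = Finsupp.linearCombination k ((dendAlg k B).eval g) f := rfl

theorem FreeDend.lift_mono (g : X → B) (t : Tm dendSig X) :
    lift g (mono k t) = (dendAlg k B).eval g t := by
  rw [mono, lift_mk, Finsupp.linearCombination_single, one_smul]

theorem FreeDend.lift_gen (g : X → B) (x : X) : lift g (gen k x) = g x := lift_mono g _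

theorem FreeDend.lift_isDendHom (g : X → B) : IsDendHom k (lift (k := k) g) where
  map_prec x y := by
    induction x using induction_mono with
    | h0 => simp only [map_zero, LinearMap.zero_apply]
    | hadd x x' hx hy => simp only [map_add, LinearMap.add_apply, hx, hy]
    | hsmul c x hx => simp only [map_smul, LinearMap.smul_apply, hx]
    | hmono p =>
    induction y using induction_mono with
    | h0 => simp only [map_zero]
    | hadd x x' hx hy => simp only [map_add, hx, hy]
    | hsmul c x hx => simp only [map_smul, hx]
    | hmono q => rw [dprec_mono, lift_mono, lift_mono, lift_mono, dendAlg_eval_prec]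
  map_succ x y := by
    induction x using induction_mono with
    | h0 => simp only [map_zero, LinearMap.zero_apply]
    | hadd x x' hx hy => simp only [map_add, LinearMap.add_apply, hx, hy]
    | hsmul c x hx => simp only [map_smul, LinearMap.smul_apply, hx]
    | hmono p =>
    induction y using induction_mono with
    | h0 => simp only [map_zero]
    | hadd x x' hx hy => simp only [map_add, hx, hy]
    | hsmul c x hx => simp only [map_smul, hx]
    | hmono q => rw [dsucc_mono, lift_mono, lift_mono, lift_mono, dendAlg_eval_succ]

end Lift

/-- The projection of the free dendriform algebra onto its multilinear part. -/
noncomputable def FreeDend.toDend [Finite X] [Nonempty X] :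
    FreeDend k X →ₗ[k] (Dend k).obj X :=
  Submodule.mapQ (renames (dendIdeal k) X) ((dendIdeal k).carrier X)
    (linearPart : _ →ₗ[k] (freeOperad k dendSig).obj X) fun _ hf => linearPart_mem hf

theorem FreeDend.toDend_mk [Finite X] [Nonempty X] (f : Tm dendSig X →₀ k) :
    toDend (mk f) = (Submodule.Quotient.mk (p := (dendIdeal k).carrier X) (linearPart f)) := rfl

theorem FreeDend.toDend_mono [Finite X] [Nonempty X] (t : Tree dendSig X) :
    toDend (mono k t.1) = presentedOperad.of k dendSig _ t := by
  rw [mono, toDend_mk, linearPart_single]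
  rfl

end FreeDend

/-! ## The grading of the free dendriform algebra -/

section Degree

variable (k : Type u) [CommRing k] {X : Type}

/-- The span of the monomials with a given multiset of variables. -/
noncomputable def deg (m : Multiset X) : Submodule k (FreeDend k X) :=
  Submodule.span k {x | ∃ t : Tm dendSig X, (t.leaves : Multiset X) = m ∧ FreeDend.mono k t = x}

theorem mono_mem_deg (t : Tm dendSig X) : FreeDend.mono k t ∈ deg k (t.leaves : Multiset X) :=
  Submodule.subset_span ⟨t, rfl, rfl⟩

theorem prod_mem_deg (e : DendGen) {m n : Multiset X} {x y : FreeDend k X} (hx : x ∈ deg k m)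
    (hy : y ∈ deg k n) : FreeDend.prod e x y ∈ deg k (m + n) := by
  induction hx using Submodule.span_induction with
  | zero => simp
  | add x x' _ _ hx hx' =>
    rw [map_add, LinearMap.add_apply]
    exact add_mem hx hx'
  | smul c x _ hx =>
    rw [map_smul, LinearMap.smul_apply]
    exact Submodule.smul_mem _ c hx
  | mem x hx =>
    obtain ⟨s, rfl, rfl⟩ := hx
    induction hy using Submodule.span_induction with
    | zero => simp
    | add x x' _ _ hx hx' =>
      rw [map_add]
      exact add_mem hx hx'
    | smul c x _ hx =>
      rw [map_smul]
      exact Submodule.smul_mem _ c hx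
    | mem y hy =>
      obtain ⟨t, rfl, rfl⟩ := hy
      rw [FreeDend.prod_mono, Multiset.coe_add, ← leaves_bin e s t]
      exact mono_mem_deg k _

/-- Homogeneous elements of the unitization. -/
def HomogU (u : Unitization k (FreeDend k X)) (m : Multiset X) : Prop :=
  -- The first alternative is the value of `nearU` and `searU` at the empty list, which does not lie
  -- in the algebra itself.
  (u = 1 ∧ m = 0) ∨ (u.fst = 0 ∧ u.snd ∈ deg k m)

variable {k}

theorem HomogU.lAct_mem {u : Unitization k (FreeDend k X)} {m n : Multiset X} (hu : HomogU k u m)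
    {z : FreeDend k X} (hz : z ∈ deg k n) : lAct u z ∈ deg k (m + n) := by
  rcases hu with ⟨rfl, rfl⟩ | ⟨h, h'⟩
  · rwa [lAct_one, zero_add]
  · rw [lAct_apply, h, zero_smul, zero_add]
    exact prod_mem_deg k .succ h' hz

theorem HomogU.rAct_mem {u : Unitization k (FreeDend k X)} {m n : Multiset X} (hu : HomogU k u m)
    {z : FreeDend k X} (hz : z ∈ deg k n) : rAct u z ∈ deg k (n + m) := by
  rcases hu with ⟨rfl, rfl⟩ | ⟨h, h'⟩
  · rwa [rAct_one, add_zero]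
  · rw [rAct_apply, h, zero_smul, zero_add]
    exact prod_mem_deg k .prec hz h'

variable {α : Type*} {f : α → FreeDend k X} {d : α → Multiset X} (hf : ∀ a, f a ∈ deg k (d a))

include hf

theorem homogU_nearU (l : List α) : HomogU k (nearU k (l.map f)) (l.map d).sum := by
  induction l with
  | nil => exact Or.inl ⟨rfl, rfl⟩
  | cons a l ih =>
    refine Or.inr ⟨rfl, ?_⟩
    rw [List.map_cons, List.map_cons, List.sum_cons, nearU_cons, Unitization.snd_inr]
    exact neg_mem (ih.rAct_mem (hf a))

theorem homogU_searU (l : List α) : HomogU k (searU k (l.map f)) (l.map d).sum := by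
  induction l using List.reverseRecOn with
  | nil => exact Or.inl ⟨rfl, rfl⟩
  | append_singleton l a ih =>
    rw [List.map_append, List.map_append, List.sum_append, List.map_singleton, List.map_singleton,
      List.sum_singleton, searU_append_singleton]
    exact Or.inr ⟨rfl, ih.lAct_mem (hf a)⟩

theorem br_mem_deg {z : FreeDend k X} {m : Multiset X} (hz : z ∈ deg k m) (l : List α) :
    br k z (l.map f) ∈ deg k (m + (l.map d).sum) := by
  rw [br, cutSum_map]
  refine cutSum_mem _ fun p q hpq => ?_
  have h := (homogU_nearU hf p).lAct_mem ((homogU_searU hf q).rAct_mem hz)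
  rwa [add_left_comm, ← List.sum_append, ← List.map_append, hpq] at h

end Degree

/-! ### The multilinear part of the free dendriform algebra, and composition as substitution. -/

section Multilinear

variable {k : Type u} [CommRing k] {X : Type}

theorem coe_flatten (L : List (List X)) :
    (L.flatten : Multiset X) = (L.map Multiset.ofList).sum := by
  induction L with
  | nil => rfl
  | cons l L ih => rw [List.flatten_cons, ← Multiset.coe_add, ih]; rfl

theorem brace_induction {P : Tm braceSig X → Prop} (hvar : ∀ x, P (.var x))
    (hnode : ∀ (n : ℕ) (c : Fin (n + 2) → Tm braceSig X), (∀ a, P (c a)) →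
      P (Tm.node (S := braceSig) n c)) (t : Tm braceSig X) : P t := by
  induction t with
  | var x => exact hvar x
  | node n c ih => exact hnode n c ih

theorem braceAlg_eval_node {A : Type v} [NonUnitalRing A] [Module k A] [Dendriform k A] (g : X → A)
    (n : ℕ) (c : Fin (n + 2) → Tm braceSig X) :
    (braceAlg k A).eval g (Tm.node (S := braceSig) n c) = br k ((braceAlg k A).eval g (c 0))
      (List.ofFn fun i : Fin (n + 1) => (braceAlg k A).eval g (c i.succ)) := rfl

theorem leaves_braceNode (n : ℕ) (c : Fin (n + 2) → Tm braceSig X) :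
    ((Tm.node (S := braceSig) n c).leaves : Multiset X) = ((c 0).leaves : Multiset X) +
      (List.ofFn fun i : Fin (n + 1) => ((c i.succ).leaves : Multiset X)).sum := by
  change (((List.ofFn fun a : Fin (n + 2) => (c a).leaves).flatten : List X) : Multiset X) = _
  rw [List.ofFn_succ, List.flatten_cons, ← Multiset.coe_add, coe_flatten, List.map_ofFn]
  rfl

theorem brace_eval_mem_deg (t : Tm braceSig X) :
    (braceAlg k (FreeDend k X)).eval (FreeDend.gen k) t ∈ deg k (t.leaves : Multiset X) := by
  induction t using brace_induction with
  | hvar x =>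
    have h := mono_mem_deg k (.var x : Tm dendSig X)
    rw [Tm.leaves] at h ⊢
    exact h
  | hnode n c ih =>
    have h := br_mem_deg (fun i : Fin (n + 1) => ih i.succ) (ih 0) (List.finRange (n + 1))
    rw [← List.ofFn_eq_map, ← List.ofFn_eq_map] at h
    rw [braceAlg_eval_node, leaves_braceNode]
    exact h

/-- The multilinear part of the free dendriform algebra. -/
noncomputable def multilinear (k : Type u) [CommRing k] (X : Type) : Submodule k (FreeDend k X) :=
  Submodule.span k (Set.range fun t : Tree dendSig X => FreeDend.mono k t.1)

theorem deg_le_multilinear {S : Sig} (s : Tree S X) :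
    deg k (s.1.leaves : Multiset X) ≤ multilinear k X := by
  refine Submodule.span_le.2 ?_
  rintro _ ⟨t, ht, rfl⟩
  have hp := Multiset.coe_eq_coe.1 ht
  exact Submodule.subset_span
    ⟨⟨t, hp.nodup_iff.2 s.2.1, fun x => hp.mem_iff.2 (s.2.2 x)⟩, rfl⟩

/-- Braces preserve the multiset of variables. This places the values of brace trees where the
projection to `Dend` is compatible with relabelling and composition. -/
theorem brace_eval_mem_multilinear (t : Tree braceSig X) :
    (braceAlg k (FreeDend k X)).eval (FreeDend.gen k) t.1 ∈ multilinear k X :=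
  deg_le_multilinear t (brace_eval_mem_deg t.1)

variable {I J : Type} [Finite I] [Nonempty I] [Finite J] [Nonempty J]

theorem toDend_lift_equiv (σ : I ≃ J) {x : FreeDend k I} (hx : x ∈ multilinear k I) :
    FreeDend.toDend (FreeDend.lift (fun i => FreeDend.gen k (σ i)) x) =
      (Dend k).map σ (FreeDend.toDend x) := by
  induction hx using Submodule.span_induction with
  | zero => simp only [map_zero]
  | add x y _ _ hx hy => simp only [map_add, hx, hy]
  | smul c x _ hx => simp only [map_smul, hx]
  | mem x hx =>
    obtain ⟨t, rfl⟩ := hx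
    rw [FreeDend.lift_mono, ← Alg.eval_rename, FreeDend.eval_gen, FreeDend.toDend_mono]
    refine (FreeDend.toDend_mono (t.map σ)).trans ?_
    exact congrArg (Submodule.Quotient.mk (p := (dendIdeal k).carrier J)) (freeMap_single σ t 1).symm

open Classical in
/-- The substitution of `y` for the variable `i`. -/
noncomputable def graftMap (i : I) (y : FreeDend k J) (x : I) :
    FreeDend k ({x : I // x ≠ i} ⊕ J) :=
  Function.update (fun x => if h : x = i then 0 else FreeDend.gen k (Sum.inl ⟨x, h⟩)) i
    (FreeDend.lift (fun j => FreeDend.gen k (Sum.inr j)) y) x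

/-- By linearity it is enough to treat two trees; the substituted monomial is then the monomial of
the grafted tree, which represents the composition in `Dend`. -/
theorem toDend_lift_graftMap (i : I) {x : FreeDend k I} (hx : x ∈ multilinear k I)
    {y : FreeDend k J} (hy : y ∈ multilinear k J) :
    FreeDend.toDend (FreeDend.lift (graftMap i y) x) =
      (Dend k).comp i (FreeDend.toDend x) (FreeDend.toDend y) := by
  classical
  induction hx using Submodule.span_induction with
  | zero => simp only [map_zero, LinearMap.zero_apply]
  | add x y _ _ hx hy => simp only [map_add, LinearMap.add_apply, hx, hy]
  | smul c x _ hx => simp only [map_smul, LinearMap.smul_apply, hx]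
  | mem x hx =>
    obtain ⟨t, rfl⟩ := hx
    have hlin := (dendAlg k (FreeDend k ({x : I // x ≠ i} ⊕ J))).eval_linear
      (fun x => if h : x = i then 0 else FreeDend.gen k (Sum.inl ⟨x, h⟩)) i t.1 t.2.1 (t.2.2 i)
    -- Linearity of `t` in the variable `i` makes the substituted value linear in `y`, which permits
    -- the span induction on `y`.
    let φ : FreeDend k ({x : I // x ≠ i} ⊕ J) →ₗ[k] FreeDend k ({x : I // x ≠ i} ⊕ J) :=
      IsLinearMap.mk' _ hlin
    have hdef : ∀ y : FreeDend k J, FreeDend.lift (graftMap i y) (FreeDend.mono k t.1) =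
        φ (FreeDend.lift (fun j => FreeDend.gen k (Sum.inr j)) y) := by
      intro y
      rw [FreeDend.lift_mono]
      congr!
    rw [hdef]
    induction hy using Submodule.span_induction with
    | zero => simp only [map_zero]
    | add x y _ _ hx hy => simp only [map_add, hx, hy]
    | smul c x _ hx => simp only [map_smul, hx]
    | mem y hy =>
      obtain ⟨s, rfl⟩ := hy
      rw [FreeDend.lift_mono]
      have h := (dendAlg k (FreeDend k ({x : I // x ≠ i} ⊕ J))).eval_graft i (FreeDend.gen k) t s
      rw [FreeDend.eval_gen] at h
      refine (congrArg FreeDend.toDend h.symm).trans ?_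
      rw [FreeDend.toDend_mono, FreeDend.toDend_mono, FreeDend.toDend_mono]
      refine congrArg (Submodule.Quotient.mk (p := (dendIdeal k).carrier _)) ?_
      exact ((freeComp_single i t s (1 : k) 1).trans (by rw [mul_one]; rfl)).symm

end Multilinear

/-! ## The brace relations in dendriform algebras -/

section BraceRelations

variable {k : Type u} [CommRing k] {A : Type v} [NonUnitalRing A] [Module k A] [Dendriform k A]
  {X : Type}

theorem braceAlg_eval_brace (g : X → A) (t : Tm braceSig X) (l : List (Tm braceSig X)) :
    (braceAlg k A).eval g (brace t l) =
      br k ((braceAlg k A).eval g t) (l.map ((braceAlg k A).eval g)) := by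
  cases l with
  | nil => simp [brace]
  | cons a l =>
    change br k _ _ = _
    exact congrArg (br k _) (List.ofFn_getElem_eq_map (a :: l) ((braceAlg k A).eval g))

theorem cuts_cons {α : Type} (x : α) (l : List α) :
    cuts (x :: l) = ([], x :: l) :: (cuts l).map fun p => (x :: p.1, p.2) := by
  simp only [cuts, List.length_cons, List.map_map]
  rw [List.range_succ_eq_map, List.map_cons, List.map_map]
  rfl

theorem sum_cuts {α : Type} {M : Type*} [AddCommGroup M] (F : List α → List α → M) (l : List α) :
    ((cuts l).map fun p => F p.1 p.2).sum = cutSum F l := by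
  induction l generalizing F with
  | nil => simp [cuts, cutSum]
  | cons x l ih =>
    rw [cuts_cons, List.map_cons, List.sum_cons, List.map_map, cutSum, ← ih]
    rfl

theorem sum_map_flatMap {α β M : Type*} [AddCommGroup M] (l : List α) (f : α → List β) (g : β → M) :
    ((l.flatMap f).map g).sum = (l.map fun a => ((f a).map g).sum).sum := by
  induction l with
  | nil => rfl
  | cons x l ih => simp [ih]

theorem sum_braceArgs {M : Type*} [AddCommGroup M] (g : X → A) (xs ys : List (Tm braceSig X))
    (G : List A → M) :
    ((braceArgs xs ys).map fun W => G (W.map ((braceAlg k A).eval g))).sum =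
      brSum k (xs.map ((braceAlg k A).eval g)) (ys.map ((braceAlg k A).eval g)) G := by
  induction xs generalizing ys G with
  | nil => simp [braceArgs, brSum]
  | cons x xs ih =>
    rw [braceArgs, List.map_cons, brSum, cutSum_map, sum_map_flatMap, ← sum_cuts]
    refine congrArg List.sum (List.map_congr_left fun p _ => ?_)
    rw [cutSum_map, sum_map_flatMap, ← sum_cuts]
    refine congrArg List.sum (List.map_congr_left fun q _ => ?_)
    rw [← ih, List.map_map]
    refine congrArg List.sum (List.map_congr_left fun W _ => ?_)
    simp [braceAlg_eval_brace]

theorem braceRel_subset_kernel (I : Type) [Finite I] [Nonempty I] :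
    {r | BraceRel k I r} ⊆
      ((braceAlg k A).kernel.carrier I : Set ((freeOperad k braceSig).obj I)) := by
  intro r hr
  refine (braceAlg k A).mem_kernel.2 fun g => ?_
  have hof : ∀ t : Tree braceSig I, (braceAlg k A).evalL g (freeOperad.of k braceSig t) =
      (braceAlg k A).eval g t.1 := fun t => ((braceAlg k A).evalL_single g t 1).trans (one_smul _ _)
  let φ : (freeOperad k braceSig).obj I →ₗ[k] A := (braceAlg k A).evalL g
  cases hr with
  | brace_brace n m hn hm =>
    change φ _ = 0
    rw [map_sub, map_list_sum, List.map_map, sub_eq_zero]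
    refine (hof _).trans ?_
    rw [braceLhs, braceAlg_eval_brace, braceAlg_eval_brace, br_br, ← sum_braceArgs, braceRhs]
    refine congrArg List.sum (Eq.trans ?_ (List.map_map ..).symm)
    refine List.attach_map_val.symm.trans (List.map_congr_left fun W _ => ?_)
    exact ((hof _).trans (braceAlg_eval_brace _ _ _)).symm

end BraceRelations

/-! ## The morphism from `Brace` to `Dend` -/

section Psi

variable {k : Type u} [CommRing k]

theorem brace_evalL_eq_zero {A : Type v} [NonUnitalRing A] [Module k A] [Dendriform k A] {I : Type}
    [Finite I] [Nonempty I] {p : (freeOperad k braceSig).obj I}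
    (hp : p ∈ ((freeOperad k braceSig).idealSpan fun I _ _ => {r | BraceRel k I r}).carrier I)
    (g : I → A) : (braceAlg k A).evalL g p = 0 :=
  Alg.evalL_eq_zero _ (fun I _ _ => braceRel_subset_kernel I) hp g

variable (k) in
/-- The value of an operation of `Brace` on the generators of a free dendriform algebra, seen as an
operation of `Dend`. -/
noncomputable def braceToDend (I : Type) [Finite I] [Nonempty I] :
    (Brace k).obj I →ₗ[k] (Dend k).obj I :=
  Submodule.liftQ (((freeOperad k braceSig).idealSpan fun I _ _ => {r | BraceRel k I r}).carrier I)
    (FreeDend.toDend ∘ₗ (braceAlg k (FreeDend k I)).evalL (FreeDend.gen k)) fun p hp => by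
      refine LinearMap.mem_ker.2 ?_
      exact (congrArg FreeDend.toDend (brace_evalL_eq_zero hp _)).trans (map_zero _)

theorem braceToDend_of {I : Type} [Finite I] [Nonempty I] (t : Tree braceSig I) :
    braceToDend k I (presentedOperad.of k braceSig _ t) =
      FreeDend.toDend ((braceAlg k (FreeDend k I)).eval (FreeDend.gen k) t.1) :=
  congrArg FreeDend.toDend (((braceAlg k (FreeDend k I)).evalL_single _ t 1).trans (one_smul _ _))

section Presented

variable {S : Sig} {R : ∀ (I : Type) [Finite I] [Nonempty I], Set ((freeOperad k S).obj I)}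
  {I J : Type} [Finite I] [Nonempty I] [Finite J] [Nonempty J]

theorem presentedOperad.induction {P : (presentedOperad k S R).obj I → Prop} (h0 : P 0)
    (hadd : ∀ p q, P p → P q → P (p + q)) (hsmul : ∀ (c : k) p, P p → P (c • p))
    (hof : ∀ t, P (presentedOperad.of k S R t)) (p : (presentedOperad k S R).obj I) : P p := by
  obtain ⟨p, rfl⟩ := Submodule.Quotient.mk_surjective _ p
  change Tree S I →₀ k at p
  induction p using Finsupp.induction_linear with
  | zero => exact h0
  | add f g hf hg => exact hadd _ _ hf hg
  | single t c =>
    have h := hsmul c _ (hof t)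
    have he : c • (Finsupp.single t 1 : Tree S I →₀ k) = Finsupp.single t c := by
      rw [Finsupp.smul_single, smul_eq_mul, mul_one]
    rw [← he]
    exact h

theorem presentedOperad.map_of (σ : I ≃ J) (t : Tree S I) :
    (presentedOperad k S R).map σ (presentedOperad.of k S R t) =
      presentedOperad.of k S R (t.map σ) :=
  congrArg Submodule.Quotient.mk (freeMap_single σ t 1)

theorem presentedOperad.comp_of (i : I) (t : Tree S I) (s : Tree S J) :
    (presentedOperad k S R).comp i (presentedOperad.of k S R t) (presentedOperad.of k S R s) =
      presentedOperad.of k S R (t.graft i s) :=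
  congrArg Submodule.Quotient.mk ((freeComp_single i t s 1 1).trans (by rw [mul_one]; rfl))

end Presented

theorem Brace.induction {I : Type} [Finite I] [Nonempty I] {P : (Brace k).obj I → Prop} (h0 : P 0)
    (hadd : ∀ p q, P p → P q → P (p + q)) (hsmul : ∀ (c : k) p, P p → P (c • p))
    (hof : ∀ t, P (presentedOperad.of k braceSig _ t)) (p : (Brace k).obj I) : P p :=
  presentedOperad.induction h0 hadd hsmul hof p

variable (k) in
/-- The morphism from `Brace` to `Dend`. -/
noncomputable def psi : Operad.Hom (Brace k) (Dend k) where
  app I := braceToDend k I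
  app_map σ p := by
    induction p using Brace.induction with
    | h0 => simp only [map_zero]
    | hadd p q hp hq => simp only [map_add, hp, hq]
    | hsmul c p hp => simp only [map_smul, hp]
    | hof t =>
      refine (congrArg (braceToDend k _) (presentedOperad.map_of σ t)).trans ?_
      rw [braceToDend_of, braceToDend_of, ← toDend_lift_equiv σ (brace_eval_mem_multilinear t),
        (FreeDend.lift_isDendHom _).map_brace_eval]
      simp only [FreeDend.lift_gen]
      exact congrArg _ (Alg.eval_rename _ _ _ _)
  app_one := (braceToDend_of Tree.one).trans (FreeDend.toDend_mono Tree.one)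
  app_comp {I J} _ _ _ _ i p q := by
    induction p using Brace.induction with
    | h0 => simp only [map_zero, LinearMap.zero_apply]
    | hadd p q hp hq => simp only [map_add, LinearMap.add_apply, hp, hq]
    | hsmul c p hp => simp only [map_smul, LinearMap.smul_apply, hp]
    | hof t =>
    induction q using Brace.induction with
    | h0 => simp only [map_zero]
    | hadd p q hp hq => simp only [map_add, hp, hq]
    | hsmul c p hp => simp only [map_smul, hp]
    | hof s =>
      refine (congrArg (braceToDend k _) (presentedOperad.comp_of i t s)).trans ?_
      -- Composition on the `Dend` side becomes substitution in a free algebra; dendriform morphisms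
      -- preserve braces, so both sides evaluate `t` with the value of `s` in the slot `i`.
      rw [braceToDend_of, braceToDend_of, braceToDend_of, ← toDend_lift_graftMap i
        (brace_eval_mem_multilinear t) (brace_eval_mem_multilinear s),
        (FreeDend.lift_isDendHom _).map_brace_eval, Alg.eval_graft]
      simp only [FreeDend.lift_gen]
      refine congrArg FreeDend.toDend (congrArg (fun g => Alg.eval _ g t.1) ?_)
      funext x
      rw [graftMap, (FreeDend.lift_isDendHom _).map_brace_eval]
      simp only [FreeDend.lift_gen]

end Psi

/-! ### Values of the constructed morphism on corollas. -/

section Corollas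

variable {k : Type u} [CommRing k] {X : Type}

theorem nearU_gen (x : X) (l : List X) :
    nearU k ((x :: l).map (FreeDend.gen k)) =
      Unitization.inr ((-1 : k) ^ (l.length + 1) • FreeDend.mono k (nearrow x l)) := by
  induction l generalizing x with
  | nil => simp [nearU_cons, nearrow, FreeDend.gen]
  | cons y l ih =>
    rw [List.map_cons, nearU_cons, ih, rAct_inr, map_smul, FreeDend.gen, FreeDend.dprec_mono,
      ← neg_smul, List.length_cons, pow_succ _ (l.length + 1), mul_neg_one]
    rfl

theorem searU_gen (x : X) (l : List X) :
    searU k ((x :: l).map (FreeDend.gen k)) = Unitization.inr (FreeDend.mono k (searrow x l)) := by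
  induction l using List.reverseRecOn with
  | nil => simp [searU, searrow, FreeDend.gen]
  | append_singleton l y ih =>
    rw [← List.cons_append, List.map_append, List.map_singleton, searU_append_singleton, ih,
      lAct_inr, FreeDend.gen, FreeDend.dsucc_mono, searrow, searrow, List.foldl_append]
    rfl

theorem lAct_rAct_gen (z : X) (p q : List X) :
    lAct (nearU k (p.map (FreeDend.gen k))) (rAct (searU k (q.map (FreeDend.gen k)))
      (FreeDend.gen k z)) = (-1 : k) ^ p.length • FreeDend.mono k (vTerm z p q) := by
  cases p with
  | nil =>
    cases q with
    | nil => simp [vTerm, FreeDend.gen]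
    | cons y q =>
      rw [searU_gen, rAct_inr, FreeDend.gen, FreeDend.dprec_mono]
      simp [vTerm]
      rfl
  | cons x p =>
    cases q with
    | nil =>
      rw [nearU_gen, lAct_inr, map_smul, LinearMap.smul_apply]
      simp only [List.map_nil, searU_nil, rAct_one, FreeDend.gen, FreeDend.dsucc_mono]
      rfl
    | cons y q =>
      rw [nearU_gen, searU_gen, lAct_inr, map_smul, LinearMap.smul_apply, rAct_inr, ← succ_prec,
        FreeDend.gen, FreeDend.dsucc_mono, FreeDend.dprec_mono]
      rfl

theorem cutSum_eq_sum_range {α M : Type*} [AddCommGroup M] (F : List α → List α → M) (l : List α) :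
    cutSum F l = ∑ i ∈ Finset.range (l.length + 1), F (l.take i) (l.drop i) := by
  induction l generalizing F with
  | nil => simp [cutSum]
  | cons x l ih =>
    rw [cutSum, ih, List.length_cons, Finset.sum_range_succ' _ (l.length + 1), add_comm]
    rfl

theorem br_gen (z : X) (l : List X) :
    br k (FreeDend.gen k z) (l.map (FreeDend.gen k)) = ∑ i ∈ Finset.range (l.length + 1),
      (-1 : k) ^ i • FreeDend.mono k (vTerm z (l.take i) (l.drop i)) := by
  rw [br, cutSum_map]
  simp only [lAct_rAct_gen]
  rw [cutSum_eq_sum_range]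
  refine Finset.sum_congr rfl fun i hi => ?_
  rw [List.length_take, min_eq_left (Nat.lt_succ_iff.1 (Finset.mem_range.1 hi))]

theorem braceAlg_eval_corlTree {A : Type v} [NonUnitalRing A] [Module k A] [Dendriform k A] (n : ℕ)
    (g : Fin (n + 1) → A) : (braceAlg k A).eval g (corlTree n).1 =
      br k (g 0) ((tailVars n).map g) := by
  refine (braceAlg_eval_brace _ _ _).trans ?_
  rw [List.map_map]
  rfl

theorem psi_sendsCorollas : SendsCorollas (psi k) := by
  intro n _
  refine (braceToDend_of (corlTree n)).trans ?_
  rw [braceAlg_eval_corlTree, br_gen, map_sum, dendCorl]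
  have hl : (tailVars n).length = n := by simp [tailVars]
  rw [hl]
  refine Finset.sum_congr rfl fun i _ => ?_
  rw [map_smul]
  exact congrArg _ (FreeDend.toDend_mono (vTree n i))

end Corollas

/-! ## Uniqueness -/

section Uniqueness

variable {k : Type u} [CommRing k] {X Y : Type}

theorem brace_cons_eq_node {n : ℕ} (t a : Tm braceSig X) (l : List (Tm braceSig X))
    (h : l.length = n) : brace t (a :: l) = Tm.node (S := braceSig) n
      fun c : Fin (n + 2) => (t :: a :: l).get (c.cast (by simp [h])) := by
  subst h
  rfl

theorem brace_bind (f : X → Tm braceSig Y) (t : Tm braceSig X) (l : List (Tm braceSig X)) :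
    (brace t l).bind f = brace (t.bind f) (l.map (Tm.bind f)) := by
  cases l with
  | nil => rfl
  | cons a l =>
    rw [List.map_cons, brace_cons_eq_node _ _ (l.map (Tm.bind f)) (List.length_map _)]
    change Tm.node (S := braceSig) l.length (fun c : Fin (l.length + 2) => _) = _
    refine congrArg (Tm.node (S := braceSig) l.length) (funext fun c => ?_)
    exact (List.getElem_map (l := t :: a :: l) (i := c.1) (h := by have := c.2; simp; omega) (Tm.bind f)).symm

theorem node_eq_brace (n : ℕ) (c : Fin (n + 2) → Tm braceSig X) :
    Tm.node (S := braceSig) n c = brace (c 0) (List.ofFn fun i : Fin (n + 1) => c i.succ) := by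
  rw [List.ofFn_succ, brace_cons_eq_node _ _ _ (List.length_ofFn)]
  refine congrArg (Tm.node (S := braceSig) n) (funext fun a => ?_)
  have h : c 0 :: c (Fin.succ 0) :: List.ofFn (fun i : Fin n => c i.succ.succ) = List.ofFn c := by
    rw [List.ofFn_succ, List.ofFn_succ]
  exact (List.getElem_ofFn (f := c) (by have := a.2; simp; omega)).symm.trans (List.getElem_of_eq h.symm _)

theorem corlTree_bind (n : ℕ) (c : Fin (n + 2) → Tm braceSig X) :
    (corlTree (n + 1)).1.bind c = Tm.node (S := braceSig) n c := by
  rw [node_eq_brace]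
  refine (brace_bind c _ _).trans ?_
  rw [List.map_map, tailVars, List.map_map, List.ofFn_eq_map]
  rfl

/-- The set `E` of trees where the two morphisms agree contains the unit and the corollas and is
stable under grafting; every expression is thus a renaming of a tree in `E`. -/
theorem hom_ext_of_sendsCorollas {ψ φ : Operad.Hom (Brace k) (Dend k)} (hψ : SendsCorollas ψ)
    (hφ : SendsCorollas φ) {I : Type} [Finite I] [Nonempty I] (t : Tree braceSig I) :
    ψ.app I (presentedOperad.of k braceSig _ t) = φ.app I (presentedOperad.of k braceSig _ t) := by
  -- Over the zero ring everything is equal; otherwise 1 ≠ 0, so a tree can be recovered from its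
  -- basis vector below.
  rcases subsingleton_or_nontrivial k with hk | hk
  · have := Module.subsingleton k ((Dend k).obj I)
    exact Subsingleton.elim _ _
  let E : ∀ (I : Type) [Finite I] [Nonempty I], Set (Tree braceSig I) := fun I _ _ =>
    {t | ψ.app I (presentedOperad.of k braceSig _ t) = φ.app I (presentedOperad.of k braceSig _ t)}
  have key : ∀ {X : Type} (t : Tm braceSig X), ∃ (Y : Type) (_ : Finite Y) (_ : Nonempty Y)
      (j : Y → X) (s : Tree braceSig Y), s ∈ E Y ∧ s.1.rename j = t := by
    intro X t
    induction t using brace_induction with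
    | hvar x =>
      exact ⟨Unit, inferInstance, inferInstance, fun _ => x, Tree.one,
        ψ.app_one.trans φ.app_one.symm, rfl⟩
    | hnode n c ih =>
      obtain ⟨Y, hY, hY', j, q, ⟨s, hs, rfl⟩, hq⟩ := exists_bindL_var (k := k)
        (P := fun I _ _ => (fun t => Finsupp.single t (1 : k)) '' E I) (Q := E)
        (by
          rintro I J _ _ _ _ i _ s ⟨t, ht, rfl⟩ hs
          refine ⟨t.graft i s, ?_, by rw [freeComp_single, mul_one]⟩
          change ψ.app _ _ = φ.app _ _
          have e := presentedOperad.comp_of (k := k)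
            (R := fun I _ _ => {r | BraceRel k I r}) i t s
          refine (congrArg _ e.symm).trans (Eq.trans ?_ (congrArg _ e))
          refine (ψ.app_comp i _ _).trans (Eq.trans ?_ (φ.app_comp i _ _).symm)
          rw [ht, hs])
        (p := Finsupp.single (corlTree (n + 1)) 1)
        -- The generator labelled `n` has `n + 2` inputs, so it is the corolla of index `n + 1`.
        ⟨corlTree (n + 1), (hψ (n + 1) (by omega)).trans (hφ (n + 1) (by omega)).symm, rfl⟩
        c (fun i => Or.inr (ih i))
      refine ⟨Y, hY, hY', j, s, hs, ?_⟩
      rw [bindL_single, bindL_single, corlTree_bind] at hq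
      exact Finsupp.single_left_injective one_ne_zero hq
  obtain ⟨Y, _, _, j, s, hs, hst⟩ := key t.1
  -- The tree and its renaming both use every variable exactly once, so the renaming is a
  -- relabelling.
  have hj : Function.Bijective j := s.2.bijective (hst ▸ t.2)
  obtain rfl : s.map (Equiv.ofBijective j hj) = t := Subtype.ext hst
  have e := presentedOperad.map_of (k := k) (R := fun I _ _ => {r | BraceRel k I r})
    (Equiv.ofBijective j hj) s
  refine (congrArg _ e.symm).trans (Eq.trans ?_ (congrArg _ e))
  refine (ψ.app_map _ _).trans (Eq.trans ?_ (φ.app_map _ _).symm)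
  rw [hs]

theorem eq_psi {ψ : Operad.Hom (Brace k) (Dend k)} (hψ : SendsCorollas ψ) : ψ = psi k := by
  have h : ψ.app = (psi k).app := by
    funext I _ _
    ext p
    induction p using Brace.induction with
    | h0 => rw [map_zero, map_zero]
    | hadd p q hp hq => rw [map_add, map_add, hp, hq]
    | hsmul c p hp => rw [map_smul, map_smul, hp]
    | hof t => exact hom_ext_of_sendsCorollas hψ psi_sendsCorollas t
  cases ψ
  exact (Operad.Hom.mk.injEq ..).mpr h

end Uniqueness

/-! ## A dendriform algebra with `x ≻ y = y ≺ x` -/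

section Shuffle

variable {k : Type u} [CommRing k]

/-- The value at a word of the shuffle product of two functions on words. -/
def shuf : List ℕ → (List ℕ → k) → (List ℕ → k) → k
  | [], f, g => f [] * g []
  | x :: w, f, g => shuf w (fun v => f (x :: v)) g + shuf w f (fun v => g (x :: v))

theorem shuf_comm (w : List ℕ) (f g : List ℕ → k) : shuf w f g = shuf w g f := by
  induction w generalizing f g with
  | nil => exact mul_comm _ _
  | cons x w ih => rw [shuf, shuf, ih, ih f, add_comm]

theorem shuf_add (w : List ℕ) (f g h : List ℕ → k) :
    shuf w f (fun v => g v + h v) = shuf w f g + shuf w f h := by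
  induction w generalizing f g h with
  | nil => exact mul_add _ _ _
  | cons x w ih => simp only [shuf, ih]; abel

theorem add_shuf (w : List ℕ) (f g h : List ℕ → k) :
    shuf w (fun v => f v + g v) h = shuf w f h + shuf w g h := by
  rw [shuf_comm, shuf_add, shuf_comm, shuf_comm w h g]

theorem shuf_smul (w : List ℕ) (c : k) (f g : List ℕ → k) :
    shuf w f (fun v => c * g v) = c * shuf w f g := by
  induction w generalizing f g with
  | nil => exact mul_left_comm _ _ _
  | cons x w ih => simp only [shuf, ih, mul_add]

theorem smul_shuf (w : List ℕ) (c : k) (f g : List ℕ → k) :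
    shuf w (fun v => c * f v) g = c * shuf w f g := by
  rw [shuf_comm, shuf_smul, shuf_comm]

theorem shuf_assoc (w : List ℕ) (f g h : List ℕ → k) :
    shuf w (fun v => shuf v f g) h = shuf w f (fun v => shuf v g h) := by
  induction w generalizing f g h with
  | nil => exact mul_assoc _ _ _
  | cons x w ih => simp only [shuf, shuf_add, add_shuf, ih]; abel

theorem shuf_zero (w : List ℕ) (f : List ℕ → k) : shuf w f (fun _ => 0) = 0 := by
  simpa using shuf_smul w 0 f fun _ => 0

theorem shuf_one (w : List ℕ) (f : List ℕ → k) :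
    shuf w f (fun v => if v = [] then 1 else 0) = f w := by
  induction w generalizing f with
  | nil => simp [shuf]
  | cons x w ih => simp [shuf, ih, shuf_zero]

variable (k) in
/-- Functions on nonempty words, with the half-shuffle product. -/
def Zinb : Type u := ℕ → List ℕ → k

noncomputable instance : AddCommGroup (Zinb k) := inferInstanceAs (AddCommGroup (ℕ → List ℕ → k))

noncomputable instance : Module k (Zinb k) := inferInstanceAs (Module k (ℕ → List ℕ → k))

namespace Zinb

@[ext] theorem ext {k : Type u} {u v : Zinb k} (h : ∀ x w, u x w = v x w) : u = v :=
  funext fun x => funext fun w => h x w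

/-- The extension by zero to all words. -/
def extend (u : Zinb k) : List ℕ → k
  | [] => 0
  | x :: w => u x w

theorem extend_add (u v : Zinb k) : (u + v).extend = fun w => u.extend w + v.extend w := by
  funext w
  cases w with
  | nil => exact (add_zero 0).symm
  | cons x w => rfl

theorem extend_smul (c : k) (u : Zinb k) : (c • u).extend = fun w => c * u.extend w := by
  funext w
  cases w with
  | nil => exact (mul_zero c).symm
  | cons x w => rfl

/-- The half-shuffle product. -/
noncomputable def half : Zinb k →ₗ[k] Zinb k →ₗ[k] Zinb k :=
  LinearMap.mk₂ k (fun u v x w => shuf w u.extend (v x))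
    (fun u u' v => by
      ext x w
      simp only [extend_add, add_shuf]
      rfl)
    (fun c u v => by
      ext x w
      simp only [extend_smul, smul_shuf]
      rfl)
    (fun u v v' => by
      ext x w
      exact shuf_add w _ _ _)
    (fun c u v => by
      ext x w
      exact shuf_smul w c _ _)

theorem half_apply (u v : Zinb k) (x : ℕ) (w : List ℕ) :
    half u v x w = shuf w u.extend (v x) := rfl

/-- The first letter of a shuffle comes from one of the two factors: the half-shuffles record which
one, and their sum is the full shuffle. -/
theorem extend_half_add (u v : Zinb k) :
    (half v u + half u v).extend = fun w => shuf w u.extend v.extend := by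
  funext w
  cases w with
  | nil => exact (zero_mul _).symm
  | cons x w =>
    change shuf w v.extend (u x) + shuf w u.extend (v x) = shuf w (u x) v.extend + _
    rw [shuf_comm]
    rfl

theorem half_half (u v z : Zinb k) : half u (half v z) = half (half v u + half u v) z := by
  ext x w
  rw [half_apply, half_apply, extend_half_add, shuf_assoc]
  rfl

noncomputable instance : NonUnitalRing (Zinb k) where
  __ := (inferInstance : AddCommGroup (Zinb k))
  mul x y := half y x + half x y
  left_distrib x y z := by
    change half _ _ + half _ _ = (half _ _ + half _ _) + (half _ _ + half _ _)
    simp only [map_add, LinearMap.add_apply]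
    abel
  right_distrib x y z := by
    change half _ _ + half _ _ = (half _ _ + half _ _) + (half _ _ + half _ _)
    simp only [map_add, LinearMap.add_apply]
    abel
  zero_mul x := by
    change half _ _ + half _ _ = _
    simp only [map_zero, LinearMap.zero_apply, add_zero]
  mul_zero x := by
    change half _ _ + half _ _ = _
    simp only [map_zero, LinearMap.zero_apply, add_zero]
  mul_assoc x y z := by
    change half z (half y x + half x y) + half (half y x + half x y) z =
      half (half z y + half y z) x + half x (half z y + half y z)
    rw [← half_half x y z, ← half_half y z x, map_add, map_add, half_half z y x, half_half z x y,
      half_half y z x, half_half x z y, add_comm (half y z) (half z y),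
      add_comm (half x z) (half z x)]
    abel

theorem mul_def (x y : Zinb k) : x * y = half y x + half x y := rfl

noncomputable instance : Dendriform k (Zinb k) where
  dprec := half.flip
  dsucc := half
  mul_eq _ _ := rfl
  prec_prec x y z := by
    change half z (half y x) = half (y * z) x
    rw [half_half, mul_def, add_comm]
  succ_prec x y z := by
    change half z (half x y) = half x (half z y)
    rw [half_half, half_half, add_comm]
  succ_succ x y z := half_half x y z

theorem rAct_eq_lAct (u : Unitization k (Zinb k)) (z : Zinb k) : rAct u z = lAct u z := rfl

/-- Since ≻ and ≺ are opposite here, both actions coincide and the brace is the action on `z` of the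
convolution of `nearU` with `searU`, which is zero on nonempty lists. -/
theorem br_eq_zero (z : Zinb k) {l : List (Zinb k)} (hl : l ≠ []) : br k z l = 0 := by
  have := Dendriform.isScalarTower k (Zinb k)
  have := Dendriform.smulCommClass k (Zinb k)
  have h := map_cutSum ((lAct : Unitization k (Zinb k) →ₗ[k] _).flip z)
    (fun p q => nearU k p * searU k q) l
  rw [nearU_mul_searU, if_neg hl, map_zero] at h
  rw [br, h]
  refine cutSum_congr fun p q _ => ?_
  rw [rAct_eq_lAct, ← lAct_mul]
  rfl

variable (k) in
/-- The word with one letter. -/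
def letter (n : ℕ) : Zinb k := fun x w => if x = n then if w = [] then 1 else 0 else 0

/-- In u ≻ v the first letter comes from `v`, so multiplying by a letter on the right prepends it;
hence the reversal. -/
theorem searU_letter (l : List ℕ) : (searU k (l.map (letter k))).snd =
    fun x w => if x :: w = l.reverse then 1 else 0 := by
  induction l using List.reverseRecOn with
  | nil => rfl
  | append_singleton l y ih =>
    rw [List.map_append, List.map_singleton, searU_append_singleton, Unitization.snd_inr]
    ext x w
    have hr : (l ++ [y]).reverse = y :: l.reverse := by simp
    rw [hr]
    rcases eq_or_ne l [] with rfl | hl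
    · simp only [List.map_nil, searU_nil, lAct_one, letter, List.reverse_nil, List.cons.injEq]
      split_ifs <;> simp_all
    · have hl' : l.map (letter k) ≠ [] := by simpa using hl
      rw [lAct_apply, searU_fst k hl', zero_smul, zero_add, ih]
      change shuf w _ (letter k y x) = _
      by_cases hx : x = y
      -- With its first letter removed, a one-letter word is the empty word, the unit of the shuffle
      -- product.
      · have h1 : letter k y x = fun v => if v = [] then 1 else 0 := by
          funext v
          rw [letter, if_pos hx]
        rw [h1, shuf_one]
        cases w with
        | nil =>
          have : ¬ ([] = l.reverse) := fun h => hl (by simpa using h.symm)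
          simp [extend, hx, this]
        | cons a w => simp [extend, hx]
      · have h1 : letter k y x = fun _ => 0 := by
          funext v
          rw [letter, if_neg hx]
        rw [h1, shuf_zero]
        simp [hx]

end Zinb

end Shuffle

/-! ## Spanning of the free dendriform algebra -/

section Words

variable (k : Type u) [CommRing k] {X : Type}

/-- The product `((x₁ ≻ x₂) ≻ ⋯) ≻ xₙ`. -/
noncomputable def word (l : List X) : FreeDend k X := (searU k (l.map (FreeDend.gen k))).snd

theorem word_nil : word k ([] : List X) = 0 := Unitization.snd_one

theorem word_singleton (x : X) : word k [x] = FreeDend.gen k x := lAct_one _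

theorem word_append_singleton {l : List X} (hl : l ≠ []) (x : X) :
    word k (l ++ [x]) = FreeDend.prod .succ (word k l) (FreeDend.gen k x) := by
  rw [word, List.map_append, List.map_singleton, searU_append_singleton, Unitization.snd_inr,
    lAct_apply, searU_fst k (by simpa using hl), zero_smul, zero_add, word]
  rfl

/-- The span of the words with a given multiset of letters. -/
noncomputable def words (m : Multiset X) : Submodule k (FreeDend k X) :=
  Submodule.span k {x | ∃ l : List X, (l : Multiset X) = m ∧ word k l = x}

theorem gen_mem_deg (x : X) : FreeDend.gen k x ∈ deg k ({x} : Multiset X) :=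
  mono_mem_deg k (.var x : Tm dendSig X)

theorem sum_map_singleton_eq_coe (l : List X) :
    (l.map fun x => ({x} : Multiset X)).sum = (l : Multiset X) := by
  induction l with
  | nil => rfl
  | cons x l ih => rw [List.map_cons, List.sum_cons, ih]; rfl

theorem homogU_searU_gen (l : List X) :
    HomogU k (searU k (l.map (FreeDend.gen k))) (l : Multiset X) := by
  have h := homogU_searU (k := k) (gen_mem_deg k) l
  rwa [sum_map_singleton_eq_coe] at h

theorem HomogU.snd_mem {u : Unitization k (FreeDend k X)} {m : Multiset X} (hu : HomogU k u m) :
    u.snd ∈ deg k m := by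
  rcases hu with ⟨rfl, -⟩ | h
  · rw [Unitization.snd_one]
    exact zero_mem _
  · exact h.2

theorem word_mem_deg (l : List X) : word k l ∈ deg k (l : Multiset X) :=
  (homogU_searU_gen k l).snd_mem

theorem nearU_gen_snd_mem_deg (l : List X) :
    (nearU k (l.map (FreeDend.gen k))).snd ∈ deg k (l : Multiset X) := by
  have h := homogU_nearU (k := k) (gen_mem_deg k) l
  rw [sum_map_singleton_eq_coe] at h
  exact h.snd_mem

end Words

section Spanning

variable {k : Type u} [CommRing k] {X : Type} {N : Submodule k (FreeDend k X)}

theorem dsucc_gen_mem_words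
    {m : Multiset X} {b : FreeDend k X} (hb : b ∈ words k m) (y : X) :
    FreeDend.prod .succ b (FreeDend.gen k y) ∈ words k (m + {y}) := by
  induction hb using Submodule.span_induction with
  | zero => rw [map_zero, LinearMap.zero_apply]; exact zero_mem _
  | add x x' _ _ hx hx' =>
    rw [map_add, LinearMap.add_apply]
    exact add_mem hx hx'
  | smul c x _ hx =>
    rw [map_smul, LinearMap.smul_apply]
    exact Submodule.smul_mem _ c hx
  | mem x hx =>
    obtain ⟨l, rfl, rfl⟩ := hx
    rcases eq_or_ne l [] with rfl | hl
    · rw [word_nil, map_zero, LinearMap.zero_apply]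
      exact zero_mem _
    · rw [← word_append_singleton k hl, ← Multiset.coe_singleton, Multiset.coe_add]
      exact Submodule.subset_span ⟨l ++ [y], rfl, rfl⟩

theorem dsucc_gen_mem (hN : ∀ (e : DendGen) (x y : FreeDend k X), x ∈ N → FreeDend.prod e x y ∈ N)
    {m : Multiset X} {x : FreeDend k X} (hx : x ∈ N ⊔ words k m) (y : X) :
    FreeDend.prod .succ x (FreeDend.gen k y) ∈ N ⊔ words k (m + {y}) := by
  obtain ⟨a, ha, b, hb, rfl⟩ := Submodule.mem_sup.1 hx
  rw [map_add, LinearMap.add_apply]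
  exact add_mem (Submodule.mem_sup_left (hN .succ a _ ha))
    (Submodule.mem_sup_right (dsucc_gen_mem_words hb y))

/-- Modulo `N`, the right factor is a word. If it is l ≻ z, then x ≻ (l ≻ z) = (x * l) ≻ z, where x
* l has lower degree and is a combination of words modulo `N`; multiplying by `z` on the right
lengthens these words. If it is a single letter, the same holds for `x` directly. -/
theorem dsucc_mem_of_forall_lt
    (hl : ∀ (e : DendGen) (x y : FreeDend k X), x ∈ N → FreeDend.prod e x y ∈ N)
    (hr : ∀ (e : DendGen) (x y : FreeDend k X), y ∈ N → FreeDend.prod e x y ∈ N)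
    {m n : Multiset X} (ih : ∀ p : Multiset X, p.card < (m + n).card → deg k p ≤ N ⊔ words k p)
    (hm : m ≠ 0) (hn : n ≠ 0) {x y : FreeDend k X} (hx : x ∈ deg k m) (hy : y ∈ deg k n) :
    FreeDend.prod .succ x y ∈ N ⊔ words k (m + n) := by
  have hm' := Multiset.card_pos.2 hm
  have hn' := Multiset.card_pos.2 hn
  rw [Multiset.card_add] at ih
  obtain ⟨a, ha, b, hb, rfl⟩ := Submodule.mem_sup.1 (ih n (by omega) hy)
  rw [map_add]
  refine add_mem (Submodule.mem_sup_left (hr .succ x a ha)) ?_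
  refine (Submodule.span_le (p := (N ⊔ words k (m + n)).comap (FreeDend.prod .succ x))).2 ?_ hb
  rintro _ ⟨l, rfl, rfl⟩
  change FreeDend.prod .succ x (word k l) ∈ N ⊔ words k _
  rw [Multiset.coe_card] at hn'
  obtain ⟨l, z, rfl⟩ := (List.eq_nil_or_concat' l).resolve_left (List.ne_nil_of_length_pos hn')
  rw [← Multiset.coe_add, ← add_assoc]
  rcases eq_or_ne l [] with rfl | hl0
  · rw [List.nil_append, word_singleton, Multiset.coe_nil, add_zero]
    exact dsucc_gen_mem hl (ih m (by simp) hx) z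
  · rw [word_append_singleton k hl0, FreeDend.succ_succ']
    refine dsucc_gen_mem hl (ih _ ?_ ?_) z
    · simp
    · exact add_mem (prod_mem_deg k .prec hx (word_mem_deg k l))
        (prod_mem_deg k .succ hx (word_mem_deg k l))

/-- z ≺ ↘(l) is the term with empty left piece in the brace {z ∣ l}, which lies in `N`. All other
terms are products ≻ of factors of lower degree, already treated. -/
theorem dprec_gen_word_mem_of_forall_lt
    (hl : ∀ (e : DendGen) (x y : FreeDend k X), x ∈ N → FreeDend.prod e x y ∈ N)
    (hr : ∀ (e : DendGen) (x y : FreeDend k X), y ∈ N → FreeDend.prod e x y ∈ N)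
    (hbr : ∀ (z : X) (l : List X), l ≠ [] → br k (FreeDend.gen k z) (l.map (FreeDend.gen k)) ∈ N)
    (z y : X) (l : List X) (ih : ∀ p : Multiset X,
      p.card < ({z} + (y :: l : List X) : Multiset X).card → deg k p ≤ N ⊔ words k p) :
    FreeDend.prod .prec (FreeDend.gen k z) (word k (y :: l)) ∈ N ⊔ words k ({z} + (y :: l : List X)) := by
  have h := hbr z (y :: l) (List.cons_ne_nil _ _)
  rw [br, cutSum_map, cutSum] at h
  have h0 : lAct (nearU k (([] : List X).map (FreeDend.gen k)))
      (rAct (searU k ((y :: l).map (FreeDend.gen k))) (FreeDend.gen k z)) =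
        FreeDend.prod .prec (FreeDend.gen k z) (word k (y :: l)) := by
    rw [List.map_nil, nearU_nil, lAct_one, rAct_apply, searU_fst k (by simp), zero_smul, zero_add,
      word]
    rfl
  rw [h0] at h
  refine (Submodule.add_mem_iff_left _ ?_).1 (Submodule.mem_sup_left (T := words k _) h)
  refine cutSum_mem _ fun p q hpq => ?_
  rw [lAct_apply, nearU_fst k (by simp), zero_smul, zero_add]
  have hdeg : (({z} : Multiset X) + (y :: l : List X)) =
      (y :: p : List X) + ({z} + (q : Multiset X)) := by
    rw [← hpq, ← List.cons_append, ← Multiset.coe_add, add_left_comm]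
  rw [hdeg] at ih ⊢
  exact dsucc_mem_of_forall_lt hl hr ih (by simp) (by simp) (nearU_gen_snd_mem_deg k (y :: p))
    ((homogU_searU_gen k q).rAct_mem (gen_mem_deg k z))

/-- Modulo `N`, the left factor is a word. If it is s ≻ z, then (s ≻ z) ≺ y = s ≻ (z ≺ y) is a
product ≻. If it is a letter, replace `y` by words modulo `N` and use the brace formula. -/
theorem dprec_mem_of_forall_lt
    (hl : ∀ (e : DendGen) (x y : FreeDend k X), x ∈ N → FreeDend.prod e x y ∈ N)
    (hr : ∀ (e : DendGen) (x y : FreeDend k X), y ∈ N → FreeDend.prod e x y ∈ N)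
    (hbr : ∀ (z : X) (l : List X), l ≠ [] → br k (FreeDend.gen k z) (l.map (FreeDend.gen k)) ∈ N)
    {m n : Multiset X} (ih : ∀ p : Multiset X, p.card < (m + n).card → deg k p ≤ N ⊔ words k p)
    (hm : m ≠ 0) (hn : n ≠ 0) {x y : FreeDend k X} (hx : x ∈ deg k m) (hy : y ∈ deg k n) :
    FreeDend.prod .prec x y ∈ N ⊔ words k (m + n) := by
  have hm' := Multiset.card_pos.2 hm
  have hn' := Multiset.card_pos.2 hn
  have hc := Multiset.card_add m n
  obtain ⟨a, ha, b, hb, rfl⟩ := Submodule.mem_sup.1 (ih m (by omega) hx)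
  rw [map_add, LinearMap.add_apply]
  refine add_mem (Submodule.mem_sup_left (hl .prec a y ha)) ?_
  refine (Submodule.span_le (p := (N ⊔ words k (m + n)).comap ((FreeDend.prod .prec).flip y))).2 ?_ hb
  rintro _ ⟨s, rfl, rfl⟩
  change FreeDend.prod .prec (word k s) y ∈ N ⊔ words k _
  rw [Multiset.coe_card] at hm'
  obtain ⟨s, z, rfl⟩ := (List.eq_nil_or_concat' s).resolve_left (List.ne_nil_of_length_pos hm')
  rw [← Multiset.coe_add, add_assoc] at ih ⊢
  rcases eq_or_ne s [] with rfl | hs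
  · rw [List.nil_append, word_singleton]
    rw [Multiset.coe_nil, zero_add] at ih ⊢
    obtain ⟨a', ha', b', hb', rfl⟩ := Submodule.mem_sup.1 (ih n (by simp) hy)
    rw [map_add]
    refine add_mem (Submodule.mem_sup_left (hr .prec _ a' ha')) ?_
    refine (Submodule.span_le
      (p := (N ⊔ words k _).comap (FreeDend.prod .prec (FreeDend.gen k z)))).2 ?_ hb'
    rintro _ ⟨t, rfl, rfl⟩
    obtain ⟨w, t, rfl⟩ := List.exists_cons_of_ne_nil (fun h => hn (congrArg _ h))
    exact dprec_gen_word_mem_of_forall_lt hl hr hbr z w t ih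
  · rw [word_append_singleton k hs, FreeDend.succ_prec']
    exact dsucc_mem_of_forall_lt hl hr ih (by simpa using hs) (by simp) (word_mem_deg k s)
      (prod_mem_deg k .prec (gen_mem_deg k z) hy)

/-- Modulo the braces of generators, the free dendriform algebra is spanned by words. -/
theorem deg_le_sup_words
    (hl : ∀ (e : DendGen) (x y : FreeDend k X), x ∈ N → FreeDend.prod e x y ∈ N)
    (hr : ∀ (e : DendGen) (x y : FreeDend k X), y ∈ N → FreeDend.prod e x y ∈ N)
    (hbr : ∀ (z : X) (l : List X), l ≠ [] → br k (FreeDend.gen k z) (l.map (FreeDend.gen k)) ∈ N)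
    (m : Multiset X) : deg k m ≤ N ⊔ words k m := by
  induction hm : m.card using Nat.strong_induction_on generalizing m with
  | _ n ih =>
    subst hm
    refine Submodule.span_le.2 ?_
    rintro _ ⟨t, rfl, rfl⟩
    induction t using dend_induction with
    | hvar x =>
      refine Submodule.mem_sup_right (Submodule.subset_span ⟨[x], ?_, word_singleton k x⟩)
      rw [Tm.leaves]
    | hbin e s t _ _ =>
      rw [leaves_bin, ← Multiset.coe_add] at ih ⊢
      have hs : (s.leaves : Multiset X) ≠ 0 := by simpa using s.leaves_ne_nil
      have ht : (t.leaves : Multiset X) ≠ 0 := by simpa using t.leaves_ne_nil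
      rw [← FreeDend.prod_mono]
      have ih' := fun (p : Multiset X) hp => ih _ hp p rfl
      cases e
      · exact dprec_mem_of_forall_lt hl hr hbr ih' hs ht (mono_mem_deg k s) (mono_mem_deg k t)
      · exact dsucc_mem_of_forall_lt hl hr ih' hs ht (mono_mem_deg k s) (mono_mem_deg k t)

theorem mem_sup_span_range_word
    (hl : ∀ (e : DendGen) (x y : FreeDend k X), x ∈ N → FreeDend.prod e x y ∈ N)
    (hr : ∀ (e : DendGen) (x y : FreeDend k X), y ∈ N → FreeDend.prod e x y ∈ N)
    (hbr : ∀ (z : X) (l : List X), l ≠ [] → br k (FreeDend.gen k z) (l.map (FreeDend.gen k)) ∈ N)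
    (x : FreeDend k X) : x ∈ N ⊔ Submodule.span k (Set.range (word k : List X → _)) := by
  induction x using FreeDend.induction_mono with
  | h0 => exact zero_mem _
  | hadd x y hx hy => exact add_mem hx hy
  | hsmul c x hx => exact Submodule.smul_mem _ c hx
  | hmono t =>
    refine sup_le_sup_left (Submodule.span_mono ?_) N
      (deg_le_sup_words hl hr hbr _ (mono_mem_deg k t))
    rintro _ ⟨l, -, rfl⟩
    exact ⟨l, rfl⟩

end Spanning

/-! ## Left ideals of `Dend` -/

section LeftIdeals

variable {k : Type u} [CommRing k]

variable (k) in
/-- The projection of the free operad onto `Dend`. -/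
noncomputable def dendMk (I : Type) [Finite I] [Nonempty I] :
    (freeOperad k dendSig).obj I →ₗ[k] (Dend k).obj I :=
  Submodule.mkQ ((dendIdeal k).carrier I)

theorem dendMk_surjective (I : Type) [Finite I] [Nonempty I] :
    Function.Surjective (dendMk k I) := Submodule.mkQ_surjective _

/-- The preimage in the free operad. -/
noncomputable def dendComap (𝒥 : (Dend k).SubSModule) : (freeOperad k dendSig).SubSModule where
  carrier I _ _ := (𝒥.carrier I).comap (dendMk k I)
  map_mem σ _ hp := 𝒥.map_mem σ hp

theorem dendComap_isLeftIdeal {𝒥 : (Dend k).SubSModule} (h𝒥 : 𝒥.IsLeftIdeal) :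
    (dendComap 𝒥).IsLeftIdeal := fun I J _ _ _ _ i e f hf =>
  h𝒥 i (dendMk k I e) (dendMk k J f) hf

/-- The elements of the free dendriform algebra given by the operations in `𝒥`. -/
noncomputable def freeIdeal (𝒥 : (Dend k).SubSModule) (X : Type) : Submodule k (FreeDend k X) :=
  (renames (dendComap 𝒥) X).map FreeDend.mk

variable {X : Type}

/-- A left ideal of the operad gives a two-sided ideal of each free algebra; this is all the
rewriting to words needs from `𝒥`. -/
theorem prod_mem_freeIdeal_left {𝒥 : (Dend k).SubSModule} (h𝒥 : 𝒥.IsLeftIdeal) (e : DendGen)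
    (x y : FreeDend k X) (hx : x ∈ freeIdeal 𝒥 X) : FreeDend.prod e x y ∈ freeIdeal 𝒥 X := by
  obtain ⟨f, hf, rfl⟩ := hx
  obtain ⟨g, rfl⟩ := FreeDend.mk_surjective y
  exact ⟨binL e f g, binL_mem_of_left (dendComap_isLeftIdeal h𝒥) e hf g, rfl⟩

theorem prod_mem_freeIdeal_right {𝒥 : (Dend k).SubSModule} (h𝒥 : 𝒥.IsLeftIdeal) (e : DendGen)
    (x y : FreeDend k X) (hy : y ∈ freeIdeal 𝒥 X) : FreeDend.prod e x y ∈ freeIdeal 𝒥 X := by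
  obtain ⟨f, rfl⟩ := FreeDend.mk_surjective x
  obtain ⟨g, hg, rfl⟩ := hy
  exact ⟨binL e f g, binL_mem_of_right (dendComap_isLeftIdeal h𝒥) e f hg, rfl⟩

theorem toDend_mem {𝒥 : (Dend k).SubSModule} {I : Type} [Finite I] [Nonempty I]
    {x : FreeDend k I} (hx : x ∈ freeIdeal 𝒥 I) : FreeDend.toDend x ∈ 𝒥.carrier I := by
  obtain ⟨f, hf, rfl⟩ := hx
  exact linearPart_mem hf

theorem toDend_mk_bindL_var {I : Type} [Finite I] [Nonempty I]
    (p : (freeOperad k dendSig).obj I) : FreeDend.toDend (FreeDend.mk (bindL .var p)) =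
      dendMk k I p :=
  congrArg (dendMk k I) (linearPart_bindL_var p)

theorem lift_mk_bindL_var {B : Type v} [NonUnitalRing B] [Module k B] [Dendriform k B] {Y : Type}
    (g : X → B) (j : Y → X) (p : Tree dendSig Y →₀ k) :
    FreeDend.lift g (FreeDend.mk (bindL (fun y => .var (j y)) p)) =
      (dendAlg k B).evalL (fun y => g (j y)) p :=
  (dendAlg k B).linearCombination_bindL _ g p

variable (k) in
/-- The combination of trees that defines `dendCorl`. -/
noncomputable def corlSum (n : ℕ) : Tree dendSig (Fin (n + 1)) →₀ k :=
  ∑ i ∈ Finset.range (n + 1), (-1 : k) ^ i • Finsupp.single (vTree n i) 1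

theorem dendMk_corlSum (n : ℕ) : dendMk k (Fin (n + 1)) (corlSum k n) = dendCorl k n := by
  let φ : (Tree dendSig (Fin (n + 1)) →₀ k) →ₗ[k] (Dend k).obj (Fin (n + 1)) :=
    dendMk k (Fin (n + 1))
  change φ _ = _
  rw [corlSum, map_sum, dendCorl]
  refine Finset.sum_congr rfl fun i _ => ?_
  rw [map_smul]
  rfl

theorem mk_bindL_corlSum (n : ℕ) (j : Fin (n + 1) → X) :
    FreeDend.mk (bindL (fun y => .var (j y)) (corlSum k n)) =
      br k (FreeDend.gen k (j 0)) (((tailVars n).map j).map (FreeDend.gen k)) := by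
  have hl : (tailVars n).length = n := by simp [tailVars]
  have h := (FreeDend.lift_isDendHom (k := k) fun y => FreeDend.gen k (j y)).map_br
    (FreeDend.gen k 0) ((tailVars n).map (FreeDend.gen k))
  rw [FreeDend.lift_gen, List.map_map] at h
  have hc : (FreeDend.lift (k := k) fun y => FreeDend.gen k (j y)) ∘ FreeDend.gen k =
      FreeDend.gen k ∘ j := funext fun y => FreeDend.lift_gen _ y
  rw [List.map_map, ← hc, ← h, br_gen, hl, corlSum]
  simp only [map_sum, map_smul, bindL_single]
  refine Finset.sum_congr rfl fun i _ => ?_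
  rw [FreeDend.lift_mono, ← Alg.eval_rename, FreeDend.eval_gen]
  rfl

theorem br_gen_mem_freeIdeal {𝒥 : (Dend k).SubSModule}
    (h𝒥 : ∀ n, 1 ≤ n → dendCorl k n ∈ 𝒥.carrier (Fin (n + 1))) (z : X) (l : List X) (hl : l ≠ []) :
    br k (FreeDend.gen k z) (l.map (FreeDend.gen k)) ∈ freeIdeal 𝒥 X := by
  -- The brace of generators is the corolla operation with inputs renamed to the entries of `z ::
  -- l`; repeated letters are allowed.
  have h := mk_bindL_corlSum (k := k) l.length fun i : Fin (l.length + 1) => (z :: l).get i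
  have hmap : ((tailVars l.length).map fun i : Fin (l.length + 1) => (z :: l).get i) = l := by
    rw [tailVars, List.map_map]
    exact List.map_get_finRange l
  rw [hmap] at h
  refine ⟨_, bindL_var_mem_renames (𝒥 := dendComap 𝒥) _ ?_, h⟩
  change dendMk k _ (corlSum k l.length) ∈ 𝒥.carrier _
  rw [dendMk_corlSum]
  exact h𝒥 _ (List.length_pos_iff.2 hl)

end LeftIdeals

/-! ## The ideal generated by the image of `Brace₊` -/

section Ideal

variable (k : Type u) [CommRing k]

/-- The operations of `Dend` that vanish on the half-shuffle algebra. -/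
noncomputable def zinbKernel : (Dend k).SubSModule where
  carrier I _ _ := ((dendAlg k (Zinb k)).kernel.carrier I).map (dendMk k I)
  map_mem := by
    rintro I J _ _ _ _ σ _ ⟨p, hp, rfl⟩
    exact ⟨_, (dendAlg k (Zinb k)).kernel.map_mem σ hp, rfl⟩

variable {k}

theorem zinbKernel_isIdeal : (zinbKernel k).IsIdeal := by
  rintro I J _ _ _ _ i e f (⟨e, he, rfl⟩ | ⟨f, hf, rfl⟩)
  · obtain ⟨f, rfl⟩ := dendMk_surjective J f
    exact ⟨_, (dendAlg k (Zinb k)).kernel_isIdeal i e f (Or.inl he), rfl⟩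
  · obtain ⟨e, rfl⟩ := dendMk_surjective I e
    exact ⟨_, (dendAlg k (Zinb k)).kernel_isIdeal i e f (Or.inr hf), rfl⟩

/-- Vanishing does not depend on the representative, because two representatives differ by a
consequence of the dendriform relations. -/
theorem evalL_eq_zero_of_mem_zinbKernel {I : Type} [Finite I] [Nonempty I]
    {p : (freeOperad k dendSig).obj I} (hp : dendMk k I p ∈ (zinbKernel k).carrier I)
    (g : I → Zinb k) : (dendAlg k (Zinb k)).evalL g p = 0 := by
  obtain ⟨q, hq, hqp⟩ := hp
  have h : q - p ∈ (dendIdeal k).carrier I := (Submodule.Quotient.eq _).1 hqp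
  let φ : (freeOperad k dendSig).obj I →ₗ[k] Zinb k := (dendAlg k (Zinb k)).evalL g
  have h0 : φ (q - p) = 0 := dendAlg_evalL_eq_zero h g
  have h1 : φ q = 0 := (dendAlg k (Zinb k)).mem_kernel.1 hq g
  rw [map_sub, h1, zero_sub, neg_eq_zero] at h0
  exact h0

theorem exists_mk_bindL_var {X : Type} {x : FreeDend k X} (hx : x ∈ multilinear k X) :
    ∃ p : Tree dendSig X →₀ k, FreeDend.mk (bindL .var p) = x := by
  refine (Submodule.span_le (p := LinearMap.range
    ((FreeDend.mk : _ →ₗ[k] FreeDend k X) ∘ₗ bindL .var))).2 ?_ hx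
  rintro _ ⟨t, rfl⟩
  refine ⟨Finsupp.single t 1, ?_⟩
  rw [LinearMap.comp_apply, bindL_single, Tm.bind_var]
  rfl

/-- With at least two inputs the root is a corolla, so the value is a brace with a nonempty list of
arguments, whatever is below. -/
theorem Zinb.brace_eval_eq_zero {I : Type} [Finite I] [Nonempty I] (hI : 2 ≤ Nat.card I)
    (t : Tree braceSig I) (g : I → Zinb k) : (braceAlg k (Zinb k)).eval g t.1 = 0 := by
  obtain ⟨t, ht⟩ := t
  cases t using brace_induction with
  | hvar x =>
    have : Subsingleton I := ⟨fun a b => by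
      have ha := ht.2 a
      have hb := ht.2 b
      rw [Tm.leaves, List.mem_singleton] at ha hb
      rw [ha, hb]⟩
    have := Nat.card_of_subsingleton x
    omega
  | hnode n c =>
    rw [braceAlg_eval_node]
    exact Zinb.br_eq_zero _ (by simp)

theorem imagePlus_subset_zinbKernel (I : Type) [Finite I] [Nonempty I] :
    imagePlus (psi k) I ⊆ (zinbKernel k).carrier I := by
  rintro _ ⟨hI, b, rfl⟩
  induction b using Brace.induction with
  | h0 =>
    rw [map_zero]
    exact zero_mem _
  | hadd p q hp hq =>
    rw [map_add]
    exact add_mem hp hq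
  | hsmul c p hp =>
    rw [map_smul]
    exact Submodule.smul_mem _ c hp
  | hof t =>
    obtain ⟨p, hp⟩ := exists_mk_bindL_var (brace_eval_mem_multilinear (k := k) t)
    refine ⟨p, (dendAlg k (Zinb k)).mem_kernel.2 fun g => ?_, ?_⟩
    · refine (lift_mk_bindL_var g id p).symm.trans ?_
      refine (congrArg _ hp).trans ?_
      rw [(FreeDend.lift_isDendHom g).map_brace_eval]
      simp only [FreeDend.lift_gen]
      exact Zinb.brace_eval_eq_zero hI t g
    · refine (toDend_mk_bindL_var p).symm.trans ((congrArg _ hp).trans ?_)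
      exact (braceToDend_of t).symm

theorem leftIdealSpan_le_zinbKernel {I : Type} [Finite I] [Nonempty I] {y : (Dend k).obj I}
    (hy : y ∈ ((Dend k).leftIdealSpan (imagePlus (psi k))).carrier I) :
    y ∈ (zinbKernel k).carrier I :=
  Operad.mem_spanOf.1 hy _ (fun _ _ _ _ _ _ i e f hf => zinbKernel_isIdeal i e f (Or.inr hf))
    fun I _ _ => imagePlus_subset_zinbKernel I

theorem lift_letter_word {X : Type} (enc : X → ℕ) (l : List X) :
    FreeDend.lift (fun x => Zinb.letter k (enc x)) (word k l) =
      fun x w => if x :: w = (l.map enc).reverse then 1 else 0 := by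
  have h := ((FreeDend.lift_isDendHom fun x => Zinb.letter k (enc x)).map_searU
    (l.map (FreeDend.gen k))).2
  have hc : (FreeDend.lift fun x => Zinb.letter k (enc x)) ∘ FreeDend.gen k =
      Zinb.letter k ∘ enc := funext fun x => FreeDend.lift_gen (fun x => Zinb.letter k (enc x)) x
  rw [word, ← h, List.map_map, hc, ← Zinb.searU_letter, List.map_map]

/-- The coefficient of a nonempty word is read off as the value of the image at the reversed encoded
word, since distinct words have distinct reversed encodings. -/
theorem eq_zero_of_lift_letter_eq_zero {X : Type} {enc : X → ℕ} (henc : Function.Injective enc)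
    {y : FreeDend k X} (hy : y ∈ Submodule.span k (Set.range (word k : List X → _)))
    (h : FreeDend.lift (fun x => Zinb.letter k (enc x)) y = 0) : y = 0 := by
  obtain ⟨c, rfl⟩ := Finsupp.mem_span_range_iff_exists_finsupp.1 hy
  refine Finset.sum_eq_zero fun l _ => ?_
  rcases eq_or_ne l [] with rfl | hl
  -- The empty word denotes 0, so its coefficient is irrelevant.
  · exact (congrArg _ (word_nil k)).trans (smul_zero _)
  suffices hc : c l = 0 by
    change c l • _ = _
    rw [hc, zero_smul]
  obtain ⟨x, w, hxw⟩ := List.exists_cons_of_ne_nil (l := (l.map enc).reverse) (by simpa using hl)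
  let ev : Zinb k →ₗ[k] k :=
    { toFun := fun u => u x w, map_add' := fun _ _ => rfl, map_smul' := fun _ _ => rfl }
  have h' := congrArg ev h
  rw [map_finsuppSum, map_finsuppSum, map_zero] at h'
  rw [← h', Finsupp.sum, Finset.sum_eq_single l]
  · rw [map_smul, map_smul, lift_letter_word]
    change c l = c l * (if x :: w = (l.map enc).reverse then 1 else 0)
    rw [if_pos hxw.symm, mul_one]
  · intro m _ hm
    rw [map_smul, map_smul, lift_letter_word]
    change c m * (if x :: w = (m.map enc).reverse then 1 else 0) = 0
    rw [if_neg, mul_zero]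
    rw [← hxw]
    exact fun he => hm (henc.list_map (List.reverse_injective he)).symm
  · intro hl'
    rw [Finsupp.notMem_support_iff.1 hl', zero_smul, map_zero, map_zero]

theorem lift_eq_zero_of_mem_freeIdeal {𝒥 : (Dend k).SubSModule}
    (h𝒥 : ∀ (I : Type) [Finite I] [Nonempty I], 𝒥.carrier I ≤ (zinbKernel k).carrier I) {X : Type}
    (g : X → Zinb k) {x : FreeDend k X} (hx : x ∈ freeIdeal 𝒥 X) : FreeDend.lift g x = 0 := by
  obtain ⟨f, hf, rfl⟩ := hx
  refine LinearMap.mem_ker.1 ((Submodule.span_le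
    (p := LinearMap.ker (FreeDend.lift g ∘ₗ FreeDend.mk))).2 ?_ hf)
  rintro _ ⟨Y, _, _, j, p, hp, rfl⟩
  exact (lift_mk_bindL_var g j p).trans (evalL_eq_zero_of_mem_zinbKernel (h𝒥 Y hp) _)

theorem dendCorl_mem_leftIdealSpan (n : ℕ) (hn : 1 ≤ n) :
    dendCorl k n ∈ ((Dend k).leftIdealSpan (imagePlus (psi k))).carrier (Fin (n + 1)) := by
  refine Operad.mem_spanOf.2 fun 𝒥 _ h𝒥 => h𝒥 _ ⟨?_, corl k n, psi_sendsCorollas n hn⟩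
  rw [Nat.card_fin]
  omega

/-- Write an element of the kernel as `a + b` in the free algebra, `a` coming from the left ideal
and `b` a combination of words. Both the element and `a` vanish on `Zinb k`, so `b` does, hence `b =
0`; projecting `a` to its multilinear part gives membership. -/
theorem leftIdealSpan_carrier_eq (I : Type) [Finite I] [Nonempty I] :
    ((Dend k).leftIdealSpan (imagePlus (psi k))).carrier I = (zinbKernel k).carrier I := by
  refine le_antisymm (fun y => leftIdealSpan_le_zinbKernel) ?_
  rintro _ ⟨p, hp, rfl⟩
  have hleft := Operad.leftIdealSpan_isLeftIdeal (P := Dend k) (imagePlus (psi k))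
  obtain ⟨a, ha, b, hb, hab⟩ := Submodule.mem_sup.1 (mem_sup_span_range_word
    (prod_mem_freeIdeal_left hleft) (prod_mem_freeIdeal_right hleft)
    (br_gen_mem_freeIdeal dendCorl_mem_leftIdealSpan) (FreeDend.mk (bindL .var p)))
  -- Assign a different letter of `Zinb k` to each input, so that distinct words are told apart.
  obtain ⟨enc, henc⟩ := Countable.exists_injective_nat I
  have h0 : FreeDend.lift (fun x => Zinb.letter k (enc x)) (FreeDend.mk (bindL .var p)) = 0 :=
    (lift_mk_bindL_var _ id p).trans ((dendAlg k (Zinb k)).mem_kernel.1 hp _)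
  rw [← hab, map_add, lift_eq_zero_of_mem_freeIdeal (fun I _ _ _ => leftIdealSpan_le_zinbKernel) _ ha,
    zero_add] at h0
  rw [eq_zero_of_lift_letter_eq_zero henc hb h0, add_zero] at hab
  rw [← toDend_mk_bindL_var, ← hab]
  exact toDend_mem ha

theorem leftIdealSpan_isIdeal :
    ((Dend k).leftIdealSpan (imagePlus (psi k))).IsIdeal := by
  intro I J _ _ _ _ i e f h
  rw [leftIdealSpan_carrier_eq, leftIdealSpan_carrier_eq] at h
  rw [leftIdealSpan_carrier_eq]
  exact zinbKernel_isIdeal i e f h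

end Ideal

end BraceDend

theorem mainTheorem11 {k : Type*} [CommRing k] :
    (∃! ψ : BraceDend.Operad.Hom (BraceDend.Brace k) (BraceDend.Dend k),
        BraceDend.SendsCorollas ψ) ∧
      ∀ ψ : BraceDend.Operad.Hom (BraceDend.Brace k) (BraceDend.Dend k),
        BraceDend.SendsCorollas ψ →
          ((BraceDend.Dend k).leftIdealSpan (BraceDend.imagePlus ψ)).IsIdeal := by
  refine ⟨⟨BraceDend.psi k, BraceDend.psi_sendsCorollas, fun ψ hψ => BraceDend.eq_psi hψ⟩,
    fun ψ hψ => ?_⟩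
  rw [BraceDend.eq_psi hψ]
  exact BraceDend.leftIdealSpan_isIdeal
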